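/- Let $V$ be a cocomplete closed symmetric monoidal category and let $n\ge 0$. **Trees.** An $n$-tree $T$ is a chain $[k_n]\to[k_{n-1}]\to\dots\to[k_0]=[1]$ of order-preserving maps of finite ordinals; $|T|=k_n$ is its number of tips. A morphism of $n$-trees is a family of maps of sets, commuting with the structure maps and order-preserving on the fibers of the structure maps; $U_n$ is the tree $[1]\to\dots\to[1]$. For a morphism $\sigma:T\to S$ and a tip $i\in\{1,\dots,|S|\}$, the fiber $T_i$ is the $n$-tree obtained as the levelwise pullback of $\sigma$ along the unique morphism $U_n\to S$ which hits $i$, with the order induced from $T$. **$n$-operads.** An $n$-operad $A$ in $V$ consists of objects $A_T$ for all $n$-trees $T$, a unit $e:I\to A_{U_n}$, and multiplications $m_\sigma:A_S\otimes A_{T_1}\otimes\dots\otimes A_{T_{|S|}}\to A_T$ for all morphisms $\sigma:T\to S$ of $n$-trees, associative for composable pairs $T\to S\to R$ and unital for identities and for the morphisms $T\to U_n$. An $A$-algebra is an object $x\in V$ with maps $A_T\otimes x^{\otimes|T|}\to x$ compatible with $e$ and with all $m_\sigma$, where in the compatibility with $m_\sigma$ the factors of $x^{\otimes|T|}$ are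 distributed, by the symmetry of $V$, over the fibers of the map $|\sigma|$ induced by $\sigma$ on tips, preserving the order inside each fiber. (Equivalently, a map of $n$-operads from $A$ to the endomorphism $n$-operad $End_n(x)$, $End_n(x)_T=\underline{V}(x^{\otimes|T|},x)$.) Morphisms of algebras are the maps in $V$ commuting with the actions. **Symmetric operads.** A (left) symmetric operad $B$ in $V$ consists of objects $B_m$, $m\ge0$, with a left action of the symmetric group on $m$ letters, a unit $I\to B_1$, and multiplications $B_k\otimes B_{m_1}\otimes\dots\otimes B_{m_k}\to B_m$ for order-preserving maps $\sigma:[m]\to[k]$ with fibers $[m_1],\dots,[m_k]$, associative, unital, and equivariant (for permutations of the fibers as blocks and for permutations inside the fibers). A $B$-algebra is an object $x$ with unital, associative and equivariant maps $B_m\otimes x^{\otimes m}\to x$. The symmetric groups act so that, for the endomorphism operad, $\pi\in\Sigma_m$ sends $f(x_1,\dots,x_m)$ to $f(x_{\pi(1)},\dots,x_{\pi(m)})$. **Desymmetrisation.** Every map $\sigma:[m]\to[k]$ factors uniquely as $\sigma=\nu(\sigma)\circ\pi(\sigma)$ with $\nu(\sigma)$ order-preserving and $\pi(\sigma)$ a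 bijection which is order-preserving on the fibers of $\sigma$. The functor $Des_n$ from symmetric operads to $n$-operads is given by $Des_n(B)_T=B_{|T|}$, where the multiplication along $\sigma:T\to S$ is the multiplication of $B$ along $\nu(|\sigma|)$ followed by the action of $\pi(|\sigma|)^{-1}$. **Theorem.** The functor $Des_n$ has a left adjoint. For every left adjoint $Sym_n$ of $Des_n$ and every $n$-operad $A$ in $V$, the symmetric operad $Sym_n(A)$ is a solution of the symmetrisation problem for $A$: 1. the forgetful functor from $A$-algebras to $V$ is monadic, and the corresponding monad on $V$ (the $n$-fold suspension) is isomorphic to the monad on $V$ of the symmetric operad $Sym_n(A)$, that is, the free $Sym_n(A)$-algebra monad, whose category of algebras is equivalent to the category of $Sym_n(A)$-algebras via the comparison functor; 2. restriction along the unit $A\to Des_n(Sym_n(A))$ of the adjunction, which keeps the underlying object $x$ and replaces the actions $Sym_n(A)_{|T|}\otimes x^{\otimes|T|}\to x$ by the composites $A_T\otimes x^{\otimes|T|}\to Sym_n(A)_{|T|}\otimes x^{\otimes|T|}\to x$, is an isomorphism from the category of $Sym_n(A)$-algebras to the category of $A$-algebras. -/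

import Mathlib

open CategoryTheory MonoidalCategory Limits

universe v u

namespace HigherOperad

/-! ### Iterated tensor products over finite ordered families -/

section Tensor

variable {V : Type u} [Category.{v} V] [MonoidalCategory V]

/-- The iterated tensor product `X i₁ ⊗ (X i₂ ⊗ (⋯ ⊗ (X iₗ ⊗ 𝟙_)))` along the list `[i₁, …, iₗ]`. -/
def tens {ι : Type} (X : ι → V) : List ι → V
  | [] => 𝟙_ V
  | i :: L => X i ⊗ tens X L

/-- Functoriality of the iterated tensor product. -/
def tensHom {ι : Type} {X Y : ι → V} (f : ∀ i, X i ⟶ Y i) : ∀ L : List ι, tens X L ⟶ tens Y L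
  | [] => 𝟙 _
  | i :: L => f i ⊗ₘ tensHom f L

theorem tensHom_id {ι : Type} (X : ι → V) :
    ∀ L : List ι, tensHom (fun i => 𝟙 (X i)) L = 𝟙 (tens X L)
  | [] => rfl
  | i :: L => by rw [tensHom, tensHom_id X L]; exact id_tensorHom_id _ _

theorem tensHom_comp {ι : Type} {X Y Z : ι → V} (f : ∀ i, X i ⟶ Y i) (g : ∀ i, Y i ⟶ Z i) :
    ∀ L : List ι, tensHom (fun i => f i ≫ g i) L = tensHom f L ≫ tensHom g L
  | [] => (Category.comp_id _).symm
  | i :: L => by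
    rw [tensHom, tensHom_comp f g L]
    exact (tensorHom_comp_tensorHom _ _ _ _).symm

/-- The canonical isomorphism from a tensor product of unit objects to the unit object. -/
def tensUnit {ι : Type} : ∀ L : List ι, tens (fun _ => 𝟙_ V) L ⟶ 𝟙_ V
  | [] => 𝟙 _
  | _ :: L => (λ_ _).hom ≫ tensUnit L

/-- The associativity isomorphism splitting a concatenation. -/
def split {ι : Type} (X : ι → V) (L' : List ι) :
    ∀ L : List ι, tens X (L ++ L') ⟶ tens X L ⊗ tens X L'
  | [] => (λ_ _).inv
  | i :: L => X i ◁ split X L' L ≫ (α_ _ _ _).inv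

/-- Reindexing along a function: both sides are the tensor product of the same objects in the same
order. -/
def unmap {ι κ : Type} (f : ι → κ) (X : κ → V) :
    ∀ L : List ι, tens X (L.map f) ⟶ tens (fun i => X (f i)) L
  | [] => 𝟙 _
  | i :: L => X (f i) ◁ unmap f X L

/-- Inverse of `unmap`. -/
def remap {ι κ : Type} (f : ι → κ) (X : κ → V) :
    ∀ L : List ι, tens (fun i => X (f i)) L ⟶ tens X (L.map f)
  | [] => 𝟙 _
  | i :: L => X (f i) ◁ remap f X L

/-- The associativity isomorphism which brackets a tensor product along consecutive blocks: the
block with index `i` is the list `κ i 0, …, κ i (b i - 1)`. -/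
def blocks {k : ℕ} {ι : Type} (X : ι → V) (b : Fin k → ℕ) (κ : ∀ i, Fin (b i) → ι) :
    ∀ L : List (Fin k), tens X (L.flatMap fun i => (List.finRange (b i)).map (κ i)) ⟶
      tens (fun i => tens (fun j => X (κ i j)) (List.finRange (b i))) L
  | [] => 𝟙 _
  | i :: L => split X _ _ ≫ (unmap (κ i) X _ ⊗ₘ blocks X b κ L)

/-- The ordered tensor product `X 0 ⊗ (X 1 ⊗ ⋯)` of a family indexed by `Fin k`. -/
abbrev bigTens {k : ℕ} (X : Fin k → V) : V := tens X (List.finRange k)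

/-- Functoriality of `bigTens`. -/
abbrev bigTensHom {k : ℕ} {X Y : Fin k → V} (f : ∀ i, X i ⟶ Y i) : bigTens X ⟶ bigTens Y :=
  tensHom f (List.finRange k)

theorem bigTensHom_id {k : ℕ} (X : Fin k → V) :
    bigTensHom (fun i => 𝟙 (X i)) = 𝟙 (bigTens X) :=
  tensHom_id X _

theorem bigTensHom_comp {k : ℕ} {X Y Z : Fin k → V} (f : ∀ i, X i ⟶ Y i) (g : ∀ i, Y i ⟶ Z i) :
    bigTensHom (fun i => f i ≫ g i) = bigTensHom f ≫ bigTensHom g :=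
  tensHom_comp f g _

/-- The isomorphism from a one-fold tensor product to its only factor. -/
def single (X : Fin 1 → V) : bigTens X ⟶ X 0 := (ρ_ (X 0)).hom

theorem trans_aux {A L L' M M' : V} {q : L ⟶ M'} {p : L ⟶ M} {p1 : M ⟶ M'} {W : V}
    {r : A ⊗ M ⟶ L'} {p' : L' ⟶ W} {r' : A ⊗ M' ⟶ W} (hq : q = p ≫ p1)
    (h : r ≫ p' = A ◁ p1 ≫ r') : A ◁ q ≫ r' = (A ◁ p ≫ r) ≫ p' := by
  rw [Category.assoc, h, hq, MonoidalCategory.whiskerLeft_comp, Category.assoc]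

theorem map_aux₂ {A L N L' M M' N' : V} {r : A ⊗ M ⟶ N} {m : M ⟶ M'} {l : L ⟶ L'}
    {r' : A ⊗ M' ⟶ N'} {p : L ⟶ M} {p' : L' ⟶ M'} {n : N ⟶ N'} (h : p ≫ m = l ≫ p')
    (h' : r ≫ n = A ◁ m ≫ r') : (A ◁ p ≫ r) ≫ n = A ◁ l ≫ A ◁ p' ≫ r' := by
  rw [Category.assoc, h', ← MonoidalCategory.whiskerLeft_comp_assoc,
    ← MonoidalCategory.whiskerLeft_comp_assoc, h]

/-- Reindexing along an equality of lists. -/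
def recast {ι : Type} (X : ι → V) {L L' : List ι} (h : L = L') : tens X L ⟶ tens X L' :=
  eqToHom (congrArg _ h)

theorem recast_self {ι : Type} (X : ι → V) {L : List ι} (h : L = L) : recast X h = 𝟙 _ := rfl

theorem recast_trans {ι : Type} (X : ι → V) {L L' L'' : List ι} (h : L = L') (h' : L' = L'')
    (h'' : L = L'') : recast X h'' = recast X h ≫ recast X h' := by
  subst h h'; exact (Category.id_comp _).symm

theorem recast_cons {ι : Type} (X : ι → V) {L L' : List ι} (h : L = L') (i : ι)
    (h' : i :: L = i :: L') : recast X h' = X i ◁ recast X h := by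
  subst h; exact (MonoidalCategory.whiskerLeft_id _ _).symm

theorem recast_append {ι : Type} (X : ι → V) {A A' B B' : List ι} (hA : A = A') (hB : B = B')
    (h : A ++ B = A' ++ B') :
    recast X h ≫ split X B' A' = split X B A ≫ (recast X hA ⊗ₘ recast X hB) := by
  subst hA hB
  exact (Category.id_comp _).trans
    ((congrArg (split X B A ≫ ·) (id_tensorHom_id _ _)).trans (Category.comp_id _)).symm

theorem whisker_aux {A L₁ L₂ L₃ L₄ : V} {a : L₁ ⟶ L₂} {b : A ⊗ L₂ ⟶ A ⊗ L₃} {b₀ : L₂ ⟶ L₃}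
    {c : L₃ ⟶ L₄} {d : L₁ ⟶ L₄} (hb : b = A ◁ b₀) (h : a ≫ b₀ ≫ c = d) :
    A ◁ a ≫ b ≫ A ◁ c = A ◁ d := by
  simp only [hb, ← h, MonoidalCategory.whiskerLeft_comp]

theorem remap_unmap {α β γ : Type} (f : α → β) (g : β → γ) (X : γ → V) : ∀ (L : List α)
    (h : (L.map f).map g = L.map fun i => g (f i)),
    remap g X (L.map f) ≫ recast X h ≫ unmap (fun i => g (f i)) X L =
      unmap f (fun i => X (g i)) L
  | [], _ => (Category.id_comp _).trans (Category.id_comp _)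
  | _ :: L, h => whisker_aux (recast_cons X (List.cons.inj h).2 _ _)
      (remap_unmap f g X L (List.cons.inj h).2)

theorem split_aux₀ {L L' : V} (r : L ⟶ L') :
    r ≫ 𝟙 _ ≫ (λ_ _).inv = (λ_ _).inv ≫ (𝟙 (𝟙_ V) ⊗ₘ r) := by
  simp

theorem split_aux {A K K' N M M' L L' : V} {r : K ⟶ K'} {c : K' ⟶ N} {c' : A ⊗ K' ⟶ A ⊗ N}
    {s : N ⟶ M ⊗ M'} {s' : K ⟶ L ⊗ L'} {l : L ⟶ M} {l' : L' ⟶ M'} (hc : c' = A ◁ c)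
    (h : r ≫ c ≫ s = s' ≫ (l ⊗ₘ l')) :
    A ◁ r ≫ c' ≫ A ◁ s ≫ (α_ _ _ _).inv = (A ◁ s' ≫ (α_ _ _ _).inv) ≫ (A ◁ l ⊗ₘ l') := by
  have h' := congrArg (fun t => A ◁ t ≫ (α_ _ _ _).inv) h
  simp only [MonoidalCategory.whiskerLeft_comp, Category.assoc] at h'
  rw [hc, h', Category.assoc]
  congr 1
  rw [← id_tensorHom, ← id_tensorHom, associator_inv_naturality]

theorem remap_split {α β : Type} (f : α → β) (X : β → V) (B : List α) : ∀ (A : List α)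
    (h : (A ++ B).map f = A.map f ++ B.map f),
    remap f X (A ++ B) ≫ recast X h ≫ split X (B.map f) (A.map f) =
      split (fun i => X (f i)) B A ≫ (remap f X A ⊗ₘ remap f X B)
  | [], _ => split_aux₀ _
  | _ :: A, h => split_aux (recast_cons X (List.cons.inj h).2 _ _)
      (remap_split f X B A (List.cons.inj h).2)

theorem blocks_aux {K K₁ K₂ A B A₁ B₁ A₂ B₂ A₃ B₃ : V} {r : K ⟶ K₁} {c : K₁ ⟶ K₂} {K₃ : V}
    {c₁ : K₁ ⟶ K₃} {c₂ : K₃ ⟶ K₂} {s : K₂ ⟶ A₂ ⊗ B₂} {s' : K₃ ⟶ A₁ ⊗ B₁} {s'' : K ⟶ A ⊗ B}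
    {a : A ⟶ A₁} {b : B ⟶ B₁} {a₁ : A₁ ⟶ A₂} {b₁ : B₁ ⟶ B₂} {a₂ : A₂ ⟶ A₃} {b₂ : B₂ ⟶ B₃}
    {a₃ : A ⟶ A₃} {b₃ : B ⟶ B₃} (hc : c = c₁ ≫ c₂) (h₁ : c₂ ≫ s = s' ≫ (a₁ ⊗ₘ b₁))
    (h₂ : r ≫ c₁ ≫ s' = s'' ≫ (a ⊗ₘ b)) (ha : a ≫ a₁ ≫ a₂ = a₃) (hb : b ≫ b₁ ≫ b₂ = b₃) :
    r ≫ c ≫ s ≫ (a₂ ⊗ₘ b₂) = s'' ≫ (a₃ ⊗ₘ b₃) := by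
  rw [hc, ← ha, ← hb, ← tensorHom_comp_tensorHom, ← tensorHom_comp_tensorHom, ← reassoc_of% h₂,
    Category.assoc, reassoc_of% h₁]

theorem remap_blocks {k : ℕ} {ι ι' : Type} (q : ι → ι') (X : ι' → V) (b : Fin k → ℕ)
    (κ : ∀ i, Fin (b i) → ι) : ∀ (L : List (Fin k))
    (h : (L.flatMap fun i => (List.finRange (b i)).map (κ i)).map q =
      L.flatMap fun i => (List.finRange (b i)).map fun j => q (κ i j)),
    remap q X _ ≫ recast X h ≫ blocks X b (fun i j => q (κ i j)) L =
      blocks (fun i => X (q i)) b κ L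
  | [], h => (Category.id_comp _).trans (Category.id_comp _)
  | i :: L, h => by
    have hA : ((List.finRange (b i)).map (κ i)).map q =
        (List.finRange (b i)).map fun j => q (κ i j) := List.map_map
    have hC : (L.flatMap fun i => (List.finRange (b i)).map (κ i)).map q =
        L.flatMap fun i => (List.finRange (b i)).map fun j => q (κ i j) := by
      rw [List.map_flatMap]; simp only [List.map_map]; rfl
    have e : ∀ A B : List ι, (A ++ B).map q = A.map q ++ B.map q := fun _ _ => List.map_append
    exact blocks_aux (recast_trans X (e _ _) (congrArg₂ _ hA hC) h)
      (recast_append X hA hC _) (remap_split q X _ _ (e _ _)) (remap_unmap (κ i) q X _ hA)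
      (remap_blocks q X b κ L hC)

theorem remap_unmap_self {ι κ : Type} (f : ι → κ) (X : κ → V) : ∀ L : List ι,
    remap f X L ≫ unmap f X L = 𝟙 _ ∧ unmap f X L ≫ remap f X L = 𝟙 _
  | [] => ⟨Category.id_comp _, Category.id_comp _⟩
  | i :: L => by
    have h := remap_unmap_self f X L
    constructor
    · refine (MonoidalCategory.whiskerLeft_comp _ _ _).symm.trans ?_
      rw [h.1]; exact MonoidalCategory.whiskerLeft_id _ _
    · refine (MonoidalCategory.whiskerLeft_comp _ _ _).symm.trans ?_
      rw [h.2]; exact MonoidalCategory.whiskerLeft_id _ _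

end Tensor

section Symmetry

variable {V : Type u} [Category.{v} V] [MonoidalCategory V] [SymmetricCategory V]

/-- The interchange isomorphism `(⨂ Xᵢ) ⊗ (⨂ Yᵢ) ⟶ ⨂ (Xᵢ ⊗ Yᵢ)`. -/
def zip {ι : Type} (X Y : ι → V) :
    ∀ L : List ι, tens X L ⊗ tens Y L ⟶ tens (fun i => X i ⊗ Y i) L
  | [] => (λ_ _).hom
  | i :: L => tensorμ (X i) (tens X L) (Y i) (tens Y L) ≫ (X i ⊗ Y i) ◁ zip X Y L

/-- The symmetry exchanging the first two factors. -/
def swap (A B C : V) : A ⊗ B ⊗ C ⟶ B ⊗ A ⊗ C := (α_ A B C).inv ≫ (β_ A B).hom ▷ C ≫ (α_ B A C).hom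

/-- `Rem i L M` is the type of positions in `L` which hold `i` and such that deleting this position
leaves `M`. -/
inductive Rem {ι : Type} (i : ι) : List ι → List ι → Type
  | head (L : List ι) : Rem i (i :: L) L
  | tail (j : ι) {L M : List ι} (r : Rem i L M) : Rem i (j :: L) (j :: M)

/-- A bijection between the positions of `L` and those of `L'` which preserves the entries. -/
inductive Reordering {ι : Type} : List ι → List ι → Type
  | nil : Reordering [] []
  | cons {i : ι} {L L' M : List ι} (r : Rem i L' M) (p : Reordering L M) : Reordering (i :: L) L'

/-- The symmetry moving the first factor to a given position. -/
def Rem.hom {ι : Type} (X : ι → V) {i : ι} :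
    ∀ {L M : List ι}, Rem i L M → (X i ⊗ tens X M ⟶ tens X L)
  | _, _, .head _ => 𝟙 _
  | _, _, .tail j r => swap (X i) (X j) _ ≫ X j ◁ r.hom X

/-- The symmetry of the iterated tensor product along a reordering of its factors. -/
def Reordering.hom {ι : Type} (X : ι → V) :
    ∀ {L L' : List ι}, Reordering L L' → (tens X L ⟶ tens X L')
  | _, _, .nil => 𝟙 _
  | _, _, .cons (i := i) r p => X i ◁ p.hom X ≫ r.hom X

theorem swap_natural_right (A B : V) {C C' : V} (h : C ⟶ C') :
    A ◁ B ◁ h ≫ swap A B C' = swap A B C ≫ B ◁ A ◁ h := by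
  simp only [swap, Category.assoc]
  rw [associator_inv_naturality_right_assoc, whisker_exchange_assoc,
    associator_naturality_right]

theorem swap_swap (A B C : V) : swap A B C ≫ swap B A C = 𝟙 _ := by
  simp [swap, ← comp_whiskerRight_assoc]

theorem swap_swap_assoc (A B C : V) {Z : V} (f : A ⊗ B ⊗ C ⟶ Z) :
    swap A B C ≫ swap B A C ≫ f = f := by
  rw [← Category.assoc, swap_swap, Category.id_comp]

theorem swap_hexagon (A B C D : V) :
    A ◁ swap B C D ≫ swap A C (B ⊗ D) ≫ C ◁ swap A B D =
      swap A B (C ⊗ D) ≫ B ◁ swap A C D ≫ swap B C (A ⊗ D) := by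
  have h := congrArg (fun f : A ⊗ B ⊗ C ⟶ C ⊗ B ⊗ A =>
    (𝟙 _ ⊗≫ f ▷ D ⊗≫ 𝟙 _ : A ⊗ B ⊗ C ⊗ D ⟶ C ⊗ B ⊗ A ⊗ D)) (BraidedCategory.yang_baxter A B C)
  have h1 : A ◁ swap B C D ≫ swap A C (B ⊗ D) ≫ C ◁ swap A B D = 𝟙 _ ⊗≫ (A ◁ (β_ B C).hom ≫ (α_ A C B).inv ≫ (β_ A C).hom ▷ B ≫
      (α_ C A B).hom ≫ C ◁ (β_ A B).hom) ▷ D ⊗≫ 𝟙 (C ⊗ B ⊗ A ⊗ D) := by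
    simp only [swap]; monoidal
  have h2 : swap A B (C ⊗ D) ≫ B ◁ swap A C D ≫ swap B C (A ⊗ D) = 𝟙 _ ⊗≫ ((α_ A B C).inv ≫ (β_ A B).hom ▷ C ≫ (α_ B A C).hom ≫
    B ◁ (β_ A C).hom ≫ (α_ B C A).inv ≫ (β_ B C).hom ▷ A ≫ (α_ C B A).hom) ▷ D ⊗≫ 𝟙 (C ⊗ B ⊗ A ⊗ D) := by
    simp only [swap]; monoidal
  rw [h1, h2]; exact h.symm

theorem comm_aux₁ {A B Z W : V} (f : B ⊗ Z ⟶ W) :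
    A ◁ f ≫ 𝟙 _ = swap A B Z ≫ B ◁ 𝟙 _ ≫ swap B A Z ≫ A ◁ f := by
  simp [swap_swap_assoc]

theorem comm_aux₂ {A C Z W : V} (f : A ⊗ Z ⟶ W) :
    A ◁ 𝟙 (C ⊗ Z) ≫ swap A C Z ≫ C ◁ f = swap A C Z ≫ C ◁ f ≫ 𝟙 _ := by
  simp

theorem comm_aux₃ {A B K L M M' N : V} {s : B ⊗ N ⟶ M} {r : A ⊗ M ⟶ L} {r' : A ⊗ N ⟶ M'}
    {s' : B ⊗ M' ⟶ L} (h : A ◁ s ≫ r = swap A B N ≫ B ◁ r' ≫ s') :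
    A ◁ (swap B K N ≫ K ◁ s) ≫ swap A K M ≫ K ◁ r =
      swap A B (K ⊗ N) ≫ B ◁ (swap A K N ≫ K ◁ r') ≫ swap B K M' ≫ K ◁ s' := by
  have h' := congrArg (fun f => K ◁ f) h
  simp only [MonoidalCategory.whiskerLeft_comp] at h'
  have hx := swap_hexagon A B K N
  simp only [MonoidalCategory.whiskerLeft_comp, Category.assoc]
  rw [← Category.assoc (A ◁ K ◁ s), swap_natural_right, Category.assoc, h',
    ← Category.assoc (B ◁ K ◁ r'), swap_natural_right, Category.assoc, reassoc_of% hx]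

theorem pull_aux {A B L L' L'' M'' Q Z : V} {r : A ⊗ Z ⟶ L} {p : L ⟶ L''} {p1 : Z ⟶ M''}
    {r1 : A ⊗ M'' ⟶ L''} {ra : B ⊗ L'' ⟶ L'} {r' : A ⊗ Q ⟶ L'} {r'' : B ⊗ M'' ⟶ Q}
    (h1 : r ≫ p = A ◁ p1 ≫ r1) (h2 : B ◁ r1 ≫ ra = swap B A M'' ≫ A ◁ r'' ≫ r') :
    (swap A B Z ≫ B ◁ r) ≫ B ◁ p ≫ ra = A ◁ (B ◁ p1 ≫ r'') ≫ r' := by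
  have h := congrArg (fun f => B ◁ f) h1
  simp only [MonoidalCategory.whiskerLeft_comp] at h
  simp only [MonoidalCategory.whiskerLeft_comp, Category.assoc]
  rw [reassoc_of% h, h2, ← Category.assoc (B ◁ A ◁ p1), swap_natural_right, Category.assoc,
    swap_swap_assoc]

theorem Rem.comm {ι : Type} (X : ι → V) {i : ι} {L M : List ι} (r : Rem i L M) :
    ∀ {j : ι} {N : List ι} (s : Rem j M N), ∃ (M' : List ι) (s' : Rem j L M') (r' : Rem i M' N),
      X i ◁ s.hom X ≫ r.hom X = swap (X i) (X j) (tens X N) ≫ X j ◁ r'.hom X ≫ s'.hom X := by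
  induction r with
  | head L =>
    intro j N s
    exact ⟨_, .tail i s, .head _, comm_aux₁ _⟩
  | tail k r ih =>
    intro j N s
    cases s with
    | head => exact ⟨_, .head _, r, comm_aux₂ _⟩
    | tail _ s =>
      obtain ⟨M', s', r', h⟩ := ih s
      exact ⟨_, .tail k s', .tail k r', comm_aux₃ h⟩

theorem Reordering.pull {ι : Type} (X : ι → V) {L L' : List ι} (p : Reordering L L') :
    ∀ {i : ι} {M : List ι} (r : Rem i L M), ∃ (M' : List ι) (r' : Rem i L' M')
      (p' : Reordering M M'), r.hom X ≫ p.hom X = X i ◁ p'.hom X ≫ r'.hom X := by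
  induction p with
  | nil => intro i M r; cases r
  | cons ra p ih =>
    intro i M r
    cases r with
    | head => exact ⟨_, ra, p, Category.id_comp _⟩
    | tail a r =>
      obtain ⟨M'', r1, p1, h1⟩ := ih r
      obtain ⟨Q, r', r'', h2⟩ := ra.comm X r1
      exact ⟨_, r', .cons r'' p1, pull_aux h1 h2⟩

theorem Reordering.exists_trans {ι : Type} (X : ι → V) {L L' : List ι} (p : Reordering L L') :
    ∀ {L'' : List ι} (p' : Reordering L' L''),
      ∃ q : Reordering L L'', q.hom X = p.hom X ≫ p'.hom X := by
  induction p with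
  | nil => intro L'' p'; exact ⟨p', (Category.id_comp _).symm⟩
  | cons r p ih =>
    intro L'' p'
    obtain ⟨M', r', p1, h⟩ := p'.pull X r
    obtain ⟨q, hq⟩ := ih p1
    exact ⟨.cons r' q, trans_aux hq h⟩

theorem Rem.mem {ι : Type} {i : ι} {L M : List ι} (r : Rem i L M) : i ∈ L := by
  induction r with
  | head => simp
  | tail j r ih => simp [ih]

theorem Rem.perm {ι : Type} {i : ι} {L M : List ι} (r : Rem i L M) : L.Perm (i :: M) := by
  induction r with
  | head => exact List.Perm.refl _
  | tail j r ih => exact (ih.cons j).trans (List.Perm.swap _ _ _)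

theorem Rem.unique {ι : Type} {i : ι} {L M : List ι} (r : Rem i L M) (hL : L.Nodup) :
    ∀ {M' : List ι} (r' : Rem i L M'), M = M' ∧ HEq r r' := by
  induction r with
  | head L =>
    intro M' r'
    cases r' with
    | head => exact ⟨rfl, HEq.rfl⟩
    | tail _ r' => exact absurd r'.mem (List.nodup_cons.1 hL).1
  | tail j r ih =>
    intro M' r'
    cases r' with
    | head => exact absurd r.mem (List.nodup_cons.1 hL).1
    | tail _ r' =>
      obtain ⟨rfl, h⟩ := ih (List.nodup_cons.1 hL).2 r'
      obtain rfl := eq_of_heq h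
      exact ⟨rfl, HEq.rfl⟩

/-- There is at most one reordering between lists without repetitions. -/
theorem Reordering.unique {ι : Type} {L L' : List ι} (p : Reordering L L') (hL : L'.Nodup) :
    ∀ p' : Reordering L L', p = p' := by
  induction p with
  | nil => intro p'; cases p'; rfl
  | cons r p ih =>
    intro p'
    cases p' with
    | cons r' p' =>
      obtain ⟨rfl, h⟩ := r.unique hL r'
      obtain rfl := eq_of_heq h
      rw [ih (List.nodup_cons.1 (r.perm.nodup_iff.1 hL)).2 p']

/-- The identity reordering. -/
def Reordering.refl {ι : Type} : ∀ L : List ι, Reordering L L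
  | [] => .nil
  | _ :: L => .cons (.head L) (.refl L)

theorem Reordering.hom_refl {ι : Type} (X : ι → V) :
    ∀ L : List ι, (Reordering.refl L).hom X = 𝟙 _
  | [] => rfl
  | i :: L => by
    rw [Reordering.refl, Reordering.hom, Reordering.hom_refl X L]
    exact (Category.comp_id _).trans (MonoidalCategory.whiskerLeft_id _ _)

theorem Reordering.nonempty {ι : Type} {L L' : List ι} (h : L.Perm L') :
    Nonempty (Reordering L L') := by
  have triv := fun (L L' L'' : List ι) (p : Reordering L L') (p' : Reordering L' L'') =>
    Reordering.exists_trans (V := Type) (fun _ => PUnit) p p'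
  induction h with
  | nil => exact ⟨.nil⟩
  | cons i _ ih => exact ih.map fun p => .cons (.head _) p
  | swap i j L => exact ⟨.cons (.tail _ (.head _)) (.refl _)⟩
  | trans _ _ ih ih' =>
    obtain ⟨p⟩ := ih
    obtain ⟨p'⟩ := ih'
    exact ⟨(triv _ _ _ p p').choose⟩

/-- The symmetry of the iterated tensor product which permutes the factors as prescribed by their
indices. It is used only for lists without repetitions, where `Reordering L L'` has exactly one
element. -/
noncomputable def reorder {ι : Type} (X : ι → V) {L L' : List ι} (h : L.Perm L') :
    tens X L ⟶ tens X L' :=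
  (Classical.choice (Reordering.nonempty h)).hom X

theorem reorder_eq {ι : Type} (X : ι → V) {L L' : List ι} (h : L.Perm L') (hL : L'.Nodup)
    (p : Reordering L L') : reorder X h = p.hom X := by
  rw [reorder, Reordering.unique (Classical.choice (Reordering.nonempty h)) hL p]

theorem reorder_trans {ι : Type} (X : ι → V) {L L' L'' : List ι} (h : L.Perm L')
    (h' : L'.Perm L'') (hL : L''.Nodup) :
    reorder X h ≫ reorder X h' = reorder X (h.trans h') := by
  obtain ⟨q, hq⟩ := (Classical.choice (Reordering.nonempty h)).exists_trans X
    (Classical.choice (Reordering.nonempty h'))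
  rw [reorder_eq X (h.trans h') hL q, hq, reorder, reorder]

theorem reorder_self {ι : Type} (X : ι → V) {L : List ι} (h : L.Perm L) (hL : L.Nodup) :
    reorder X h = 𝟙 _ := by
  rw [reorder_eq X h hL (.refl L), Reordering.hom_refl]

end Symmetry

/-! ### Fibers of maps of finite ordinals -/

/-- `IsFibers σ b κ` says that for every `i` the order preserving injection `κ i` identifies the
ordinal with `b i` elements with the fiber `σ⁻¹(i)`, ordered as a subset of the source of `σ`. -/
structure IsFibers {n k : ℕ} (σ : Fin n → Fin k) (b : Fin k → ℕ) (κ : ∀ i, Fin (b i) → Fin n) :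
    Prop where
  strictMono : ∀ i, StrictMono (κ i)
  mem_iff : ∀ i s, (∃ j, κ i j = s) ↔ σ s = i

theorem IsFibers.apply {n k : ℕ} {σ : Fin n → Fin k} {b : Fin k → ℕ} {κ : ∀ i, Fin (b i) → Fin n}
    (h : IsFibers σ b κ) (i : Fin k) (j : Fin (b i)) : σ (κ i j) = i :=
  (h.mem_iff i _).1 ⟨j, rfl⟩

theorem IsFibers.nodup {n k : ℕ} {σ : Fin n → Fin k} {b : Fin k → ℕ}
    {κ : ∀ i, Fin (b i) → Fin n} (h : IsFibers σ b κ) :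
    ((List.finRange k).flatMap fun i => (List.finRange (b i)).map (κ i)).Nodup := by
  rw [List.nodup_flatMap]
  refine ⟨fun i _ => (List.nodup_finRange _).map (h.strictMono i).injective, ?_⟩
  refine (List.nodup_finRange k).imp ?_
  intro i i' hne s hs hs'
  simp only [List.mem_map, List.mem_finRange, true_and] at hs hs'
  exact hne (((h.mem_iff i s).1 hs).symm.trans ((h.mem_iff i' s).1 hs'))

theorem IsFibers.perm {n k : ℕ} {σ : Fin n → Fin k} {b : Fin k → ℕ}
    {κ : ∀ i, Fin (b i) → Fin n} (h : IsFibers σ b κ) :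
    (List.finRange n).Perm
      ((List.finRange k).flatMap fun i => (List.finRange (b i)).map (κ i)) := by
  rw [List.perm_ext_iff_of_nodup (List.nodup_finRange n) h.nodup]
  intro s
  simp only [List.mem_finRange, List.mem_flatMap, List.mem_map, true_and, true_iff]
  exact ⟨σ s, (h.mem_iff _ s).2 rfl⟩

section Regroup

variable {V : Type u} [Category.{v} V] [MonoidalCategory V] [SymmetricCategory V]

/-- The symmetry `⨂ₛ Xₛ ⟶ ⨂ᵢ ⨂_{s ∈ σ⁻¹(i)} Xₛ`. -/
noncomputable def regroup {n k : ℕ} {σ : Fin n → Fin k} {b : Fin k → ℕ}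
    {κ : ∀ i, Fin (b i) → Fin n} (X : Fin n → V) (h : IsFibers σ b κ) :
    bigTens X ⟶ bigTens fun i => bigTens fun j => X (κ i j) :=
  reorder X h.perm ≫ blocks X b κ (List.finRange k)

/-- The symmetry
`(P ⊗ ⨂ᵢ Yᵢ) ⊗ ⨂ₛ Xₛ ⟶ P ⊗ ⨂ᵢ (Yᵢ ⊗ ⨂_{s ∈ σ⁻¹(i)} Xₛ)`. -/
noncomputable def distribute {n k : ℕ} {σ : Fin n → Fin k} {b : Fin k → ℕ}
    {κ : ∀ i, Fin (b i) → Fin n} (P : V) (Y : Fin k → V) (X : Fin n → V) (h : IsFibers σ b κ) :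
    (P ⊗ bigTens Y) ⊗ bigTens X ⟶ P ⊗ bigTens fun i => Y i ⊗ bigTens fun j => X (κ i j) :=
  (α_ _ _ _).hom ≫ P ◁ (bigTens Y ◁ regroup X h ≫ zip Y _ (List.finRange k))

/-- The symmetry `⨂ᵢ X_{ρ i} ⟶ ⨂ᵢ Xᵢ`. -/
noncomputable def permute {k : ℕ} (ρ : Equiv.Perm (Fin k)) (X : Fin k → V) :
    bigTens (fun i => X (ρ i)) ⟶ bigTens X :=
  remap ρ X (List.finRange k) ≫ reorder X ρ.map_finRange_perm

theorem map_aux {A B M M' L L' : V} {r : A ⊗ M ⟶ L} {m : M ⟶ M'} {l : L ⟶ L'}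
    {r' : A ⊗ M' ⟶ L'} (h : r ≫ l = A ◁ m ≫ r') :
    (swap A B M ≫ B ◁ r) ≫ B ◁ l = A ◁ B ◁ m ≫ swap A B M' ≫ B ◁ r' := by
  rw [Category.assoc, ← MonoidalCategory.whiskerLeft_comp, h,
    ← Category.assoc (A ◁ B ◁ m), swap_natural_right, Category.assoc,
    MonoidalCategory.whiskerLeft_comp]

theorem Rem.exists_map {ι κ : Type} (f : ι → κ) (X : κ → V) {i : ι} {L M : List ι}
    (r : Rem i L M) : ∃ r' : Rem (f i) (L.map f) (M.map f),
      r.hom (fun i => X (f i)) ≫ remap f X L = X (f i) ◁ remap f X M ≫ r'.hom X := by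
  induction r with
  | head L => exact ⟨.head _, (Category.id_comp _).trans (Category.comp_id _).symm⟩
  | tail j r ih =>
    obtain ⟨r', h⟩ := ih
    refine ⟨.tail _ r', ?_⟩
    exact map_aux h

theorem Reordering.exists_map {ι κ : Type} (f : ι → κ) (X : κ → V) {L L' : List ι}
    (p : Reordering L L') : ∃ p' : Reordering (L.map f) (L'.map f),
      p.hom (fun i => X (f i)) ≫ remap f X L' = remap f X L ≫ p'.hom X := by
  induction p with
  | nil => exact ⟨.nil, rfl⟩
  | cons r p ih =>
    obtain ⟨p', h⟩ := ih
    obtain ⟨r', h'⟩ := r.exists_map f X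
    exact ⟨.cons r' p', map_aux₂ h h'⟩

theorem reorder_map {ι κ : Type} (f : ι → κ) (X : κ → V) {L L' : List ι} (h : L.Perm L')
    (h' : (L.map f).Perm (L'.map f)) (hL : (L'.map f).Nodup) :
    reorder (fun i => X (f i)) h ≫ remap f X L' = remap f X L ≫ reorder X h' := by
  obtain ⟨p', hp⟩ := (Classical.choice (Reordering.nonempty h)).exists_map f X
  rw [reorder_eq X h' hL p']
  exact hp

theorem reorder_recast {ι : Type} (X : ι → V) {L L' L'' : List ι} (h : L.Perm L') (e : L' = L'')
    (h' : L.Perm L'') : reorder X h ≫ recast X e = reorder X h' := by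
  subst e; exact Category.comp_id _

/-- Permuting the factors does not change their regrouping. -/
theorem permute_regroup {n k : ℕ} {σ σ' : Fin n → Fin k} {b : Fin k → ℕ}
    {κ : ∀ i, Fin (b i) → Fin n} (X : Fin n → V) (q : Equiv.Perm (Fin n)) (h' : IsFibers σ' b κ)
    (h : IsFibers σ b fun i j => q (κ i j)) :
    permute q X ≫ regroup X h = regroup (fun i => X (q i)) h' := by
  have e : ((List.finRange k).flatMap fun i => (List.finRange (b i)).map (κ i)).map q =
      (List.finRange k).flatMap fun i => (List.finRange (b i)).map fun j => q (κ i j) := by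
    rw [List.map_flatMap]; simp only [List.map_map]; rfl
  have hp := h'.perm.map q
  have hn := h'.nodup.map q.injective
  rw [permute, regroup, regroup, ← remap_blocks q X b κ _ e, ← Category.assoc,
    ← Category.assoc (reorder _ _), reorder_map q X h'.perm hp hn]
  simp only [Category.assoc]
  rw [reassoc_of% reorder_trans X _ _ h.nodup, ← Category.assoc (reorder X hp),
    reorder_recast X hp e (hp.trans (e ▸ List.Perm.refl _))]

instance {k : ℕ} (ρ : Equiv.Perm (Fin k)) (X : Fin k → V) : IsIso (permute ρ X) := by
  have h1 : IsIso (remap ρ X (List.finRange k)) :=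
    ⟨unmap ρ X _, (remap_unmap_self ρ X _).1, (remap_unmap_self ρ X _).2⟩
  have h2 : IsIso (reorder X ρ.map_finRange_perm) :=
    ⟨reorder X ρ.map_finRange_perm.symm, by
      rw [reorder_trans X _ _ ((List.nodup_finRange k).map ρ.injective), reorder_self]
      exact (List.nodup_finRange k).map ρ.injective, by
      rw [reorder_trans X _ _ (List.nodup_finRange k), reorder_self]
      exact List.nodup_finRange k⟩
  exact IsIso.comp_isIso

end Regroup

/-! ### Trees -/

/-- An `n`-tree `[kₙ] → [kₙ₋₁] → ⋯ → [k₀] = [1]`: a chain of order preserving maps of finite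
ordinals. -/
@[ext]
structure Tree (n : ℕ) where
  card : Fin (n + 1) → ℕ
  card_zero : card 0 = 1
  map : ∀ i : Fin n, Fin (card i.succ) → Fin (card i.castSucc)
  monotone : ∀ i, Monotone (map i)

namespace Tree

variable {n : ℕ}

/-- The number of tips of an `n`-tree. -/
abbrev tips (T : Tree n) : ℕ := T.card (Fin.last n)

/-- The linear tree `[1] → ⋯ → [1]`. -/
def linear (n : ℕ) : Tree n where
  card _ := 1
  card_zero := rfl
  map _ := id
  monotone _ := monotone_id

/-- A morphism of `n`-trees: levelwise functions which commute with the structure maps and are order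
preserving on the fibers of the structure maps. -/
@[ext]
structure Hom (T S : Tree n) where
  app : ∀ i, Fin (T.card i) → Fin (S.card i)
  comm : ∀ i x, S.map i (app i.succ x) = app i.castSucc (T.map i x)
  mono : ∀ i x y, T.map i x = T.map i y → x ≤ y → app i.succ x ≤ app i.succ y

/-- The category `Ωₙ` of `n`-trees. -/
instance : Category (Tree n) where
  Hom := Hom
  id T := ⟨fun _ x => x, fun _ _ => rfl, fun _ _ _ _ h => h⟩
  comp f g := ⟨fun i x => g.app i (f.app i x), fun i x => by rw [g.comm, f.comm],
    fun i x y h h' => g.mono i _ _ (by rw [f.comm, f.comm, h]) (f.mono i x y h h')⟩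

/-- The effect of a morphism of trees on tips. -/
abbrev onTips {T S : Tree n} (f : T ⟶ S) : Fin T.tips → Fin S.tips := Hom.app f (Fin.last n)

/-- `IsFibers σ F ι` says that for every tip `s` of `S` the morphism `ι s : F s ⟶ T` exhibits `F s`
as the fiber of `σ : T ⟶ S` over `s`: if `ξ : linear n ⟶ S` is the morphism which hits the tip `s`,
then at every level `ι s` is the order preserving injection onto the levelwise pullback of `ξ`
along `σ`. -/
def IsFibers {T S : Tree n} (σ : T ⟶ S) (F : Fin S.tips → Tree n) (ι : ∀ s, F s ⟶ T) : Prop :=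
  ∀ s, ∃ ξ : linear n ⟶ S, onTips ξ (0 : Fin 1) = s ∧ ∀ i, StrictMono (Hom.app (ι s) i) ∧
    ∀ x, (∃ y, Hom.app (ι s) i y = x) ↔ Hom.app σ i x = Hom.app ξ i (0 : Fin 1)

/-- On tips, the fibers of a morphism of trees are the fibers of the underlying map of ordinals. -/
theorem IsFibers.onTips {T S : Tree n} {σ : T ⟶ S} {F : Fin S.tips → Tree n} {ι : ∀ s, F s ⟶ T}
    (h : IsFibers σ F ι) :
    HigherOperad.IsFibers (onTips σ) (fun s => (F s).tips) (fun s => Tree.onTips (ι s)) where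
  strictMono s := by
    obtain ⟨ξ, -, h⟩ := h s
    exact (h _).1
  mem_iff s x := by
    obtain ⟨ξ, rfl, h⟩ := h s
    exact (h _).2 x

/-- The morphism `linear n ⟶ S` which hits a given tip. -/
theorem exists_linear_hom {S : Tree n} (s : Fin S.tips) :
    ∃ ξ : linear n ⟶ S, Tree.onTips ξ (0 : Fin 1) = s := by
  let a : ∀ i, Fin (S.card i) := fun i =>
    Fin.reverseInduction (motive := fun i => Fin (S.card i)) s (fun i x => S.map i x) i
  refine ⟨⟨fun i _ => a i, fun i _ => ?_, fun _ _ _ _ _ => le_rfl⟩, ?_⟩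
  · exact (Fin.reverseInduction_castSucc ..).symm
  · exact Fin.reverseInduction_last ..

theorem exists_fiber {T S : Tree n} (σ : T ⟶ S) (ξ : linear n ⟶ S) :
    ∃ (F : Tree n) (ι : F ⟶ T), ∀ i, StrictMono (Hom.app ι i) ∧
      ∀ x, (∃ y, Hom.app ι i y = x) ↔ Hom.app σ i x = Hom.app ξ i (0 : Fin 1) := by
  let P : ∀ i, Finset (Fin (T.card i)) := fun i =>
    Finset.univ.filter fun x => Hom.app σ i x = Hom.app ξ i (0 : Fin 1)
  let e : ∀ i, Fin (P i).card ≃o P i := fun i => (P i).orderIsoOfFin rfl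
  have hP : ∀ (i : Fin n) (x : Fin (T.card i.succ)), x ∈ P i.succ → T.map i x ∈ P i.castSucc := by
    intro i x hx
    simp only [P, Finset.mem_filter, Finset.mem_univ, true_and] at hx ⊢
    rw [← Hom.comm σ, hx]
    exact Hom.comm ξ i (0 : Fin 1)
  have h0 : (P 0).card = 1 := by
    have : P 0 = Finset.univ := by
      refine Finset.filter_true_of_mem fun x _ => ?_
      have := S.card_zero
      exact Fin.ext (by omega)
    rw [this, Finset.card_univ, Fintype.card_fin, T.card_zero]
  refine ⟨⟨fun i => (P i).card, h0,
    fun i x => (e i.castSucc).symm ⟨T.map i (e i.succ x), hP i _ (e i.succ x).2⟩, fun i x y h => ?_⟩,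
    ⟨fun i x => (e i x : Fin (T.card i)), fun i x => ?_, fun i x y _ h => ?_⟩, fun i => ⟨?_, ?_⟩⟩
  · exact (e i.castSucc).symm.monotone (T.monotone i ((e i.succ).monotone h))
  · exact (congrArg Subtype.val
      ((e i.castSucc).apply_symm_apply ⟨_, hP i _ (e i.succ x).2⟩)).symm
  · exact (e i.succ).monotone h
  · exact fun x y h => (e i).strictMono h
  · intro x
    constructor
    · rintro ⟨y, rfl⟩
      exact (Finset.mem_filter.1 (e i y).2).2
    · intro hx
      exact ⟨(e i).symm ⟨x, Finset.mem_filter.2 ⟨Finset.mem_univ _, hx⟩⟩,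
        congrArg Subtype.val ((e i).apply_symm_apply _)⟩

theorem fiber_unique {T F F' : Tree n} (ι : F ⟶ T) (ι' : F' ⟶ T)
    (h : ∀ i, StrictMono (Hom.app ι i)) (h' : ∀ i, StrictMono (Hom.app ι' i))
    (hr : ∀ i, Set.range (Hom.app ι i) = Set.range (Hom.app ι' i)) :
    (⟨F, ι⟩ : Σ F : Tree n, F ⟶ T) = ⟨F', ι'⟩ := by
  obtain ⟨c, c0, m, mm⟩ := F
  obtain ⟨c', c0', m', mm'⟩ := F'
  obtain rfl : c = c' := by
    funext i
    have h1 := Set.card_range_of_injective (h i).injective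
    have h2 := Set.card_range_of_injective (h' i).injective
    simp only [← hr, Fintype.card_fin] at h1 h2
    exact h1.symm.trans h2
  have hι : ∀ i, Hom.app ι i = Hom.app ι' i := fun i => ((h i).range_inj (h' i)).1 (hr i)
  obtain rfl : m = m' := by
    funext i x
    apply (h i.castSucc).injective
    refine (Hom.comm ι i x).symm.trans ?_
    rw [hι, hι]
    exact Hom.comm ι' i x
  obtain rfl : ι = ι' := Hom.ext (funext hι)
  rfl

/-- Every morphism of trees has exactly one family of fibers. -/
theorem existsUnique_isFibers {T S : Tree n} (σ : T ⟶ S) :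
    ∃! p : Fin S.tips → Σ F : Tree n, F ⟶ T,
      IsFibers σ (fun s => (p s).1) (fun s => (p s).2) := by
  have hex : ∀ s : Fin S.tips, ∃ p : Σ F : Tree n, F ⟶ T, ∃ ξ : linear n ⟶ S,
      Tree.onTips ξ (0 : Fin 1) = s ∧ ∀ i, StrictMono (Hom.app p.2 i) ∧
        ∀ x, (∃ y, Hom.app p.2 i y = x) ↔ Hom.app σ i x = Hom.app ξ i (0 : Fin 1) := fun s => by
    obtain ⟨ξ, hξ⟩ := exists_linear_hom s
    obtain ⟨F, ι, h⟩ := exists_fiber σ ξ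
    exact ⟨⟨F, ι⟩, ξ, hξ, h⟩
  choose p hp using hex
  refine ⟨p, hp, fun p' hp' => funext fun s => ?_⟩
  obtain ⟨ξ, hξ, h⟩ := hp s
  obtain ⟨ξ', hξ', h'⟩ := hp' s
  have hξξ : ∀ i, Hom.app ξ i (0 : Fin 1) = Hom.app ξ' i (0 : Fin 1) := by
    intro i
    induction i using Fin.reverseInduction with
    | last => exact hξ.trans hξ'.symm
    | cast i ih =>
      have h1 := Hom.comm ξ i (0 : Fin 1)
      have h2 := Hom.comm ξ' i (0 : Fin 1)
      exact h1.symm.trans ((congrArg _ ih).trans h2)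
  refine fiber_unique _ _ (fun i => (h' i).1) (fun i => (h i).1) fun i => ?_
  ext x
  exact ((h' i).2 x).trans (by rw [← hξξ]; exact ((h i).2 x).symm)

end Tree

/-! ### `n`-operads -/

section Operads

variable (n : ℕ) (V : Type u) [Category.{v} V] [MonoidalCategory V] [SymmetricCategory V]

/-- An `n`-operad in `V`. The multiplication along `σ : T ⟶ S` is a morphism
`A_S ⊗ A_{F 0} ⊗ A_{F 1} ⊗ ⋯ ⟶ A_T` where `F 0, F 1, …` are the fibers of `σ` over the tips of `S`.
Every `σ` has exactly one family of fibers. -/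
structure NOperad where
  obj : Tree n → V
  unit : 𝟙_ V ⟶ obj (Tree.linear n)
  mul : ∀ {T S : Tree n} (σ : T ⟶ S) (F : Fin S.tips → Tree n) (ι : ∀ s, F s ⟶ T),
    Tree.IsFibers σ F ι → (obj S ⊗ bigTens (fun s => obj (F s)) ⟶ obj T)
  /-- Associativity for `T ⟶ S ⟶ R`, where `B i` and `D i` are the fibers of `S` and `T` over the
  tip `i` of `R`, `τ i : D i ⟶ B i` is the map induced by `σ`, and `F s` is the fiber of `T` over
  the tip `s` of `S`. -/
  mul_assoc : ∀ {T S R : Tree n} (σ : T ⟶ S) (ω : S ⟶ R)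
    (B : Fin R.tips → Tree n) (κ : ∀ i, B i ⟶ S) (hω : Tree.IsFibers ω B κ)
    (F : Fin S.tips → Tree n) (φ : ∀ s, F s ⟶ T) (hσ : Tree.IsFibers σ F φ)
    (D : Fin R.tips → Tree n) (ι : ∀ i, D i ⟶ T) (hσω : Tree.IsFibers (σ ≫ ω) D ι)
    (τ : ∀ i, D i ⟶ B i) (_ : ∀ i, τ i ≫ κ i = ι i ≫ σ)
    (ψ : ∀ i (j : Fin (B i).tips), F (Tree.onTips (κ i) j) ⟶ D i)
    (_ : ∀ i j, ψ i j ≫ ι i = φ (Tree.onTips (κ i) j))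
    (hτ : ∀ i, Tree.IsFibers (τ i) (fun j => F (Tree.onTips (κ i) j)) (ψ i)),
    mul ω B κ hω ▷ bigTens (fun s => obj (F s)) ≫ mul σ F φ hσ =
      distribute (obj R) (fun i => obj (B i)) (fun s => obj (F s)) hω.onTips ≫
        obj R ◁ bigTensHom (fun i => mul (τ i) _ (ψ i) (hτ i)) ≫ mul (σ ≫ ω) D ι hσω
  mul_id : ∀ (T : Tree n) (ι : Fin T.tips → (Tree.linear n ⟶ T))
    (h : Tree.IsFibers (𝟙 T) (fun _ => Tree.linear n) ι),
    obj T ◁ bigTensHom (fun _ => unit) ≫ mul (𝟙 T) _ ι h = obj T ◁ tensUnit _ ≫ (ρ_ _).hom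
  mul_unit : ∀ (T : Tree n) (σ : T ⟶ Tree.linear n)
    (h : Tree.IsFibers σ (fun _ => T) (fun _ => 𝟙 T)),
    unit ▷ bigTens (fun _ : Fin 1 => obj T) ≫ mul σ (fun _ => T) (fun _ => 𝟙 T) h =
      (λ_ _).hom ≫ single _

/-- A (left) symmetric operad in `V`: objects `A n` with a left action of the symmetric groups and
a multiplication along order preserving maps of finite ordinals. -/
structure SymOperad where
  obj : ℕ → V
  act : ∀ {m : ℕ}, Equiv.Perm (Fin m) → (obj m ⟶ obj m)
  act_one : ∀ m, act (1 : Equiv.Perm (Fin m)) = 𝟙 _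
  act_mul : ∀ {m : ℕ} (π ρ : Equiv.Perm (Fin m)), act (π * ρ) = act ρ ≫ act π
  unit : 𝟙_ V ⟶ obj 1
  mul : ∀ {m k : ℕ} (σ : Fin m → Fin k) (b : Fin k → ℕ) (κ : ∀ i, Fin (b i) → Fin m),
    Monotone σ → IsFibers σ b κ → (obj k ⊗ bigTens (fun i => obj (b i)) ⟶ obj m)
  /-- Associativity for `[m] → [l] → [k]`, where `b i` and `d i` are the fibers of `[l]` and `[m]`
  over `i`, `τ i` is the map induced by `σ`, and `f s` is the fiber of `[m]` over `s`. -/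
  mul_assoc : ∀ {m l k : ℕ} (σ : Fin m → Fin l) (ω : Fin l → Fin k)
    (mσ : Monotone σ) (mω : Monotone ω)
    (b : Fin k → ℕ) (κ : ∀ i, Fin (b i) → Fin l) (hω : IsFibers ω b κ)
    (f : Fin l → ℕ) (φ : ∀ s, Fin (f s) → Fin m) (hσ : IsFibers σ f φ)
    (d : Fin k → ℕ) (ι : ∀ i, Fin (d i) → Fin m) (hσω : IsFibers (ω ∘ σ) d ι)
    (τ : ∀ i, Fin (d i) → Fin (b i)) (_ : ∀ i x, κ i (τ i x) = σ (ι i x))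
    (mτ : ∀ i, Monotone (τ i))
    (ψ : ∀ i j, Fin (f (κ i j)) → Fin (d i)) (_ : ∀ i j x, ι i (ψ i j x) = φ (κ i j) x)
    (hτ : ∀ i, IsFibers (τ i) (fun j => f (κ i j)) (ψ i)),
    mul ω b κ mω hω ▷ bigTens (fun s => obj (f s)) ≫ mul σ f φ mσ hσ =
      distribute (obj k) (fun i => obj (b i)) (fun s => obj (f s)) hω ≫
        obj k ◁ bigTensHom (fun i => mul (τ i) _ (ψ i) (mτ i) (hτ i)) ≫
          mul (ω ∘ σ) d ι (mω.comp mσ) hσω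
  mul_id : ∀ (m : ℕ) (h : IsFibers (fun s : Fin m => s) (fun _ => 1) (fun s _ => s)),
    obj m ◁ bigTensHom (fun _ => unit) ≫ mul (fun s => s) _ (fun s _ => s) monotone_id h =
      obj m ◁ tensUnit _ ≫ (ρ_ _).hom
  mul_unit : ∀ (m : ℕ) (h : IsFibers (fun _ : Fin m => (0 : Fin 1)) (fun _ => m) (fun _ x => x)),
    unit ▷ bigTens (fun _ : Fin 1 => obj m) ≫
        mul (fun _ => 0) (fun _ => m) (fun _ x => x) monotone_const h =
      (λ_ _).hom ≫ single _
  /-- Equivariance with respect to permutations of the outer operation: `π` permutes the fibers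
  of `σ'` as blocks, according to `ρ`. -/
  equivariance_outer : ∀ {m k : ℕ} (σ σ' : Fin m → Fin k) (mσ : Monotone σ) (mσ' : Monotone σ')
    (π : Equiv.Perm (Fin m)) (ρ : Equiv.Perm (Fin k)) (_ : ∀ x, σ (π x) = ρ (σ' x))
    (b : Fin k → ℕ) (κ : ∀ i, Fin (b i) → Fin m) (h : IsFibers σ b κ)
    (κ' : ∀ i, Fin (b (ρ i)) → Fin m) (h' : IsFibers σ' (fun i => b (ρ i)) κ')
    (_ : ∀ i x, π (κ' i x) = κ (ρ i) x),
    (act ρ ⊗ₘ permute ρ fun i => obj (b i)) ≫ mul σ b κ mσ h =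
      mul σ' (fun i => b (ρ i)) κ' mσ' h' ≫ act π
  /-- Equivariance with respect to permutations of the inner operations: `π` maps every fiber of
  `σ` to itself, by the permutation `ρ i`. -/
  equivariance_inner : ∀ {m k : ℕ} (σ : Fin m → Fin k) (mσ : Monotone σ)
    (b : Fin k → ℕ) (κ : ∀ i, Fin (b i) → Fin m) (h : IsFibers σ b κ)
    (π : Equiv.Perm (Fin m)) (ρ : ∀ i, Equiv.Perm (Fin (b i)))
    (_ : ∀ i x, π (κ i x) = κ i (ρ i x)),
    obj k ◁ bigTensHom (fun i => act (ρ i)) ≫ mul σ b κ mσ h = mul σ b κ mσ h ≫ act π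

variable {n V}

namespace NOperad

/-- A morphism of `n`-operads. -/
@[ext]
structure Hom (A B : NOperad n V) where
  app : ∀ T, A.obj T ⟶ B.obj T
  unit : A.unit ≫ app _ = B.unit
  mul : ∀ {T S : Tree n} (σ : T ⟶ S) (F : Fin S.tips → Tree n) (ι : ∀ s, F s ⟶ T)
    (h : Tree.IsFibers σ F ι),
    A.mul σ F ι h ≫ app T = (app S ⊗ₘ bigTensHom fun s => app (F s)) ≫ B.mul σ F ι h

instance : Category (NOperad n V) where
  Hom := Hom
  id A := ⟨fun _ => 𝟙 _, Category.comp_id _, fun σ F ι h => by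
    rw [Category.comp_id, bigTensHom_id]; simp⟩
  comp f g := ⟨fun T => f.app T ≫ g.app T, by rw [← Category.assoc, f.unit, g.unit],
    fun σ F ι h => by
      rw [← Category.assoc, f.mul, Category.assoc, g.mul, bigTensHom_comp,
        ← tensorHom_comp_tensorHom, Category.assoc]⟩
  id_comp _ := Hom.ext (funext fun _ => Category.id_comp _)
  comp_id _ := Hom.ext (funext fun _ => Category.comp_id _)
  assoc _ _ _ := Hom.ext (funext fun _ => Category.assoc _ _ _)

/-- An algebra of an `n`-operad in `V`: an object `x` with actions `A_T ⊗ x^{⊗|T|} ⟶ x`. -/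
structure Alg (A : NOperad n V) where
  carrier : V
  act : ∀ T : Tree n, A.obj T ⊗ bigTens (fun _ : Fin T.tips => carrier) ⟶ carrier
  act_unit : A.unit ▷ bigTens (fun _ : Fin 1 => carrier) ≫ act (Tree.linear n) =
    (λ_ _).hom ≫ single _
  act_mul : ∀ {T S : Tree n} (σ : T ⟶ S) (F : Fin S.tips → Tree n) (ι : ∀ s, F s ⟶ T)
    (h : Tree.IsFibers σ F ι),
    A.mul σ F ι h ▷ bigTens (fun _ => carrier) ≫ act T =
      distribute (A.obj S) (fun s => A.obj (F s)) (fun _ => carrier) h.onTips ≫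
        A.obj S ◁ bigTensHom (fun s => act (F s)) ≫ act S

/-- A morphism of algebras of an `n`-operad. -/
@[ext]
structure Alg.Hom {A : NOperad n V} (x y : A.Alg) where
  hom : x.carrier ⟶ y.carrier
  act : ∀ T : Tree n, x.act T ≫ hom = A.obj T ◁ bigTensHom (fun _ => hom) ≫ y.act T

instance (A : NOperad n V) : Category A.Alg where
  Hom := Alg.Hom
  id x := ⟨𝟙 _, fun T => by rw [bigTensHom_id]; simp⟩
  comp f g := ⟨f.hom ≫ g.hom, fun T => by
    rw [← Category.assoc, f.act, Category.assoc, g.act, bigTensHom_comp,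
      MonoidalCategory.whiskerLeft_comp, Category.assoc]⟩
  id_comp _ := Alg.Hom.ext (Category.id_comp _)
  comp_id _ := Alg.Hom.ext (Category.comp_id _)
  assoc _ _ _ := Alg.Hom.ext (Category.assoc _ _ _)

/-- The forgetful functor from algebras of an `n`-operad to `V`. -/
def forget (A : NOperad n V) : A.Alg ⥤ V where
  obj x := x.carrier
  map f := Alg.Hom.hom f

end NOperad

namespace SymOperad

/-- A morphism of symmetric operads. -/
@[ext]
structure Hom (A B : SymOperad V) where
  app : ∀ m, A.obj m ⟶ B.obj m
  act : ∀ {m : ℕ} (π : Equiv.Perm (Fin m)), A.act π ≫ app m = app m ≫ B.act π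
  unit : A.unit ≫ app 1 = B.unit
  mul : ∀ {m k : ℕ} (σ : Fin m → Fin k) (b : Fin k → ℕ) (κ : ∀ i, Fin (b i) → Fin m)
    (mσ : Monotone σ) (h : IsFibers σ b κ),
    A.mul σ b κ mσ h ≫ app m = (app k ⊗ₘ bigTensHom fun i => app (b i)) ≫ B.mul σ b κ mσ h

instance : Category (SymOperad V) where
  Hom := Hom
  id A := ⟨fun _ => 𝟙 _, fun _ => by simp, Category.comp_id _, fun σ b κ mσ h => by
    rw [Category.comp_id, bigTensHom_id]; simp⟩
  comp f g := ⟨fun m => f.app m ≫ g.app m,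
    fun π => by rw [← Category.assoc, f.act, Category.assoc, g.act, Category.assoc],
    by rw [← Category.assoc, f.unit, g.unit],
    fun σ b κ mσ h => by
      rw [← Category.assoc, f.mul, Category.assoc, g.mul, bigTensHom_comp,
        ← tensorHom_comp_tensorHom, Category.assoc]⟩
  id_comp _ := Hom.ext (funext fun _ => Category.id_comp _)
  comp_id _ := Hom.ext (funext fun _ => Category.comp_id _)
  assoc _ _ _ := Hom.ext (funext fun _ => Category.assoc _ _ _)

/-- An algebra of a symmetric operad in `V`: an object `x` with equivariant actions
`A_m ⊗ x^{⊗m} ⟶ x`. -/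
structure Alg (A : SymOperad V) where
  carrier : V
  act : ∀ m : ℕ, A.obj m ⊗ bigTens (fun _ : Fin m => carrier) ⟶ carrier
  act_unit : A.unit ▷ bigTens (fun _ : Fin 1 => carrier) ≫ act 1 = (λ_ _).hom ≫ single _
  act_mul : ∀ {m k : ℕ} (σ : Fin m → Fin k) (b : Fin k → ℕ) (κ : ∀ i, Fin (b i) → Fin m)
    (mσ : Monotone σ) (h : IsFibers σ b κ),
    A.mul σ b κ mσ h ▷ bigTens (fun _ => carrier) ≫ act m =
      distribute (A.obj k) (fun i => A.obj (b i)) (fun _ => carrier) h ≫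
        A.obj k ◁ bigTensHom (fun i => act (b i)) ≫ act k
  equivariance : ∀ {m : ℕ} (π : Equiv.Perm (Fin m)),
    (A.act π ⊗ₘ permute π fun _ => carrier) ≫ act m = act m

/-- A morphism of algebras of a symmetric operad. -/
@[ext]
structure Alg.Hom {A : SymOperad V} (x y : A.Alg) where
  hom : x.carrier ⟶ y.carrier
  act : ∀ m : ℕ, x.act m ≫ hom = A.obj m ◁ bigTensHom (fun _ => hom) ≫ y.act m

instance (A : SymOperad V) : Category A.Alg where
  Hom := Alg.Hom
  id x := ⟨𝟙 _, fun m => by rw [bigTensHom_id]; simp⟩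
  comp f g := ⟨f.hom ≫ g.hom, fun m => by
    rw [← Category.assoc, f.act, Category.assoc, g.act, bigTensHom_comp,
      MonoidalCategory.whiskerLeft_comp, Category.assoc]⟩
  id_comp _ := Alg.Hom.ext (Category.id_comp _)
  comp_id _ := Alg.Hom.ext (Category.comp_id _)
  assoc _ _ _ := Alg.Hom.ext (Category.assoc _ _ _)

/-- The forgetful functor from algebras of a symmetric operad to `V`. -/
def forget (A : SymOperad V) : A.Alg ⥤ V where
  obj x := x.carrier
  map f := Alg.Hom.hom f

end SymOperad

end Operads

/-! ### Desymmetrisation -/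

section Straighten

theorem IsFibers.comp_perm {m k : ℕ} {σ : Fin m → Fin k} {b : Fin k → ℕ}
    {κ κ' : ∀ i, Fin (b i) → Fin m} (h : IsFibers σ b κ) (r : Equiv.Perm (Fin m))
    (hr : ∀ i j, r (κ' i j) = κ i j) (hm : ∀ i, StrictMono (κ' i)) :
    IsFibers (σ ∘ r) b κ' where
  strictMono := hm
  mem_iff i s := by
    rw [Function.comp_apply, ← h.mem_iff]
    exact exists_congr fun j => by rw [← hr, r.injective.eq_iff]

theorem sort_symm_lt {m k : ℕ} (σ : Fin m → Fin k) {u v : Fin m}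
    (h : σ u < σ v ∨ (σ u = σ v ∧ u < v)) : (Tuple.sort σ).symm u < (Tuple.sort σ).symm v := by
  by_contra hn
  have hle := not_lt.1 hn
  have h1 : σ v ≤ σ u := by simpa using Tuple.monotone_sort σ hle
  rcases h with h | ⟨h, huv⟩
  · exact absurd h1 (not_le.2 h)
  · have hne : (Tuple.sort σ).symm v ≠ (Tuple.sort σ).symm u :=
      fun e => huv.ne' ((Tuple.sort σ).symm.injective e)
    have := ((Tuple.eq_sort_iff (f := σ) (σ := Tuple.sort σ)).1 rfl).2 _ _ (lt_of_le_of_ne hle hne)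
      (by simp [h])
    simp only [Equiv.apply_symm_apply] at this
    exact absurd huv (not_lt.2 this.le)

theorem IsFibers.sort {m k : ℕ} {σ : Fin m → Fin k} {b : Fin k → ℕ}
    {κ : ∀ i, Fin (b i) → Fin m} (h : IsFibers σ b κ) :
    IsFibers (σ ∘ Tuple.sort σ) b fun i j => (Tuple.sort σ).symm (κ i j) :=
  h.comp_perm _ (fun _ _ => Equiv.apply_symm_apply _ _) fun i _ _ hxy =>
    sort_symm_lt σ (Or.inr ⟨by rw [h.apply, h.apply], h.strictMono i hxy⟩)

theorem IsFibers.eq_sort {m k : ℕ} {σ : Fin m → Fin k} {b : Fin k → ℕ}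
    {κ κ' : ∀ i, Fin (b i) → Fin m} (h : IsFibers σ b κ) (r : Equiv.Perm (Fin m))
    (hr : ∀ i j, r (κ' i j) = κ i j) (mr : Monotone (σ ∘ r)) (h' : IsFibers (σ ∘ r) b κ') :
    r = Tuple.sort σ := by
  rw [Tuple.eq_sort_iff]
  refine ⟨mr, fun u v huv e => ?_⟩
  obtain ⟨x, hx⟩ := (h'.mem_iff _ u).2 rfl
  obtain ⟨y, hy⟩ := (h'.mem_iff _ v).2 e.symm
  rw [← hx, ← hy] at huv
  rw [← hx, ← hy, hr, hr]
  exact h.strictMono _ ((h'.strictMono _).lt_iff_lt.1 huv)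

theorem IsFibers.embedding_unique {m k : ℕ} {σ : Fin m → Fin k} {b : Fin k → ℕ}
    {κ κ' : ∀ i, Fin (b i) → Fin m} (h : IsFibers σ b κ) (h' : IsFibers σ b κ') : κ = κ' := by
  funext i
  refine ((h.strictMono i).range_inj (h'.strictMono i)).1 ?_
  ext s
  exact (h.mem_iff i s).trans (h'.mem_iff i s).symm

end Straighten

theorem assoc_aux {V : Type u} [Category.{v} V] [MonoidalCategory V]
    {Pk B P X X' W Y Z Z' : V} {u : Pk ⊗ B ⟶ P} {a : P ⟶ P} {e : X' ⟶ X}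
    {μ : P ⊗ X ⟶ Y} {ν : P ⊗ X' ⟶ Y} {g : Y ⟶ Y} {g' g'' : Y ⟶ Y} {D : (Pk ⊗ B) ⊗ X ⟶ W}
    {D' : (Pk ⊗ B) ⊗ X' ⟶ W} {c : W ⟶ Z} {c' : Z ⟶ Z'} {w : Z ⟶ Y} {w' : Z' ⟶ Y} {t : Y ⟶ Y}
    {c'' : W ⟶ Z'} [IsIso e]
    (h₁ : (a ⊗ₘ e) ≫ μ = ν ≫ g) (h₂ : u ▷ X' ≫ ν = D' ≫ c ≫ w) (hD : (Pk ⊗ B) ◁ e ≫ D = D')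
    (hc : c'' = c ≫ c') (hw : c' ≫ w' = w ≫ t) (hg : g ≫ g' = t ≫ g'') :
    (u ≫ a) ▷ X ≫ μ ≫ g' = D ≫ c'' ≫ w' ≫ g'' := by
  rw [← cancel_epi ((Pk ⊗ B) ◁ e), reassoc_of% hD, hc, Category.assoc, reassoc_of% hw, ← hg,
    ← reassoc_of% h₂, ← reassoc_of% h₁, whisker_exchange_assoc]
  simp [MonoidalCategory.tensorHom_def]

section Des

variable {n : ℕ} {V : Type u} [Category.{v} V] [MonoidalCategory V] [SymmetricCategory V]

namespace SymOperad

variable (A : SymOperad V)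

/-- The multiplication along an arbitrary map `σ` of finite ordinals. Here `Tuple.sort σ` is the
inverse of the permutation `π(σ)` which occurs in the unique factorisation `σ = ν(σ) ∘ π(σ)` with
`ν(σ)` order preserving and `π(σ)` a bijection which is order preserving on the fibers of `σ`; the
multiplication is the composite of the one along `ν(σ)` with the action of `π(σ)⁻¹`. -/
noncomputable def comp {m k : ℕ} (σ : Fin m → Fin k) (b : Fin k → ℕ)
    (κ : ∀ i, Fin (b i) → Fin m) (h : IsFibers σ b κ) :
    A.obj k ⊗ bigTens (fun i => A.obj (b i)) ⟶ A.obj m :=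
  A.mul (σ ∘ Tuple.sort σ) b (fun i j => (Tuple.sort σ).symm (κ i j)) (Tuple.monotone_sort σ) h.sort ≫
    A.act (Tuple.sort σ)

theorem mul_congr {m k : ℕ} {σ σ' : Fin m → Fin k} {b : Fin k → ℕ}
    {κ κ' : ∀ i, Fin (b i) → Fin m} (hσ : σ = σ') (hκ : κ = κ') (mσ : Monotone σ)
    (h : IsFibers σ b κ) (mσ' : Monotone σ') (h' : IsFibers σ' b κ') :
    A.mul σ b κ mσ h = A.mul σ' b κ' mσ' h' := by
  subst hσ hκ; rfl

theorem comp_eq {m k : ℕ} {σ : Fin m → Fin k} {b : Fin k → ℕ}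
    {κ κ' : ∀ i, Fin (b i) → Fin m} (h : IsFibers σ b κ) (r : Equiv.Perm (Fin m))
    (hr : ∀ i j, r (κ' i j) = κ i j) (mr : Monotone (σ ∘ r)) (h' : IsFibers (σ ∘ r) b κ') :
    A.comp σ b κ h = A.mul (σ ∘ r) b κ' mr h' ≫ A.act r := by
  obtain rfl := h.eq_sort r hr mr h'
  rw [comp]
  congr 1
  exact A.mul_congr rfl (h.sort.embedding_unique h') _ _ _ _

/-- Along an order preserving map, `comp` is the given multiplication. -/
theorem comp_of_monotone {m k : ℕ} {σ : Fin m → Fin k} {b : Fin k → ℕ}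
    {κ : ∀ i, Fin (b i) → Fin m} (h : IsFibers σ b κ) (mσ : Monotone σ) :
    A.comp σ b κ h = A.mul σ b κ mσ h := by
  rw [A.comp_eq h 1 (κ' := κ) (fun _ _ => rfl) mσ h, A.act_one, Category.comp_id]
  rfl

theorem comp_assoc {m l k : ℕ} (σ : Fin m → Fin l) (ω : Fin l → Fin k)
    (b : Fin k → ℕ) (κ : ∀ i, Fin (b i) → Fin l) (hω : IsFibers ω b κ)
    (f : Fin l → ℕ) (φ : ∀ s, Fin (f s) → Fin m) (hσ : IsFibers σ f φ)
    (d : Fin k → ℕ) (ι : ∀ i, Fin (d i) → Fin m) (hσω : IsFibers (ω ∘ σ) d ι)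
    (τ : ∀ i, Fin (d i) → Fin (b i)) (hι : ∀ i x, κ i (τ i x) = σ (ι i x))
    (ψ : ∀ i j, Fin (f (κ i j)) → Fin (d i)) (hψ : ∀ i j x, ι i (ψ i j x) = φ (κ i j) x)
    (hτ : ∀ i, IsFibers (τ i) (fun j => f (κ i j)) (ψ i)) :
    A.comp ω b κ hω ▷ bigTens (fun s => A.obj (f s)) ≫ A.comp σ f φ hσ =
      distribute (A.obj k) (fun i => A.obj (b i)) (fun s => A.obj (f s)) hω ≫
        A.obj k ◁ bigTensHom (fun i => A.comp (τ i) _ (ψ i) (hτ i)) ≫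
          A.comp (ω ∘ σ) d ι hσω := by
  obtain ⟨q, κ', mq, hq, rfl⟩ : ∃ (q : Equiv.Perm (Fin l)) (κ' : ∀ i, Fin (b i) → Fin l),
      Monotone (ω ∘ q) ∧ IsFibers (ω ∘ q) b κ' ∧ κ = fun i j => q (κ' i j) :=
    ⟨Tuple.sort ω, fun i j => (Tuple.sort ω).symm (κ i j), Tuple.monotone_sort ω, hω.sort, by simp⟩
  have hg : IsFibers (q.symm ∘ σ) (fun s => f (q s)) (fun s => φ (q s)) :=
    ⟨fun s => hσ.strictMono _, fun s x => by
      rw [hσ.mem_iff, Function.comp_apply, Equiv.symm_apply_eq]⟩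
  have hgι : ∀ i x, (q.symm ∘ σ) (ι i x) = κ' i (τ i x) := fun i x => by
    rw [Function.comp_apply, ← hι, Equiv.symm_apply_apply]
  have hι' : IsFibers ((ω ∘ q) ∘ ((q.symm ∘ σ) ∘ Tuple.sort (q.symm ∘ σ))) d
      fun i x => (Tuple.sort (q.symm ∘ σ)).symm (ι i (Tuple.sort (τ i) x)) := by
    refine ⟨fun i x y hxy => sort_symm_lt _ ?_, fun i s => ?_⟩
    · rw [hgι, hgι]
      rcases (Tuple.monotone_sort (τ i) hxy.le).lt_or_eq with h | h
      · exact Or.inl (hq.strictMono i h)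
      · exact Or.inr ⟨congrArg _ h, hσω.strictMono i
          (((Tuple.eq_sort_iff (f := τ i) (σ := Tuple.sort (τ i))).1 rfl).2 _ _ hxy h)⟩
    · have := hσω.mem_iff i (Tuple.sort (q.symm ∘ σ) s)
      simp only [Function.comp_apply, Equiv.apply_symm_apply] at this ⊢
      rw [← this]
      constructor
      · rintro ⟨x, hx⟩
        exact ⟨_, (Equiv.symm_apply_eq _).1 hx⟩
      · rintro ⟨x, hx⟩
        refine ⟨(Tuple.sort (τ i)).symm x, ?_⟩
        rw [Equiv.symm_apply_eq, Equiv.apply_symm_apply, hx]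
  have e₂ : (ω ∘ q) ∘ ((q.symm ∘ σ) ∘ Tuple.sort (q.symm ∘ σ)) =
      (ω ∘ σ) ∘ Tuple.sort (ω ∘ σ) := by
    have h1 : (ω ∘ q) ∘ ((q.symm ∘ σ) ∘ Tuple.sort (q.symm ∘ σ)) =
      (ω ∘ σ) ∘ Tuple.sort (q.symm ∘ σ) := by funext x; simp
    rw [h1]
    refine Tuple.unique_monotone ?_ (Tuple.monotone_sort _)
    rw [← h1]
    exact mq.comp (Tuple.monotone_sort _)
  have e₃ : ∀ i x, (Tuple.sort (q.symm ∘ σ)).symm (ι i (Tuple.sort (τ i) x)) =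
      (Tuple.sort (ω ∘ σ)).symm (ι i x) := fun i x =>
    congrFun (congrFun ((e₂ ▸ hι').embedding_unique hσω.sort) i) x
  rw [A.comp_eq hω q (fun _ _ => rfl) mq hq]
  refine assoc_aux (c' := A.obj k ◁ bigTensHom fun i => A.act (Tuple.sort (τ i)))
    (t := A.act ((Tuple.sort (ω ∘ σ))⁻¹ * Tuple.sort (q.symm ∘ σ)))
    (A.equivariance_outer (σ ∘ Tuple.sort σ) ((q.symm ∘ σ) ∘ Tuple.sort (q.symm ∘ σ))
      (Tuple.monotone_sort σ) (Tuple.monotone_sort _)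
      ((Tuple.sort σ)⁻¹ * Tuple.sort (q.symm ∘ σ)) q (fun x => ?_) f _ hσ.sort _ hg.sort
      (fun i x => ?_))
    (A.mul_assoc _ (ω ∘ q) (Tuple.monotone_sort _) mq b κ' hq _ _ hg.sort d _ hι'
      (fun i x => τ i (Tuple.sort (τ i) x)) (fun i x => ?_) (fun i => Tuple.monotone_sort (τ i))
      (fun i j x => (Tuple.sort (τ i)).symm (ψ i j x)) (fun i j x => ?_) (fun i => (hτ i).sort))
    ?_ ?_ ?_ ?_
  · simp
  · exact congrArg (Tuple.sort σ).symm (Equiv.apply_symm_apply (Tuple.sort (q.symm ∘ σ)) (φ (q i) x))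
  · exact ((congrArg _ (Equiv.apply_symm_apply _ _)).trans (hgι i _)).symm
  · exact congrArg _ ((congrArg (ι i) (Equiv.apply_symm_apply _ _)).trans (hψ i j x))
  · rw [distribute, distribute, ← permute_regroup (fun s => A.obj (f s)) q hq hω,
      MonoidalCategory.whiskerLeft_comp]
    simp
  · rw [← MonoidalCategory.whiskerLeft_comp, ← bigTensHom_comp]; rfl
  · rw [A.equivariance_inner _ _ _ _ _ ((Tuple.sort (ω ∘ σ))⁻¹ * Tuple.sort (q.symm ∘ σ))]
    · congr 1
      exact A.mul_congr e₂.symm (funext fun i => funext fun x => (e₃ i x).symm) _ _ _ _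
    · intro i x
      rw [← e₃]
      simp
  · rw [← A.act_mul, ← A.act_mul, mul_inv_cancel_left, mul_inv_cancel_left]

theorem Hom.comp_app {A B : SymOperad V} (f : A.Hom B) {m k : ℕ} (σ : Fin m → Fin k)
    (b : Fin k → ℕ) (κ : ∀ i, Fin (b i) → Fin m) (h : IsFibers σ b κ) :
    A.comp σ b κ h ≫ f.app m = (f.app k ⊗ₘ bigTensHom fun i => f.app (b i)) ≫ B.comp σ b κ h := by
  rw [comp, comp, Category.assoc, f.act, ← Category.assoc, f.mul, Category.assoc]

end SymOperad

/-- The desymmetrisation of a symmetric operad: `Des_n(A)_T = A_{|T|}`, and the multiplication along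
`σ : T ⟶ S` is the multiplication of `A` along the underlying map of tips. -/
noncomputable def desObj (n : ℕ) (A : SymOperad V) : NOperad n V where
  obj T := A.obj T.tips
  unit := A.unit
  mul σ F ι h := A.comp (Tree.onTips σ) _ _ h.onTips
  mul_assoc σ ω B κ hω F φ hσ D ι hσω τ hτκ ψ hψ hτ :=
    A.comp_assoc _ _ _ _ hω.onTips _ _ hσ.onTips _ _ hσω.onTips (fun i => Tree.onTips (τ i))
      (fun i x => congrArg (fun f => Tree.onTips f x) (hτκ i)) (fun i j => Tree.onTips (ψ i j))
      (fun i j x => congrArg (fun f => Tree.onTips f x) (hψ i j)) (fun i => (hτ i).onTips)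
  mul_id T ι h := by
    have e : (fun (s : Fin T.tips) (_ : Fin 1) => s) = fun s => Tree.onTips (ι s) := by
      funext s x
      exact ((h.onTips).apply s x).symm
    have h' : IsFibers (fun s : Fin T.tips => s) (fun _ => 1) (fun s _ => s) := e ▸ h.onTips
    refine Eq.trans ?_ (A.mul_id T.tips h')
    congr 1
    refine (A.comp_of_monotone h.onTips monotone_id).trans ?_
    exact A.mul_congr rfl e.symm _ _ _ _
  mul_unit T σ h := by
    have e : Tree.onTips σ = fun _ => (0 : Fin 1) := by
      funext x; exact Subsingleton.elim (α := Fin 1) _ _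
    have h' : IsFibers (fun _ : Fin T.tips => (0 : Fin 1)) (fun _ => T.tips) (fun _ x => x) :=
      e ▸ h.onTips
    refine Eq.trans ?_ (A.mul_unit T.tips h')
    congr 1
    refine (A.comp_of_monotone h.onTips (e ▸ monotone_const)).trans ?_
    exact A.mul_congr e rfl _ _ _ _

/-- The desymmetrisation functor from symmetric operads to `n`-operads. -/
noncomputable def Des (n : ℕ) (V : Type u) [Category.{v} V] [MonoidalCategory V]
    [SymmetricCategory V] : SymOperad V ⥤ NOperad n V where
  obj A := desObj n A
  map f :=
    { app := fun T => SymOperad.Hom.app f T.tips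
      unit := SymOperad.Hom.unit f
      mul := fun σ _ _ h => SymOperad.Hom.comp_app f (Tree.onTips σ) _ _ h.onTips }
  map_id _ := rfl
  map_comp _ _ := rfl

theorem alg_aux {V : Type u} [Category.{v} V] [MonoidalCategory V] {S P X X' W x : V}
    {μ : S ⟶ P} {a : P ⟶ P} {e : X' ⟶ X} {α : P ⊗ X ⟶ x} {α' : P ⊗ X' ⟶ x} {D : S ⊗ X ⟶ W}
    {D' : S ⊗ X' ⟶ W} {c : W ⟶ x} [IsIso e] (h₁ : (a ⊗ₘ e) ≫ α = α') (hD : S ◁ e ≫ D = D')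
    (h₂ : μ ▷ X' ≫ α' = D' ≫ c) : (μ ≫ a) ▷ X ≫ α = D ≫ c := by
  rw [← cancel_epi (S ◁ e), reassoc_of% hD, ← h₂, ← h₁, whisker_exchange_assoc]
  simp [MonoidalCategory.tensorHom_def]

theorem SymOperad.Alg.comp_act {B : SymOperad V} (x : B.Alg) {m k : ℕ} (σ : Fin m → Fin k)
    (b : Fin k → ℕ) (κ : ∀ i, Fin (b i) → Fin m) (h : IsFibers σ b κ) :
    B.comp σ b κ h ▷ bigTens (fun _ => x.carrier) ≫ x.act m =
      distribute (B.obj k) (fun i => B.obj (b i)) (fun _ => x.carrier) h ≫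
        B.obj k ◁ bigTensHom (fun i => x.act (b i)) ≫ x.act k := by
  obtain ⟨q, κ', mq, hq, rfl⟩ : ∃ (q : Equiv.Perm (Fin m)) (κ' : ∀ i, Fin (b i) → Fin m),
      Monotone (σ ∘ q) ∧ IsFibers (σ ∘ q) b κ' ∧ κ = fun i j => q (κ' i j) :=
    ⟨Tuple.sort σ, fun i j => (Tuple.sort σ).symm (κ i j), Tuple.monotone_sort σ, h.sort, by simp⟩
  rw [B.comp_eq h q (fun _ _ => rfl) mq hq]
  refine alg_aux (x.equivariance q) ?_ (x.act_mul (σ ∘ q) b κ' mq hq)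
  rw [distribute, distribute, ← permute_regroup (fun _ => x.carrier) q hq h,
    MonoidalCategory.whiskerLeft_comp]
  simp

theorem unit_aux {V : Type u} [Category.{v} V] [MonoidalCategory V] {I P Q X x : V}
    {e : I ⟶ P} {f : P ⟶ Q} {e' : I ⟶ Q} {α : Q ⊗ X ⟶ x} {c : I ⊗ X ⟶ x} (h : e ≫ f = e')
    (h' : e' ▷ X ≫ α = c) : e ▷ X ≫ f ▷ X ≫ α = c := by
  rw [← h', ← h, comp_whiskerRight, Category.assoc]

theorem mul_aux {V : Type u} [Category.{v} V] [MonoidalCategory V] {S S' A B X W W' x : V}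
    {μ : S ⟶ A} {f : A ⟶ B} {g : S ⟶ S'} {ν : S' ⟶ B} {α : B ⊗ X ⟶ x} {D : S ⊗ X ⟶ W}
    {D' : S' ⊗ X ⟶ W'} {w : W ⟶ W'} {c : W' ⟶ x} {c' : W ⟶ x} (h₁ : μ ≫ f = g ≫ ν)
    (h₂ : ν ▷ X ≫ α = D' ≫ c) (h₃ : g ▷ X ≫ D' = D ≫ w) (h₄ : w ≫ c = c') :
    μ ▷ X ≫ f ▷ X ≫ α = D ≫ c' := by
  rw [← comp_whiskerRight_assoc, h₁, comp_whiskerRight, Category.assoc, h₂, reassoc_of% h₃, h₄]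

theorem act_aux {V : Type u} [Category.{v} V] [MonoidalCategory V] {A B W Y Z x : V}
    {f : A ⟶ B} {t : W ⟶ Y} {t' : Y ⟶ Z} {t'' : W ⟶ Z} {α : B ⊗ Z ⟶ x} (h : t'' = t ≫ t') :
    (f ⊗ₘ t) ≫ B ◁ t' ≫ α = A ◁ t'' ≫ f ▷ Z ≫ α := by
  rw [h, MonoidalCategory.tensorHom_def, Category.assoc, ← whisker_exchange_assoc,
    ← whisker_exchange_assoc, MonoidalCategory.whiskerLeft_comp, Category.assoc]

theorem map_act_aux {V : Type u} [Category.{v} V] [MonoidalCategory V] {A B X Y x y : V}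
    {f : A ⟶ B} {α : B ⊗ X ⟶ x} {g : x ⟶ y} {t : X ⟶ Y} {β : B ⊗ Y ⟶ y}
    (h : α ≫ g = B ◁ t ≫ β) : (f ▷ X ≫ α) ≫ g = A ◁ t ≫ f ▷ Y ≫ β := by
  rw [Category.assoc, h, whisker_exchange_assoc]

theorem zip_aux {A A' B L L' K M M' : V} {f : A ⟶ A'} {l : L ⟶ L'} {z : L ⊗ K ⟶ M}
    {z' : L' ⊗ K ⟶ M'} {m : M ⟶ M'} (h : l ▷ K ≫ z' = z ≫ m) :
    (f ⊗ₘ l) ▷ (B ⊗ K) ≫ tensorμ A' L' B K ≫ (A' ⊗ B) ◁ z' =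
      (tensorμ A L B K ≫ (A ⊗ B) ◁ z) ≫ (f ▷ B ⊗ₘ m) := by
  have h' := tensorμ_natural_left f l B K
  rw [reassoc_of% h', Category.assoc]
  congr 1
  rw [MonoidalCategory.tensorHom_def, Category.assoc, ← MonoidalCategory.whiskerLeft_comp, h,
    MonoidalCategory.whiskerLeft_comp, ← whisker_exchange_assoc, MonoidalCategory.tensorHom_def]

theorem zip_natural {ι : Type} {Y Y' : ι → V} (f : ∀ i, Y i ⟶ Y' i) (Z : ι → V) :
    ∀ L : List ι, tensHom f L ▷ tens Z L ≫ zip Y' Z L =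
      zip Y Z L ≫ tensHom (fun i => f i ▷ Z i) L
  | [] => by
    refine Eq.trans ?_ (Category.comp_id _).symm
    exact (congrArg (· ≫ _) (id_whiskerRight _ _)).trans (Category.id_comp _)
  | _ :: L => zip_aux (zip_natural f Z L)

theorem distribute_aux {V : Type u} [Category.{v} V] [MonoidalCategory V]
    {P P' Y Y' X X' W W' : V} {g : P ⟶ P'} {l : Y ⟶ Y'} {r : X ⟶ X'} {z : Y ⊗ X' ⟶ W}
    {z' : Y' ⊗ X' ⟶ W'} {w : W ⟶ W'} (h : l ▷ X' ≫ z' = z ≫ w) :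
    (g ⊗ₘ l) ▷ X ≫ (α_ _ _ _).hom ≫ P' ◁ (Y' ◁ r ≫ z') =
      ((α_ _ _ _).hom ≫ P ◁ (Y ◁ r ≫ z)) ≫ (g ⊗ₘ w) := by
  have e : (g ⊗ₘ l) ▷ X ≫ (α_ _ _ _).hom = (α_ _ _ _).hom ≫ (g ⊗ₘ (l ▷ X)) := by
    rw [← tensorHom_id, associator_naturality, tensorHom_id]
  rw [reassoc_of% e, Category.assoc]
  congr 1
  have h' := congrArg (fun t => P' ◁ t) h
  simp only [MonoidalCategory.whiskerLeft_comp] at h'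
  simp only [MonoidalCategory.tensorHom_def, Category.assoc, MonoidalCategory.whiskerLeft_comp,
    whisker_exchange_assoc]
  rw [← h', ← MonoidalCategory.whiskerLeft_comp_assoc, ← MonoidalCategory.whiskerLeft_comp_assoc,
    whisker_exchange]

theorem distribute_natural {m k : ℕ} {σ : Fin m → Fin k} {b : Fin k → ℕ}
    {κ : ∀ i, Fin (b i) → Fin m} {P P' : V} (g : P ⟶ P') {Y Y' : Fin k → V}
    (f : ∀ i, Y i ⟶ Y' i) (X : Fin m → V) (h : IsFibers σ b κ) :
    (g ⊗ₘ bigTensHom f) ▷ bigTens X ≫ distribute P' Y' X h =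
      distribute P Y X h ≫ (g ⊗ₘ bigTensHom fun i => f i ▷ bigTens fun j => X (κ i j)) := by
  have hz := zip_natural f (fun i => bigTens fun j => X (κ i j)) (List.finRange k)
  exact distribute_aux hz

/-- Restriction of algebras along a morphism of `n`-operads `f : A ⟶ Des_n(B)`: an algebra of the
symmetric operad `B` becomes an algebra of `A` on the same object, with the actions
`A_T ⊗ x^{⊗|T|} ⟶ B_{|T|} ⊗ x^{⊗|T|} ⟶ x`. -/
noncomputable def restrict {A : NOperad n V} {B : SymOperad V} (f : A ⟶ (Des n V).obj B) :
    B.Alg ⥤ A.Alg where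
  obj x :=
    { carrier := x.carrier
      act := fun T => NOperad.Hom.app f T ▷ _ ≫ x.act T.tips
      act_unit := unit_aux (NOperad.Hom.unit f) x.act_unit
      act_mul := fun {_ S} σ F ι h => mul_aux (NOperad.Hom.mul f σ F ι h)
        (x.comp_act (Tree.onTips σ) _ _ h.onTips)
        (distribute_natural (NOperad.Hom.app f S) (fun s => NOperad.Hom.app f (F s)) _ h.onTips)
        (act_aux (bigTensHom_comp _ _)) }
  map g := ⟨SymOperad.Alg.Hom.hom g, fun T => map_act_aux (SymOperad.Alg.Hom.act g T.tips)⟩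
  map_id _ := rfl
  map_comp _ _ := rfl

/-- Restriction does not change the underlying object. -/
theorem restrict_forget {A : NOperad n V} {B : SymOperad V} (f : A ⟶ (Des n V).obj B) :
    restrict f ⋙ A.forget = B.forget := rfl

/-- `B` is a symmetrisation of the `n`-operad `A`: the forgetful functor from the category of
algebras of `A` is monadic, and the corresponding monad on `V` (the `n`-fold suspension) comes from
the symmetric operad `B`, that is, it is the monad on `V` whose algebras are the algebras of `B`. -/
structure IsSymmetrisation (A : NOperad n V) (B : SymOperad V) : Prop where
  monadic : Nonempty (MonadicRightAdjoint A.forget)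
  comesFrom : ∀ (F : V ⥤ A.Alg) (adj : F ⊣ A.forget), ∃ (G : V ⥤ B.Alg) (adj' : G ⊣ B.forget),
    (Monad.comparison adj').IsEquivalence ∧ Nonempty (adj.toMonad ≅ adj'.toMonad)

end Des

end HigherOperad

/-!
The proof has three ingredients: a construction of free structures in `V` by generators and
relations, a coherence theorem for symmetries of iterated tensor products, and Beck's criterion.

**Free structures.** In a cocomplete closed category, a free structure is built in one step.
Consider the formal composites (terms) of the operations of the theory and of the given generators.
A term `t` has a domain in `V`, an iterated tensor product of the generators, and a value `ev t` in
each model. The terms of a given sort are the objects of a small category, in which a morphism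
`t ⟶ s` is a morphism `φ` between the domains with `φ ≫ ev s = ev t` in *all* models. The colimit
of the domains is the underlying object of the free structure (`Signature.free`). The operations descend
to these colimits, because tensor products preserve colimits in each variable
(`Multicocontinuous`). An equation which holds in all models is a morphism of terms, so it holds in
the colimit (`Signature.free_equation`, `Signature.free_eq_of_forall_eq`). The free structure is
thereby a model itself, without an analysis of the relations which the axioms generate, and it maps
uniquely to any other model (`Signature.exists_free_isHom`, `Signature.free_isHom_unique`). With
symmetric operads under an `n`-operad `A` as models, this gives the symmetrisation `symObj A` and
the left adjoint of desymmetrisation (`exists_symObj_hom`, `symObj_hom_ext`). With algebras of `A`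
under an object `x` as models, it gives the free algebra `freeAlg A x` and the left adjoint of the
forgetful functor.

**Algebras.** An algebra with underlying object `x` is a morphism to the endomorphism operad of `x`
(`endOperad`, `SymOperad.Alg.toHom`, `NOperad.Alg.toHom`). The axioms of `endOperad` are identities
between structural isomorphisms which permute the factors of a tensor product. They follow from
coherence: two such morphisms agree if they induce the same permutation, provided that the factors
are labelled by distinct variables (`IsCanonical.unique`). By the universal property of the unit
`A ⟶ Des_n(Sym_n(A))`, an algebra of `A` then extends uniquely to an algebra of `Sym_n(A)`
(`restrict_extendObj`, `extendObj_restrict`). A morphism in `V` which commutes with the actions of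
`A` commutes with all composites of operations from `A`, and these cover `Sym_n(A)`, so it is a
morphism of algebras of `Sym_n(A)` (`act_comp_of_restrict`). Hence restriction is an isomorphism of
categories over `V`.

**Monads.** A split coequalizer in `V` of a pair of morphisms of algebras carries an algebra
structure which makes it a coequalizer of algebras (`NOperad.Alg.quotientIsColimit`), so the
forgetful functor from algebras of `A` is monadic (`monadicRightAdjoint`). The adjunction, its
monad and the equivalence with the category of algebras of the monad are carried over to `Sym_n(A)`
along the isomorphism of the categories of algebras (`monadIsoComp`,
`comparison_comp_isEquivalence`).
-/

universe w

namespace HigherOperad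

/-! ### Naturality of the structural morphisms -/

section Naturality

variable {V : Type u} [Category.{v} V] [MonoidalCategory V]

theorem split_natural {ι : Type} {X Y : ι → V} (g : ∀ i, X i ⟶ Y i) (L' : List ι) :
    ∀ L : List ι, tensHom g (L ++ L') ≫ split Y L' L = split X L' L ≫ (tensHom g L ⊗ₘ tensHom g L')
  | [] => by
    dsimp only [List.nil_append, tens, tensHom, split]
    simp
  | i :: L => by
    have h := split_natural g L' L
    dsimp only [List.cons_append, tens, tensHom, split]
    rw [Category.assoc, ← associator_inv_naturality, ← Category.assoc, ← Category.assoc]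
    congr 1
    rw [← id_tensorHom, ← id_tensorHom, tensorHom_comp_tensorHom, tensorHom_comp_tensorHom, h]
    simp

theorem whiskerLeft_cons {A A' L L' M M' : V} {a : A ⟶ A'} {l : L ⟶ L'} {m : M ⟶ M'} {r : L ⟶ M}
    {r' : L' ⟶ M'} (h : l ≫ r' = r ≫ m) : (a ⊗ₘ l) ≫ A' ◁ r' = A ◁ r ≫ (a ⊗ₘ m) := by
  rw [← id_tensorHom, ← id_tensorHom, tensorHom_comp_tensorHom, tensorHom_comp_tensorHom, h]
  simp

theorem remap_natural {ι κ : Type} (f : ι → κ) {X Y : κ → V} (g : ∀ i, X i ⟶ Y i) :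
    ∀ L : List ι, tensHom (fun i => g (f i)) L ≫ remap f Y L = remap f X L ≫ tensHom g (L.map f)
  | [] => rfl
  | _ :: L => whiskerLeft_cons (remap_natural f g L)

theorem unmap_natural {ι κ : Type} (f : ι → κ) {X Y : κ → V} (g : ∀ i, X i ⟶ Y i) :
    ∀ L : List ι, tensHom g (L.map f) ≫ unmap f Y L = unmap f X L ≫ tensHom (fun i => g (f i)) L
  | [] => rfl
  | _ :: L => whiskerLeft_cons (unmap_natural f g L)

theorem blocks_natural_aux {L L' A A' B B' C C' D D' : V} {s : L ⟶ A ⊗ B} {s' : L' ⟶ A' ⊗ B'}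
    {l : L ⟶ L'} {a : A ⟶ A'} {b : B ⟶ B'} {c : C ⟶ C'} {d : D ⟶ D'} {u : A ⟶ C} {u' : A' ⟶ C'}
    {t : B ⟶ D} {t' : B' ⟶ D'} (h : l ≫ s' = s ≫ (a ⊗ₘ b)) (hu : a ≫ u' = u ≫ c)
    (ht : b ≫ t' = t ≫ d) : l ≫ s' ≫ (u' ⊗ₘ t') = (s ≫ (u ⊗ₘ t)) ≫ (c ⊗ₘ d) := by
  rw [reassoc_of% h, Category.assoc, tensorHom_comp_tensorHom, tensorHom_comp_tensorHom, hu, ht]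

theorem blocks_natural {k : ℕ} {ι : Type} {X Y : ι → V} (g : ∀ i, X i ⟶ Y i) (b : Fin k → ℕ)
    (κ : ∀ i, Fin (b i) → ι) : ∀ L : List (Fin k),
      tensHom g (L.flatMap fun i => (List.finRange (b i)).map (κ i)) ≫ blocks Y b κ L =
        blocks X b κ L ≫ tensHom (fun i => bigTensHom fun j => g (κ i j)) L
  | [] => rfl
  | i :: L => blocks_natural_aux (split_natural g _ _) (unmap_natural (κ i) g _)
      (blocks_natural g b κ L)

variable [SymmetricCategory V]

theorem swap_natural {A A' B B' C C' : V} (f : A ⟶ A') (g : B ⟶ B') (h : C ⟶ C') :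
    (f ⊗ₘ g ⊗ₘ h) ≫ swap A' B' C' = swap A B C ≫ (g ⊗ₘ f ⊗ₘ h) := by
  simp only [swap, Category.assoc]
  rw [associator_inv_naturality_assoc, ← associator_naturality, ← tensorHom_id, ← tensorHom_id,
    tensorHom_comp_tensorHom_assoc, tensorHom_comp_tensorHom_assoc,
    BraidedCategory.braiding_naturality]
  simp

theorem Rem.hom_natural {ι : Type} {X Y : ι → V} (g : ∀ i, X i ⟶ Y i) {i : ι} {L M : List ι}
    (r : Rem i L M) : (g i ⊗ₘ tensHom g M) ≫ r.hom Y = r.hom X ≫ tensHom g L := by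
  induction r with
  | head L =>
    dsimp only [Rem.hom, tens, tensHom]
    simp
  | tail j r ih =>
    dsimp only [Rem.hom, tens, tensHom]
    rw [← Category.assoc, swap_natural, Category.assoc, Category.assoc, ← id_tensorHom,
      ← id_tensorHom, tensorHom_comp_tensorHom, tensorHom_comp_tensorHom, ih]
    simp

theorem Reordering.hom_natural {ι : Type} {X Y : ι → V} (g : ∀ i, X i ⟶ Y i) {L L' : List ι}
    (p : Reordering L L') : tensHom g L ≫ p.hom Y = p.hom X ≫ tensHom g L' := by
  induction p with
  | nil =>
    dsimp only [Reordering.hom, tens, tensHom]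
  | cons r p ih =>
    dsimp only [Reordering.hom, tens, tensHom]
    rw [Category.assoc, ← r.hom_natural g, ← Category.assoc, ← Category.assoc]
    congr 1
    rw [← id_tensorHom, ← id_tensorHom, tensorHom_comp_tensorHom, tensorHom_comp_tensorHom, ih]
    simp

theorem reorder_natural {ι : Type} {X Y : ι → V} (g : ∀ i, X i ⟶ Y i) {L L' : List ι}
    (h : L.Perm L') : tensHom g L ≫ reorder Y h = reorder X h ≫ tensHom g L' :=
  Reordering.hom_natural g _

theorem permute_natural {k : ℕ} (ρ : Equiv.Perm (Fin k)) {X Y : Fin k → V} (g : ∀ i, X i ⟶ Y i) :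
    bigTensHom (fun i => g (ρ i)) ≫ permute ρ Y = permute ρ X ≫ bigTensHom g := by
  have h := remap_natural ρ g (List.finRange k)
  rw [permute, permute, ← Category.assoc, h, Category.assoc, Category.assoc, reorder_natural]

theorem regroup_natural {m k : ℕ} {σ : Fin m → Fin k} {b : Fin k → ℕ}
    {κ : ∀ i, Fin (b i) → Fin m} {X Y : Fin m → V} (g : ∀ i, X i ⟶ Y i) (h : IsFibers σ b κ) :
    bigTensHom g ≫ regroup Y h =
      regroup X h ≫ bigTensHom fun i => bigTensHom fun j => g (κ i j) := by
  rw [regroup, regroup, ← Category.assoc, reorder_natural, Category.assoc, Category.assoc,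
    blocks_natural]

theorem zip_natural_right {ι : Type} (Y : ι → V) {Z Z' : ι → V} (g : ∀ i, Z i ⟶ Z' i) :
    ∀ L : List ι, tens Y L ◁ tensHom g L ≫ zip Y Z' L = zip Y Z L ≫ tensHom (fun i => Y i ◁ g i) L
  | [] => by
    dsimp only [tens, tensHom, zip]
    simp
  | i :: L => by
    have h := zip_natural_right Y g L
    have h' := tensorμ_natural_right (Y i) (tens Y L) (g i) (tensHom g L)
    dsimp only [tens, tensHom, zip]
    rw [reassoc_of% h', Category.assoc, ← id_tensorHom (Y i ⊗ Z' i),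
      ← id_tensorHom (Y i ⊗ Z i), tensorHom_comp_tensorHom, tensorHom_comp_tensorHom, h]
    simp

theorem distribute_natural_right {m k : ℕ} {σ : Fin m → Fin k} {b : Fin k → ℕ}
    {κ : ∀ i, Fin (b i) → Fin m} (P : V) (Y : Fin k → V) {X X' : Fin m → V}
    (g : ∀ i, X i ⟶ X' i) (h : IsFibers σ b κ) :
    (P ⊗ bigTens Y) ◁ bigTensHom g ≫ distribute P Y X' h =
      distribute P Y X h ≫ P ◁ bigTensHom fun i => Y i ◁ bigTensHom fun j => g (κ i j) := by
  have hz := zip_natural_right Y (fun i => bigTensHom fun j => g (κ i j)) (List.finRange k)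
  have e : bigTens Y ◁ bigTensHom g ≫ bigTens Y ◁ regroup X' h ≫ zip Y _ (List.finRange k) =
      (bigTens Y ◁ regroup X h ≫ zip Y _ (List.finRange k)) ≫
        bigTensHom fun i => Y i ◁ bigTensHom fun j => g (κ i j) := by
    rw [Category.assoc, ← hz, ← MonoidalCategory.whiskerLeft_comp_assoc, regroup_natural,
      MonoidalCategory.whiskerLeft_comp, Category.assoc]
  rw [distribute, distribute, associator_naturality_right_assoc,
    ← MonoidalCategory.whiskerLeft_comp, e, MonoidalCategory.whiskerLeft_comp, Category.assoc]

end Naturality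

/-! ### Functors of several variables preserving colimits in each variable -/

section Multicocontinuous

variable {V : Type u} [Category.{v} V]

/-- A functor of several variables is multicocontinuous if, for all small diagrams `D p` with
colimit cocones `c p`, its value at the tips of the `c p` is the colimit of its values on the
product of the index categories. -/
structure Multicocontinuous {P : Type} (S : (P → V) ⥤ V) : Prop where
  exists_desc : ∀ (J : P → Type) [∀ p, Category.{v} (J p)] (D : ∀ p, J p ⥤ V)
    (c : ∀ p, Cocone (D p)) (_ : ∀ p, IsColimit (c p)) (Z : V)
    (h : ∀ j : ∀ p, J p, S.obj (fun p => (D p).obj (j p)) ⟶ Z),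
    (∀ (j j' : ∀ p, J p) (f : ∀ p, j p ⟶ j' p),
      S.map (X := fun p => (D p).obj (j p)) (Y := fun p => (D p).obj (j' p))
        (fun p => (D p).map (f p)) ≫ h j' = h j) →
    ∃ g : S.obj (fun p => (c p).pt) ⟶ Z,
      ∀ j, S.map (X := fun p => (D p).obj (j p)) (Y := fun p => (c p).pt)
        (fun p => (c p).ι.app (j p)) ≫ g = h j
  hom_ext : ∀ (J : P → Type) [∀ p, Category.{v} (J p)] (D : ∀ p, J p ⥤ V)
    (c : ∀ p, Cocone (D p)) (_ : ∀ p, IsColimit (c p)) (Z : V)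
    (g g' : S.obj (fun p => (c p).pt) ⟶ Z),
    (∀ j : ∀ p, J p, S.map (X := fun p => (D p).obj (j p)) (Y := fun p => (c p).pt)
        (fun p => (c p).ι.app (j p)) ≫ g =
      S.map (X := fun p => (D p).obj (j p)) (Y := fun p => (c p).pt)
        (fun p => (c p).ι.app (j p)) ≫ g') → g = g'

theorem Multicocontinuous.of_iso {P : Type} {S T : (P → V) ⥤ V} (hS : Multicocontinuous S)
    (e : S ≅ T) : Multicocontinuous T where
  exists_desc J _ D c hc Z h hh := by
    obtain ⟨g, hg⟩ := hS.exists_desc J D c hc Z (fun j => e.hom.app _ ≫ h j) (fun j j' f => by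
      rw [e.hom.naturality_assoc, hh])
    refine ⟨e.inv.app _ ≫ g, fun j => ?_⟩
    rw [e.inv.naturality_assoc, hg]
    simp
  hom_ext J _ D c hc Z g g' h := by
    rw [← cancel_epi (e.hom.app _)]
    refine hS.hom_ext J D c hc Z _ _ fun j => ?_
    rw [e.hom.naturality_assoc, e.hom.naturality_assoc, h]

theorem multicocontinuous_eval : Multicocontinuous (P := Unit) (Pi.eval (fun _ => V) ()) where
  exists_desc _ _ _ _ hc Z h hh :=
    ⟨(hc ()).desc
      { pt := Z
        ι :=
          { app := fun j => h fun _ => j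
            naturality := fun j j' f =>
              (hh (fun _ => j) (fun _ => j') fun _ => f).trans (Category.comp_id _).symm } },
      fun j => (hc ()).fac _ (j ())⟩
  hom_ext _ _ _ _ hc _ _ _ h := (hc ()).hom_ext fun j => h fun _ => j

theorem multicocontinuous_const (P : Type) [IsEmpty P] (A : V) :
    Multicocontinuous (P := P) ((Functor.const _).obj A) where
  exists_desc _ _ _ _ _ _ h _ :=
    ⟨h isEmptyElim, fun j => by
      obtain rfl : j = isEmptyElim := Subsingleton.elim _ _
      exact Category.id_comp _⟩
  hom_ext _ _ _ _ _ _ _ _ h :=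
    (Category.id_comp _).symm.trans ((h isEmptyElim).trans (Category.id_comp _))

variable [MonoidalCategory V]

/-- The functor `X ↦ A ⊗ S(X)`. -/
def constTensor {P : Type} (A : V) (S : (P → V) ⥤ V) : (P → V) ⥤ V :=
  S ⋙ tensorLeft A

/-- The functor `X ↦ X₀ ⊗ S(X₁, X₂, …)`. -/
def consTensor {k : ℕ} (S : (Fin k → V) ⥤ V) : (Fin (k + 1) → V) ⥤ V where
  obj X := X 0 ⊗ S.obj fun i => X i.succ
  map {X Y} f := f 0 ⊗ₘ S.map (X := fun i => X i.succ) (Y := fun i => Y i.succ) fun i => f i.succ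
  map_id X := by
    refine Eq.trans ?_ (id_tensorHom_id _ _)
    exact congrArg (_ ⊗ₘ ·) (S.map_id _)
  map_comp {X Y Z} f g := by
    refine Eq.trans ?_ (tensorHom_comp_tensorHom _ _ _ _).symm
    exact congrArg (_ ⊗ₘ ·) (S.map_comp (X := fun i => X i.succ) (Y := fun i => Y i.succ)
      (Z := fun i => Z i.succ) (fun i => f i.succ) fun i => g i.succ)

/-- The functor `X ↦ X₀ ⊗ (X₁ ⊗ ⋯)`. -/
def bigTensFunctor (k : ℕ) : (Fin k → V) ⥤ V where
  obj X := bigTens X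
  map f := bigTensHom f
  map_id X := bigTensHom_id X
  map_comp f g := bigTensHom_comp f g

theorem recast_natural {ι : Type} {X Y : ι → V} (g : ∀ i, X i ⟶ Y i) {L L' : List ι}
    (h : L = L') : tensHom g L ≫ recast Y h = recast X h ≫ tensHom g L' := by
  subst h
  exact (Category.comp_id _).trans (Category.id_comp _).symm

theorem recast_isIso {ι : Type} (X : ι → V) {L L' : List ι} (h : L = L') : IsIso (recast X h) := by
  unfold recast; infer_instance

theorem unmap_isIso {ι κ : Type} (f : ι → κ) (X : κ → V) (L : List ι) : IsIso (unmap f X L) :=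
  ⟨remap f X L, (remap_unmap_self f X L).2, (remap_unmap_self f X L).1⟩

/-- Splitting off the first factor of an ordered tensor product. -/
noncomputable def bigTensSuccIso (k : ℕ) :
    bigTensFunctor (V := V) (k + 1) ≅ consTensor (bigTensFunctor k) :=
  NatIso.ofComponents
    (fun X =>
      @asIso _ _ _ _ (recast X List.finRange_succ) (recast_isIso X _) ≪≫
        whiskerLeftIso (X 0)
          (@asIso _ _ _ _ (unmap Fin.succ X (List.finRange k)) (unmap_isIso _ X _)))
    (fun {X Y} g => by
      have h1 := recast_natural g (List.finRange_succ (n := k))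
      have h2 := whiskerLeft_cons (a := g 0) (unmap_natural Fin.succ g (List.finRange k))
      refine (Category.assoc _ _ _).symm.trans ((congrArg (· ≫ _) h1).trans ?_)
      refine (Category.assoc _ _ _).trans ((congrArg (_ ≫ ·) h2).trans ?_)
      exact (Category.assoc _ _ _).symm)

variable [MonoidalClosed V]

theorem Multicocontinuous.constTensor {P : Type} {S : (P → V) ⥤ V} (hS : Multicocontinuous S)
    (A : V) : Multicocontinuous (constTensor A S) where
  exists_desc J _ D c hc Z h hh := by
    obtain ⟨g, hg⟩ := hS.exists_desc J D c hc ((ihom A).obj Z)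
      (fun j => MonoidalClosed.curry (h j)) (fun j j' f => by
        exact (MonoidalClosed.curry_natural_left _ _).symm.trans
          (congrArg MonoidalClosed.curry (hh j j' f)))
    refine ⟨MonoidalClosed.uncurry g, fun j => ?_⟩
    refine (MonoidalClosed.uncurry_natural_left _ _).symm.trans ?_
    exact (congrArg MonoidalClosed.uncurry (hg j)).trans (MonoidalClosed.uncurry_curry (h j))
  hom_ext J _ D c hc Z g g' h := by
    apply MonoidalClosed.curry_injective
    refine hS.hom_ext J D c hc _ _ _ fun j => ?_
    exact (MonoidalClosed.curry_natural_left _ _).symm.trans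
      ((congrArg MonoidalClosed.curry (h j)).trans (MonoidalClosed.curry_natural_left _ _))

variable [SymmetricCategory V]

theorem tensorRight_isLeftAdjoint (A : V) : (tensorRight A).IsLeftAdjoint :=
  Functor.isLeftAdjoint_of_iso (BraidedCategory.tensorLeftIsoTensorRight A)

/-- If `S` is multicocontinuous, then so is `X₀ ⊗ S(X₁, X₂, …)`: tensoring on either side preserves
colimits, so a compatible family descends first along the variable `X₀`, for fixed values of the
other variables, and the resulting morphisms, curried, descend along the other variables. -/
theorem Multicocontinuous.consTensor {k : ℕ} {S : (Fin k → V) ⥤ V} (hS : Multicocontinuous S) :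
    Multicocontinuous (consTensor S) where
  exists_desc J _ D c hc Z h hh := by
    have key : ∀ (j : ∀ p : Fin k, J p.succ),
        ∃ g : (c 0).pt ⊗ S.obj (fun p => (D p.succ).obj (j p)) ⟶ Z,
          ∀ j₀, (c 0).ι.app j₀ ▷ _ ≫ g = h (Fin.cons j₀ j) := fun j => by
      have := tensorRight_isLeftAdjoint (S.obj fun p => (D p.succ).obj (j p))
      let hF := isColimitOfPreserves (tensorRight (S.obj fun p => (D p.succ).obj (j p))) (hc 0)
      refine ⟨hF.desc ⟨Z, { app := fun j₀ => h (Fin.cons j₀ j), naturality := fun a b f => ?_ }⟩,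
        fun j₀ => hF.fac _ j₀⟩
      have := hh (Fin.cons a j) (Fin.cons b j) (Fin.cons f fun _ => 𝟙 _)
      refine Eq.trans ?_ (this.trans (Category.comp_id _).symm)
      refine congrArg (· ≫ _) ?_
      have e : S.map (X := fun p => (D p.succ).obj (j p)) (Y := fun p => (D p.succ).obj (j p))
          (fun p => (D p.succ).map (𝟙 (j p))) = 𝟙 _ := by
        rw [← S.map_id]; congr 1; funext p; exact (D p.succ).map_id _
      refine ((congrArg ((D 0).map f ⊗ₘ ·) e).trans (tensorHom_id _ _)).symm
    choose g hg using key
    obtain ⟨t, ht⟩ := hS.exists_desc (fun p => J p.succ) (fun p => D p.succ) (fun p => c p.succ)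
      (fun p => hc p.succ) ((ihom (c 0).pt).obj Z) (fun j => MonoidalClosed.curry (g j))
      (fun j j' f => by
        rw [← MonoidalClosed.curry_natural_left]
        congr 1
        have := tensorRight_isLeftAdjoint (S.obj fun p => (D p.succ).obj (j p))
        refine (isColimitOfPreserves (tensorRight (S.obj fun p => (D p.succ).obj (j p)))
          (hc 0)).hom_ext fun j₀ => ?_
        refine Eq.trans ?_ (hg j j₀).symm
        refine (whisker_exchange_assoc _ _ _).symm.trans ?_
        rw [hg]
        refine Eq.trans ?_ (hh (Fin.cons j₀ j) (Fin.cons j₀ j') (Fin.cons (𝟙 _) f))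
        refine congrArg (· ≫ _) ?_
        exact ((congrArg (· ⊗ₘ _) ((D 0).map_id j₀)).trans (id_tensorHom _ _)).symm)
    have H : ∀ (j₀ : J 0) (j : ∀ p : Fin k, J p.succ),
        (HigherOperad.consTensor S).map
          (X := fun p => (D p).obj ((Fin.cons j₀ j : ∀ p, J p) p)) (Y := fun p => (c p).pt)
          (fun p => (c p).ι.app ((Fin.cons j₀ j : ∀ p, J p) p)) ≫ MonoidalClosed.uncurry t =
            h (Fin.cons j₀ j) := fun j₀ j => by
      refine Eq.trans ?_ (hg j j₀)
      refine (congrArg (· ≫ _) (MonoidalCategory.tensorHom_def _ _)).trans ?_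
      refine (Category.assoc _ _ _).trans (congrArg (_ ≫ ·) ?_)
      refine (MonoidalClosed.uncurry_natural_left _ _).symm.trans ?_
      exact (congrArg MonoidalClosed.uncurry (ht j)).trans (MonoidalClosed.uncurry_curry (g j))
    refine ⟨MonoidalClosed.uncurry t, fun j => ?_⟩
    have h' := H (j 0) fun p => j p.succ
    rwa [show (Fin.cons (j 0) fun p => j p.succ : ∀ p, J p) = j from Fin.cons_self_tail j] at h'
  hom_ext J _ D c hc Z g g' h := by
    apply MonoidalClosed.curry_injective
    refine hS.hom_ext (fun p => J p.succ) (fun p => D p.succ) (fun p => c p.succ)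
      (fun p => hc p.succ) _ _ _ fun j => ?_
    refine (MonoidalClosed.curry_natural_left _ _).symm.trans
      (Eq.trans ?_ (MonoidalClosed.curry_natural_left _ _))
    congr 1
    have := tensorRight_isLeftAdjoint (S.obj fun p => (D p.succ).obj (j p))
    refine (isColimitOfPreserves (tensorRight (S.obj fun p => (D p.succ).obj (j p)))
      (hc 0)).hom_ext fun j₀ => ?_
    have h1 := h (Fin.cons j₀ j)
    refine Eq.trans ?_ (h1.trans ?_)
    · refine (Category.assoc _ _ _).symm.trans (congrArg (· ≫ g) ?_)
      exact (MonoidalCategory.tensorHom_def _ _).symm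
    · refine Eq.trans (congrArg (· ≫ g') ?_) (Category.assoc _ _ _)
      exact MonoidalCategory.tensorHom_def _ _

theorem multicocontinuous_bigTens : ∀ k : ℕ, Multicocontinuous (bigTensFunctor (V := V) k)
  | 0 => (multicocontinuous_const (Fin 0) (𝟙_ V)).of_iso
      (NatIso.ofComponents (fun _ => Iso.refl _) fun _ => rfl)
  | k + 1 => (multicocontinuous_bigTens k).consTensor.of_iso (bigTensSuccIso k).symm

end Multicocontinuous

/-! ### Free structures -/

/-- A many-sorted signature in `V` with generators: an operation `o` has a source which is a
multicocontinuous functor of its arguments, whose sorts are `inp o`, and a target of sort `out o`.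
A generator `g` is a family of elements of sort `genSort g` parametrised by the object `gen g`. -/
structure Signature (V : Type u) [Category.{v} V] where
  Sort' : Type
  Op : Type
  Pos : Op → Type
  inp : ∀ o, Pos o → Sort'
  out : Op → Sort'
  src : ∀ o, (Pos o → V) ⥤ V
  multicocontinuous : ∀ o, Multicocontinuous (src o)
  Gen : Type
  genSort : Gen → Sort'
  gen : Gen → V

namespace Signature

variable {V : Type u} [Category.{v} V] (Θ : Signature V)

/-- An interpretation of the operations and generators of a signature, subject to no equations. -/
structure Model where
  obj : Θ.Sort' → V
  op : ∀ o, (Θ.src o).obj (fun p => obj (Θ.inp o p)) ⟶ obj (Θ.out o)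
  gen : ∀ g, Θ.gen g ⟶ obj (Θ.genSort g)

/-- A family of morphisms between models which preserves operations and generators. -/
structure Model.IsHom {Θ : Signature V} (M N : Θ.Model) (f : ∀ c, M.obj c ⟶ N.obj c) : Prop where
  op : ∀ o, M.op o ≫ f _ = (Θ.src o).map (X := fun p => M.obj (Θ.inp o p))
    (Y := fun p => N.obj (Θ.inp o p)) (fun p => f (Θ.inp o p)) ≫ N.op o
  gen : ∀ g, M.gen g ≫ f _ = N.gen g

/-- Formal composites of operations, with generators at the leaves. -/
inductive Term : Θ.Sort' → Type
  | gen (g : Θ.Gen) : Term (Θ.genSort g)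
  | node (o : Θ.Op) (ts : ∀ p, Term (Θ.inp o p)) : Term (Θ.out o)

variable {Θ}

/-- The object of `V` from which a term is evaluated. -/
def Term.dom : ∀ {c}, Θ.Term c → V
  | _, .gen g => Θ.gen g
  | _, .node o ts => (Θ.src o).obj fun p => (ts p).dom

/-- Evaluation of a term in a model. -/
def Model.ev (M : Θ.Model) : ∀ {c} (t : Θ.Term c), t.dom ⟶ M.obj c
  | _, .gen g => M.gen g
  | _, .node o ts => (Θ.src o).map (X := fun p => (ts p).dom) (Y := fun p => M.obj (Θ.inp o p))
      (fun p => M.ev (ts p)) ≫ M.op o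

/-- Morphisms of models preserve the values of terms. -/
theorem Model.IsHom.ev_comp {M N : Θ.Model} {f : ∀ c, M.obj c ⟶ N.obj c} (hf : M.IsHom N f) {c}
    (t : Θ.Term c) : M.ev t ≫ f c = N.ev t := by
  induction t with
  | gen g => exact hf.gen g
  | node o ts ih =>
    refine (Category.assoc _ _ _).trans ((congrArg (_ ≫ ·) (hf.op o)).trans ?_)
    refine (Category.assoc _ _ _).symm.trans (congrArg (· ≫ _) ?_)
    refine ((Θ.src o).map_comp (X := fun p => (ts p).dom) (Y := fun p => M.obj (Θ.inp o p))
      (Z := fun p => N.obj (Θ.inp o p)) _ _).symm.trans ?_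
    congr 1
    funext p
    exact ih p

variable {I : Type w} (M : I → Θ.Model)

/-- The terms of sort `c`, as the objects of a category which depends on a family of models. -/
def TermCat (_ : I → Θ.Model) (c : Θ.Sort') : Type := Θ.Term c

/-- A morphism of terms `t ⟶ s` is a morphism of `V` along which the value of `s` restricts to the
value of `t` in all the given models. So the equations between operations which hold in all the
models become morphisms of terms. -/
instance (c : Θ.Sort') : Category.{v} (TermCat M c) where
  Hom t s := { φ : Term.dom t ⟶ Term.dom s // ∀ i, φ ≫ (M i).ev s = (M i).ev t }
  id t := ⟨𝟙 _, fun _ => Category.id_comp _⟩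
  comp φ ψ := ⟨φ.1 ≫ ψ.1, fun i => by rw [Category.assoc, ψ.2, φ.2]⟩

/-- The diagram whose colimit is the free structure. -/
def diagram (c : Θ.Sort') : TermCat M c ⥤ V where
  obj t := Term.dom t
  map φ := φ.1

variable [HasColimits V]

theorem hasColimit_diagram (c : Θ.Sort') : HasColimit (diagram M c) :=
  have : HasColimitsOfSize.{v, 0} V := hasColimitsOfSizeShrink.{v, 0, v, v} V
  inferInstance

/-- The colimit cocone of the diagram of terms of sort `c`. -/
noncomputable def freeCocone (c : Θ.Sort') : Cocone (diagram M c) :=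
  have := hasColimit_diagram M c
  colimit.cocone _

/-- `freeCocone` is a colimit. -/
noncomputable def freeCoconeIsColimit (c : Θ.Sort') : IsColimit (freeCocone M c) :=
  have := hasColimit_diagram M c
  colimit.isColimit _

/-- The operations descend to the colimits: a tuple of morphisms of terms induces a morphism between
the composites, because the value of a composite only depends on the values of its arguments. -/
theorem exists_freeOp (o : Θ.Op) :
    ∃ g : (Θ.src o).obj (fun p => (freeCocone M (Θ.inp o p)).pt) ⟶ (freeCocone M (Θ.out o)).pt,
      ∀ ts : ∀ p, Θ.Term (Θ.inp o p),
        (Θ.src o).map (X := fun p => (ts p).dom) (Y := fun p => (freeCocone M (Θ.inp o p)).pt)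
          (fun p => (freeCocone M (Θ.inp o p)).ι.app (ts p)) ≫ g =
            (freeCocone M (Θ.out o)).ι.app (Term.node o ts) := by
  refine (Θ.multicocontinuous o).exists_desc (fun p => TermCat M (Θ.inp o p))
    (fun p => diagram M _) (fun p => freeCocone M _) (fun p => freeCoconeIsColimit M _) _
    (fun ts => (freeCocone M (Θ.out o)).ι.app (Term.node o ts)) fun ts ts' f => ?_
  refine (freeCocone M (Θ.out o)).w (j := Term.node o ts') (j' := Term.node o ts)
    ⟨(Θ.src o).map (X := fun p => (ts p).dom) (Y := fun p => (ts' p).dom) fun p => (f p).1,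
      fun i => ?_⟩
  refine (Category.assoc _ _ _).symm.trans (congrArg (· ≫ _) ?_)
  refine ((Θ.src o).map_comp (X := fun p => (ts p).dom) (Y := fun p => (ts' p).dom)
    (Z := fun p => (M i).obj (Θ.inp o p)) _ _).symm.trans ?_
  congr 1
  funext p
  exact (f p).2 i

/-- The free structure on the generators, subject to the equations which hold in all the given
models. -/
noncomputable def free : Θ.Model where
  obj c := (freeCocone M c).pt
  op o := (exists_freeOp M o).choose
  gen g := (freeCocone M (Θ.genSort g)).ι.app (Term.gen g)

/-- In the free structure, the value of a term is its inclusion in the colimit. -/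
theorem free_ev {c} (t : Θ.Term c) : (free M).ev t = (freeCocone M c).ι.app t := by
  induction t with
  | gen g => rfl
  | node o ts ih =>
    refine Eq.trans ?_ ((exists_freeOp M o).choose_spec ts)
    refine congrArg (· ≫ _) ?_
    change (Θ.src o).map (X := fun p => (ts p).dom) (Y := fun p => (free M).obj (Θ.inp o p))
      (fun p => (free M).ev (ts p)) = _
    congr 1
    funext p
    exact ih p

/-- An equation between terms which holds in all the given models holds in the free structure. -/
theorem free_equation {c} {t s : Θ.Term c} (φ : t.dom ⟶ s.dom)
    (h : ∀ i, φ ≫ (M i).ev s = (M i).ev t) : φ ≫ (free M).ev s = (free M).ev t := by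
  rw [free_ev, free_ev]
  exact (freeCocone M c).w (j := s) (j' := t) ⟨φ, h⟩

/-- The values of the terms jointly cover the source of an operation on the free structure. -/
theorem src_free_hom_ext {P : Type} {S : (P → V) ⥤ V} (hS : Multicocontinuous S)
    (c : P → Θ.Sort') {Z : V} {g g' : S.obj (fun p => (free M).obj (c p)) ⟶ Z}
    (h : ∀ ts : ∀ p, Θ.Term (c p), S.map (X := fun p => (ts p).dom)
      (Y := fun p => (free M).obj (c p)) (fun p => (free M).ev (ts p)) ≫ g =
        S.map (X := fun p => (ts p).dom) (Y := fun p => (free M).obj (c p))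
          (fun p => (free M).ev (ts p)) ≫ g') : g = g' := by
  refine hS.hom_ext (fun p => TermCat M (c p)) (fun p => diagram M _) (fun p => freeCocone M _)
    (fun p => freeCoconeIsColimit M _) Z g g' fun ts => ?_
  have e : (fun p => (freeCocone M (c p)).ι.app (ts p)) = fun p => (free M).ev (ts p) :=
    funext fun p => (free_ev M (ts p)).symm
  exact e ▸ h ts

theorem free_hom_ext {c : Θ.Sort'} {Z : V} {g g' : (free M).obj c ⟶ Z}
    (h : ∀ t : Θ.Term c, (free M).ev t ≫ g = (free M).ev t ≫ g') : g = g' :=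
  (freeCoconeIsColimit M c).hom_ext fun t => by
    have := h t
    rw [free_ev M (c := c) t] at this
    exact this

/-- The free structure maps to all the given models. -/
theorem exists_free_isHom (i : I) : ∃ f : ∀ c, (free M).obj c ⟶ (M i).obj c,
    (free M).IsHom (M i) f := by
  let f : ∀ c, (free M).obj c ⟶ (M i).obj c := fun c =>
    (freeCoconeIsColimit M c).desc
      { pt := (M i).obj c
        ι :=
          { app := fun t => (M i).ev t
            naturality := fun _ _ φ => Eq.trans (φ.2 i) (Category.comp_id _).symm } }
  have hf : ∀ {c} (t : Θ.Term c), (free M).ev t ≫ f c = (M i).ev t := fun t => by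
    rw [free_ev]
    exact (freeCoconeIsColimit M _).fac _ _
  refine ⟨f, fun o => ?_, fun g => hf (.gen g)⟩
  refine src_free_hom_ext M (Θ.multicocontinuous o) (Θ.inp o) fun ts => ?_
  refine (Category.assoc _ _ _).symm.trans ((hf (.node o ts)).trans ?_)
  refine Eq.trans (congrArg (· ≫ _) ?_) (Category.assoc _ _ _)
  refine Eq.trans ?_ ((Θ.src o).map_comp (X := fun p => (ts p).dom)
    (Y := fun p => (free M).obj (Θ.inp o p)) (Z := fun p => (M i).obj (Θ.inp o p)) _ _)
  congr 1
  funext p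
  exact (hf (ts p)).symm

/-- A morphism out of the free structure is determined by the generators. -/
theorem free_isHom_unique {N : Θ.Model} {f g : ∀ c, (free M).obj c ⟶ N.obj c}
    (hf : (free M).IsHom N f) (hg : (free M).IsHom N g) : f = g := by
  funext c
  exact free_hom_ext M fun t => by rw [hf.ev_comp, hg.ev_comp]

end Signature

/-! ### Coherence for iterated tensor products -/

section Coherence

variable {V : Type u} [Category.{v} V] [MonoidalCategory V]

/-- The associativity isomorphism which concatenates two iterated tensor products. -/
def join {ι : Type} (X : ι → V) (L' : List ι) : ∀ L : List ι,
    tens X L ⊗ tens X L' ⟶ tens X (L ++ L')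
  | [] => (λ_ _).hom
  | i :: L => (α_ _ _ _).hom ≫ X i ◁ join X L' L

theorem join_isIso {ι : Type} (X : ι → V) (L' : List ι) : ∀ L : List ι, IsIso (join X L' L)
  | [] => inferInstanceAs (IsIso (λ_ _).hom)
  | i :: L =>
    have := join_isIso X L' L
    inferInstanceAs (IsIso ((α_ (X i) (tens X L) (tens X L')).hom ≫ X i ◁ join X L' L))

/-- Formal iterated tensor products of variables. -/
inductive Word (ι : Type) : Type 1
  | var (i : ι) : Word ι
  | one : Word ι
  | tensor (w w' : Word ι) : Word ι
  | tensors {κ : Type} (w : κ → Word ι) (L : List κ) : Word ι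

namespace Word

variable {ι : Type}

/-- The object of `V` denoted by a word. -/
def obj (X : ι → V) : Word ι → V
  | var i => X i
  | one => 𝟙_ V
  | tensor w w' => obj X w ⊗ obj X w'
  | tensors w L => tens (fun i => obj X (w i)) L

/-- The variables which occur in a word, in order. -/
def leaves : Word ι → List ι
  | var i => [i]
  | one => []
  | tensor w w' => leaves w ++ leaves w'
  | tensors w L => L.flatMap fun i => leaves (w i)

/-- The concatenation of a list of families. -/
def concat {κ : Type} (X : ι → V) {A : κ → V} {l : κ → List ι} (f : ∀ i, A i ⟶ tens X (l i)) :
    ∀ L : List κ, tens A L ⟶ tens X (L.flatMap l)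
  | [] => 𝟙 _
  | i :: L => (f i ⊗ₘ concat X f L) ≫ join X _ _

/-- Removal of all the brackets and units of a word. -/
def flat (X : ι → V) : ∀ w : Word ι, w.obj X ⟶ tens X w.leaves
  | var i => (ρ_ (X i)).inv
  | one => 𝟙 _
  | tensor w w' => (flat X w ⊗ₘ flat X w') ≫ join X _ _
  | tensors w L => concat X (fun i => flat X (w i)) L

theorem concat_isIso {κ : Type} (X : ι → V) {A : κ → V} {l : κ → List ι}
    (f : ∀ i, A i ⟶ tens X (l i)) (h : ∀ i, IsIso (f i)) : ∀ L : List κ, IsIso (concat X f L)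
  | [] => inferInstanceAs (IsIso (𝟙 (𝟙_ V)))
  | i :: L =>
    have := concat_isIso X f h L
    have := join_isIso X (L.flatMap l) (l i)
    have := h i
    inferInstanceAs (IsIso ((f i ⊗ₘ concat X f L) ≫ join X _ _))

theorem flat_isIso (X : ι → V) : ∀ w : Word ι, IsIso (w.flat X)
  | var i => inferInstanceAs (IsIso (ρ_ (X i)).inv)
  | one => inferInstanceAs (IsIso (𝟙 (𝟙_ V)))
  | tensor w w' =>
    have := flat_isIso X w
    have := flat_isIso X w'
    have := join_isIso X w'.leaves w.leaves
    inferInstanceAs (IsIso ((flat X w ⊗ₘ flat X w') ≫ join X _ _))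
  | tensors w L => concat_isIso X _ (fun i => flat_isIso X (w i)) L

end Word

theorem inv_aux {A L M N : V} {p : L ⟶ M} {p' : M ⟶ L} {r : A ⊗ M ⟶ N} {q : N ⟶ A ⊗ M}
    (hp : p ≫ p' = 𝟙 _) (hp' : p' ≫ p = 𝟙 _) (hr : r ≫ q = 𝟙 _) (hr' : q ≫ r = 𝟙 _) :
    (A ◁ p ≫ r) ≫ q ≫ A ◁ p' ≫ 𝟙 _ = 𝟙 _ ∧ (q ≫ A ◁ p' ≫ 𝟙 _) ≫ A ◁ p ≫ r = 𝟙 _ := by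
  constructor
  · rw [Category.assoc, reassoc_of% hr, Category.comp_id, ← MonoidalCategory.whiskerLeft_comp, hp,
      MonoidalCategory.whiskerLeft_id]
  · rw [Category.comp_id, Category.assoc, ← MonoidalCategory.whiskerLeft_comp_assoc, hp',
      MonoidalCategory.whiskerLeft_id, Category.id_comp, hr']

theorem reordering_append_aux {A L L' M N N' P Q R : V} {p : L ⟶ M} {r : A ⊗ M ⟶ L'} {q : N ⟶ N'}
    {j : L' ⊗ N' ⟶ R} {j₀ : L ⊗ N ⟶ P} {j₁ : M ⊗ N' ⟶ Q} {r' : A ⊗ Q ⟶ R} {t : P ⟶ Q}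
    (h : (p ⊗ₘ q) ≫ j₁ = j₀ ≫ t) (h' : r ▷ N' ≫ j = (α_ _ _ _).hom ≫ A ◁ j₁ ≫ r') :
    ((A ◁ p ≫ r) ⊗ₘ q) ≫ j = ((α_ _ _ _).hom ≫ A ◁ j₀) ≫ A ◁ t ≫ r' := by
  have e : ((A ◁ p ≫ r) ⊗ₘ q) = ((A ◁ p) ⊗ₘ q) ≫ r ▷ N' := by
    rw [← tensorHom_id, tensorHom_comp_tensorHom, Category.comp_id]
  rw [e, Category.assoc, h', ← id_tensorHom, associator_naturality_assoc, id_tensorHom,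
    Category.assoc, ← MonoidalCategory.whiskerLeft_comp_assoc, h,
    MonoidalCategory.whiskerLeft_comp_assoc]

theorem join_assoc_aux {A L M N P Q Q' R : V} {j : L ⊗ M ⟶ P} {j₁ : P ⊗ N ⟶ Q} {j₂ : M ⊗ N ⟶ R}
    {j₃ : L ⊗ R ⟶ Q'} {p : Q ⟶ Q'} (h : j ▷ N ≫ j₁ ≫ p = (α_ _ _ _).hom ≫ L ◁ j₂ ≫ j₃) :
    ((α_ _ _ _).hom ≫ A ◁ j) ▷ N ≫ ((α_ _ _ _).hom ≫ A ◁ j₁) ≫ A ◁ p ≫ 𝟙 _ =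
      (α_ _ _ _).hom ≫ (A ⊗ L) ◁ j₂ ≫ (α_ _ _ _).hom ≫ A ◁ j₃ := by
  have h' := congrArg (fun t => A ◁ t) h
  simp only [MonoidalCategory.whiskerLeft_comp] at h'
  simp only [comp_whiskerRight, Category.assoc, Category.comp_id]
  rw [associator_naturality_middle_assoc, h', associator_naturality_right_assoc, pentagon_assoc]

theorem join_nil_aux {A L P : V} {j : L ⊗ 𝟙_ V ⟶ P} {p : P ⟶ L} (h : j ≫ p = (ρ_ _).hom) :
    ((α_ _ _ _).hom ≫ A ◁ j) ≫ A ◁ p ≫ 𝟙 _ = (ρ_ (A ⊗ L)).hom := by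
  rw [Category.comp_id, Category.assoc, ← MonoidalCategory.whiskerLeft_comp, h]
  simp

variable [SymmetricCategory V]

theorem rem_inv_aux {A B L M : V} {r : A ⊗ M ⟶ L} {q : L ⟶ A ⊗ M} (h : r ≫ q = 𝟙 _)
    (h' : q ≫ r = 𝟙 _) :
    (swap A B M ≫ B ◁ r) ≫ B ◁ q ≫ swap B A M ≫ A ◁ 𝟙 (B ⊗ M) = 𝟙 _ ∧
      (B ◁ q ≫ swap B A M ≫ A ◁ 𝟙 (B ⊗ M)) ≫ swap A B M ≫ B ◁ r = 𝟙 _ := by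
  simp only [MonoidalCategory.whiskerLeft_id, Category.comp_id, Category.assoc]
  rw [swap_swap_assoc, ← MonoidalCategory.whiskerLeft_comp, h',
    ← MonoidalCategory.whiskerLeft_comp_assoc, h]
  simp [swap_swap]

theorem Rem.exists_inv {ι : Type} (X : ι → V) {i : ι} {L M : List ι} (r : Rem i L M) :
    ∃ q : Reordering L (i :: M), r.hom X ≫ q.hom X = 𝟙 _ ∧ q.hom X ≫ r.hom X = 𝟙 _ := by
  induction r with
  | head L =>
    refine ⟨.refl _, ?_⟩
    rw [Reordering.hom_refl]
    exact ⟨Category.comp_id _, Category.comp_id _⟩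
  | tail j r ih =>
    obtain ⟨q, h, h'⟩ := ih
    exact ⟨.cons (.tail _ (.head _)) q, rem_inv_aux h h'⟩

theorem Reordering.exists_inv {ι : Type} (X : ι → V) {L L' : List ι} (p : Reordering L L') :
    ∃ q : Reordering L' L, p.hom X ≫ q.hom X = 𝟙 _ ∧ q.hom X ≫ p.hom X = 𝟙 _ := by
  induction p with
  | nil => exact ⟨.nil, Category.comp_id _, Category.comp_id _⟩
  | cons r p ih =>
    obtain ⟨p', hp, hp'⟩ := ih
    obtain ⟨q, hr, hr'⟩ := r.exists_inv X
    obtain ⟨t, ht⟩ := q.exists_trans X (.cons (.head _) p')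
    refine ⟨t, ?_⟩
    rw [ht]
    exact inv_aux hp hp' hr hr'

theorem rem_append_aux {A B C D E F G : V} {r : A ⊗ C ⟶ D} {f : D ⊗ E ⟶ F} {g : C ⊗ E ⟶ G}
    {r' : A ⊗ G ⟶ F} (h : r ▷ E ≫ f = (α_ _ _ _).hom ≫ A ◁ g ≫ r') :
    (swap A B C ≫ B ◁ r) ▷ E ≫ (α_ _ _ _).hom ≫ B ◁ f =
      (α_ _ _ _).hom ≫ A ◁ ((α_ _ _ _).hom ≫ B ◁ g) ≫ swap A B G ≫ B ◁ r' := by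
  have h' := congrArg (fun t => B ◁ t) h
  simp only [MonoidalCategory.whiskerLeft_comp] at h'
  have e : swap A B C ▷ E ≫ (α_ _ _ _).hom ≫ B ◁ (α_ A C E).hom =
      (α_ _ _ _).hom ≫ A ◁ (α_ _ _ _).hom ≫ swap A B (C ⊗ E) := by
    simp only [swap]; monoidal
  have e' := swap_natural_right A B g
  simp only [comp_whiskerRight, Category.assoc, MonoidalCategory.whiskerLeft_comp]
  rw [associator_naturality_middle_assoc, h', reassoc_of% e, reassoc_of% e']

theorem Rem.exists_append {ι : Type} (X : ι → V) {i : ι} {L M : List ι} (r : Rem i L M)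
    (N : List ι) : ∃ r' : Rem i (L ++ N) (M ++ N),
      r.hom X ▷ tens X N ≫ join X N L = (α_ _ _ _).hom ≫ X i ◁ join X N M ≫ r'.hom X := by
  induction r with
  | head L =>
    refine ⟨.head _, ?_⟩
    refine (congrArg (· ≫ _) (id_whiskerRight _ _)).trans ((Category.id_comp _).trans ?_)
    exact congrArg (_ ≫ ·) (Category.comp_id _).symm
  | tail j r ih =>
    obtain ⟨r', h⟩ := ih
    exact ⟨.tail j r', rem_append_aux h⟩

theorem Reordering.exists_append {ι : Type} (X : ι → V) {L L' : List ι} (p : Reordering L L')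
    {N N' : List ι} (q : Reordering N N') : ∃ t : Reordering (L ++ N) (L' ++ N'),
      (p.hom X ⊗ₘ q.hom X) ≫ join X N' L' = join X N L ≫ t.hom X := by
  induction p with
  | nil =>
    refine ⟨q, ?_⟩
    exact (congrArg (· ≫ _) (id_tensorHom _ _)).trans (leftUnitor_naturality _)
  | cons r p ih =>
    obtain ⟨t, h⟩ := ih
    obtain ⟨r', h'⟩ := r.exists_append X N'
    exact ⟨.cons r' t, reordering_append_aux h h'⟩

/-- Concatenation is associative, up to a reordering which does not move anything. It is stated with
a reordering because the lists `(L ++ M) ++ N` and `L ++ (M ++ N)` are not definitionally equal. -/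
theorem exists_join_assoc {ι : Type} (X : ι → V) (M N : List ι) : ∀ L : List ι,
    ∃ p : Reordering ((L ++ M) ++ N) (L ++ (M ++ N)),
      join X M L ▷ tens X N ≫ join X N (L ++ M) ≫ p.hom X =
        (α_ _ _ _).hom ≫ tens X L ◁ join X N M ≫ join X (M ++ N) L
  | [] => by
    refine ⟨.refl _, ?_⟩
    rw [Reordering.hom_refl]
    dsimp only [join, List.nil_append, tens]
    simp
  | i :: L => by
    obtain ⟨p, h⟩ := exists_join_assoc X M N L
    exact ⟨.cons (.head _) p, join_assoc_aux h⟩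

theorem exists_join_nil {ι : Type} (X : ι → V) : ∀ L : List ι,
    ∃ p : Reordering (L ++ []) L, join X [] L ≫ p.hom X = (ρ_ _).hom
  | [] => ⟨.nil, (Category.comp_id _).trans unitors_equal⟩
  | i :: L => by
    obtain ⟨p, h⟩ := exists_join_nil X L
    exact ⟨.cons (.head _) p, join_nil_aux h⟩

theorem insert_aux {A B C D P Q : V} {j : C ⊗ D ⟶ P} {r : A ⊗ P ⟶ Q} {j' : C ⊗ A ⊗ D ⟶ Q}
    (h : A ◁ j ≫ r = swap A C D ≫ j') :
    A ◁ ((α_ _ _ _).hom ≫ B ◁ j) ≫ swap A B P ≫ B ◁ r =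
      swap A (B ⊗ C) D ≫ (α_ _ _ _).hom ≫ B ◁ j' := by
  have h' := congrArg (fun t => B ◁ t) h
  simp only [MonoidalCategory.whiskerLeft_comp] at h'
  have e : swap A (B ⊗ C) D ≫ (α_ _ _ _).hom =
      A ◁ (α_ B C D).hom ≫ swap A B (C ⊗ D) ≫ B ◁ swap A C D := by
    simp only [swap, BraidedCategory.braiding_tensor_right_hom]
    monoidal
  have e' := swap_natural_right A B j
  simp only [MonoidalCategory.whiskerLeft_comp, Category.assoc]
  rw [reassoc_of% e', h', reassoc_of% e]

/-- The factor `X i` can be inserted behind a block of factors by moving past that block. -/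
theorem exists_insert {ι : Type} (X : ι → V) (i : ι) (L : List ι) : ∀ L' : List ι,
    ∃ r : Rem i (L' ++ i :: L) (L' ++ L),
      X i ◁ join X L L' ≫ r.hom X = swap (X i) (tens X L') (tens X L) ≫ join X (i :: L) L'
  | [] => by
    refine ⟨.head _, ?_⟩
    dsimp only [join, Rem.hom, List.nil_append, tens]
    simp [swap]
  | j :: L' => by
    obtain ⟨r, h⟩ := exists_insert X i L L'
    exact ⟨.tail j r, insert_aux h⟩

theorem braid_aux {A L L' P Q R : V} {j : L ⊗ L' ⟶ P} {p : P ⟶ Q} {j₁ : L' ⊗ L ⟶ Q}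
    {r : A ⊗ Q ⟶ R} {j₂ : L' ⊗ A ⊗ L ⟶ R} (h : j ≫ p = (β_ _ _).hom ≫ j₁)
    (h' : A ◁ j₁ ≫ r = swap A L' L ≫ j₂) :
    ((α_ _ _ _).hom ≫ A ◁ j) ≫ A ◁ p ≫ r = (β_ (A ⊗ L) L').hom ≫ j₂ := by
  rw [Category.assoc, ← MonoidalCategory.whiskerLeft_comp_assoc, h,
    MonoidalCategory.whiskerLeft_comp_assoc, h']
  simp [swap, BraidedCategory.braiding_tensor_left_hom]

theorem braid_nil_aux {L P : V} {j : L ⊗ 𝟙_ V ⟶ P} {p : P ⟶ L} {q : L ⟶ P}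
    (h : j ≫ p = (ρ_ _).hom) (h' : p ≫ q = 𝟙 _) : (λ_ L).hom ≫ q = (β_ _ _).hom ≫ j := by
  have e : j = (ρ_ _).hom ≫ q := by rw [← h, Category.assoc, h', Category.comp_id]
  rw [e]
  simp

/-- The braiding of two iterated tensor products permutes the factors of their concatenation. -/
theorem exists_braid {ι : Type} (X : ι → V) (L' : List ι) : ∀ L : List ι,
    ∃ p : Reordering (L ++ L') (L' ++ L), join X L' L ≫ p.hom X = (β_ _ _).hom ≫ join X L L'
  | [] => by
    obtain ⟨p, h⟩ := exists_join_nil X L'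
    obtain ⟨q, hq, -⟩ := p.exists_inv X
    exact ⟨q, braid_nil_aux h hq⟩
  | i :: L => by
    obtain ⟨p, h⟩ := exists_braid X L' L
    obtain ⟨r, h'⟩ := exists_insert X i L L'
    exact ⟨.cons r p, braid_aux h h'⟩

end Coherence

/-! ### Canonical morphisms -/

section Canonical

variable {V : Type u} [Category.{v} V] [MonoidalCategory V]

theorem flat_assoc_aux {A B C A' B' C' P Q R S : V} {a : A ⟶ A'} {b : B ⟶ B'} {c : C ⟶ C'}
    {j : A' ⊗ B' ⟶ P} {j₁ : P ⊗ C' ⟶ Q} {j₂ : B' ⊗ C' ⟶ R} {j₃ : A' ⊗ R ⟶ S} {p : Q ⟶ S}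
    (h : j ▷ C' ≫ j₁ ≫ p = (α_ _ _ _).hom ≫ A' ◁ j₂ ≫ j₃) :
    ((((a ⊗ₘ b) ≫ j) ⊗ₘ c) ≫ j₁) ≫ p = (α_ _ _ _).hom ≫ (a ⊗ₘ ((b ⊗ₘ c) ≫ j₂)) ≫ j₃ := by
  have e : (((a ⊗ₘ b) ≫ j) ⊗ₘ c) = ((a ⊗ₘ b) ⊗ₘ c) ≫ j ▷ C' := by
    rw [← tensorHom_id, tensorHom_comp_tensorHom, Category.comp_id]
  have e' : (a ⊗ₘ ((b ⊗ₘ c) ≫ j₂)) = (a ⊗ₘ b ⊗ₘ c) ≫ A' ◁ j₂ := by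
    rw [← id_tensorHom, tensorHom_comp_tensorHom, Category.comp_id]
  rw [e, e', Category.assoc, Category.assoc, h, Category.assoc, associator_naturality_assoc]

variable [SymmetricCategory V]

/-- A morphism between the values of two words is canonical if, after removal of all brackets, it is
a symmetry which permutes the variables. -/
def IsCanonical {ι : Type} (X : ι → V) (w w' : Word ι) (f : w.obj X ⟶ w'.obj X) : Prop :=
  ∃ p : Reordering w.leaves w'.leaves, w.flat X ≫ p.hom X = f ≫ w'.flat X

namespace IsCanonical

variable {ι : Type} {X : ι → V}

/-- The coherence theorem: canonical morphisms agree if no variable is repeated. -/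
theorem unique {w w' : Word ι} {f g : w.obj X ⟶ w'.obj X} (hf : IsCanonical X w w' f)
    (hg : IsCanonical X w w' g) (h : w'.leaves.Nodup) : f = g := by
  obtain ⟨p, hp⟩ := hf
  obtain ⟨q, hq⟩ := hg
  obtain rfl := p.unique h q
  have := w'.flat_isIso X
  rw [← cancel_mono (w'.flat X), ← hp, ← hq]

theorem id (w : Word ι) : IsCanonical X w w (𝟙 _) :=
  ⟨.refl _, by rw [Reordering.hom_refl, Category.comp_id, Category.id_comp]⟩

theorem comp {w w' w'' : Word ι} {f : w.obj X ⟶ w'.obj X} {g : w'.obj X ⟶ w''.obj X}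
    (hf : IsCanonical X w w' f) (hg : IsCanonical X w' w'' g) : IsCanonical X w w'' (f ≫ g) := by
  obtain ⟨p, hp⟩ := hf
  obtain ⟨q, hq⟩ := hg
  obtain ⟨t, ht⟩ := p.exists_trans X q
  refine ⟨t, ?_⟩
  rw [ht, reassoc_of% hp, hq, Category.assoc]

theorem inv {w w' : Word ι} {f : w.obj X ⟶ w'.obj X} {g : w'.obj X ⟶ w.obj X}
    (hf : IsCanonical X w w' f) (h : g ≫ f = 𝟙 _) : IsCanonical X w' w g := by
  obtain ⟨p, hp⟩ := hf
  obtain ⟨q, hq, -⟩ := p.exists_inv X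
  refine ⟨q, ?_⟩
  have e : w'.flat X = g ≫ w.flat X ≫ p.hom X := by rw [hp, reassoc_of% h]
  rw [e, Category.assoc, Category.assoc, hq, Category.comp_id]

theorem tensor {w₁ w₁' w₂ w₂' : Word ι} {f : w₁.obj X ⟶ w₁'.obj X} {g : w₂.obj X ⟶ w₂'.obj X}
    (hf : IsCanonical X w₁ w₁' f) (hg : IsCanonical X w₂ w₂' g) :
    IsCanonical X (.tensor w₁ w₂) (.tensor w₁' w₂') (f ⊗ₘ g) := by
  obtain ⟨p, hp⟩ := hf
  obtain ⟨q, hq⟩ := hg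
  obtain ⟨t, ht⟩ := p.exists_append X q
  refine ⟨t, ?_⟩
  refine (Category.assoc _ _ _).trans ((congrArg (_ ≫ ·) ht.symm).trans ?_)
  refine Eq.trans ?_ (Category.assoc _ _ _)
  refine (Category.assoc _ _ _).symm.trans (congrArg (· ≫ _) ?_)
  exact (tensorHom_comp_tensorHom _ _ _ _).trans ((congrArg₂ (· ⊗ₘ ·) hp hq).trans
    (tensorHom_comp_tensorHom _ _ _ _).symm)

theorem whiskerLeft (w : Word ι) {w₁ w₂ : Word ι} {f : w₁.obj X ⟶ w₂.obj X}
    (hf : IsCanonical X w₁ w₂ f) : IsCanonical X (.tensor w w₁) (.tensor w w₂) (w.obj X ◁ f) := by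
  rw [← id_tensorHom]
  exact (id w).tensor hf

theorem whiskerRight (w : Word ι) {w₁ w₂ : Word ι} {f : w₁.obj X ⟶ w₂.obj X}
    (hf : IsCanonical X w₁ w₂ f) : IsCanonical X (.tensor w₁ w) (.tensor w₂ w) (f ▷ w.obj X) := by
  rw [← tensorHom_id]
  exact hf.tensor (id w)

theorem associator (w₁ w₂ w₃ : Word ι) :
    IsCanonical X (.tensor (.tensor w₁ w₂) w₃) (.tensor w₁ (.tensor w₂ w₃)) (α_ _ _ _).hom := by
  obtain ⟨p, hp⟩ := exists_join_assoc X w₂.leaves w₃.leaves w₁.leaves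
  exact ⟨p, flat_assoc_aux hp⟩

theorem associator_inv (w₁ w₂ w₃ : Word ι) :
    IsCanonical X (.tensor w₁ (.tensor w₂ w₃)) (.tensor (.tensor w₁ w₂) w₃) (α_ _ _ _).inv :=
  (associator w₁ w₂ w₃).inv (Iso.inv_hom_id _)

theorem leftUnitor (w : Word ι) : IsCanonical X (.tensor .one w) w (λ_ _).hom := by
  refine ⟨.refl _, ?_⟩
  refine (congrArg (_ ≫ ·) (Reordering.hom_refl X w.leaves)).trans ((Category.comp_id _).trans ?_)
  exact (congrArg (· ≫ _) (id_tensorHom _ _)).trans (leftUnitor_naturality _)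

theorem leftUnitor_inv (w : Word ι) : IsCanonical X w (.tensor .one w) (λ_ _).inv :=
  (leftUnitor w).inv (Iso.inv_hom_id _)

theorem rightUnitor (w : Word ι) : IsCanonical X (.tensor w .one) w (ρ_ _).hom := by
  obtain ⟨p, hp⟩ := exists_join_nil X w.leaves
  refine ⟨p, ?_⟩
  refine (Category.assoc _ _ _).trans ((congrArg (_ ≫ ·) hp).trans ?_)
  exact (congrArg (· ≫ _) (tensorHom_id _ _)).trans (rightUnitor_naturality _)

theorem braiding (w w' : Word ι) : IsCanonical X (.tensor w w') (.tensor w' w) (β_ _ _).hom := by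
  obtain ⟨p, hp⟩ := exists_braid X w'.leaves w.leaves
  refine ⟨p, ?_⟩
  refine (Category.assoc _ _ _).trans ((congrArg (_ ≫ ·) hp).trans ?_)
  refine (Category.assoc _ _ _).symm.trans (Eq.trans ?_ (Category.assoc _ _ _))
  exact congrArg (· ≫ _) (BraidedCategory.braiding_naturality _ _)

theorem swap (w₁ w₂ w₃ : Word ι) : IsCanonical X (.tensor w₁ (.tensor w₂ w₃))
    (.tensor w₂ (.tensor w₁ w₃)) (HigherOperad.swap _ _ _) :=
  (associator_inv w₁ w₂ w₃).comp (((braiding w₁ w₂).whiskerRight w₃).comp (associator w₂ w₁ w₃))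

theorem tensorμ (w₁ w₂ w₃ w₄ : Word ι) : IsCanonical X (.tensor (.tensor w₁ w₂) (.tensor w₃ w₄))
    (.tensor (.tensor w₁ w₃) (.tensor w₂ w₄)) (MonoidalCategory.tensorμ _ _ _ _) :=
  (associator w₁ w₂ (.tensor w₃ w₄)).comp
    (((associator_inv w₂ w₃ w₄).whiskerLeft w₁).comp
      ((((braiding w₂ w₃).whiskerRight w₄).whiskerLeft w₁).comp
        (((associator w₃ w₂ w₄).whiskerLeft w₁).comp (associator_inv w₁ w₃ (.tensor w₂ w₄)))))

variable {κ : Type}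

theorem tensHom {w w' : κ → Word ι} {f : ∀ i, (w i).obj X ⟶ (w' i).obj X}
    (hf : ∀ i, IsCanonical X (w i) (w' i) (f i)) :
    ∀ L : List κ, IsCanonical X (.tensors w L) (.tensors w' L) (HigherOperad.tensHom f L)
  | [] => id .one
  | i :: L => (hf i).tensor (tensHom hf L)

theorem tensUnit : ∀ L : List κ,
    IsCanonical X (.tensors (fun _ => .one) L) .one (HigherOperad.tensUnit L)
  | [] => id .one
  | _ :: L => (leftUnitor (.tensors (fun _ => .one) L)).comp (tensUnit L)

theorem single (w : Fin 1 → Word ι) :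
    IsCanonical X (.tensors w (List.finRange 1)) (w 0)
      (HigherOperad.single fun i => (w i).obj X) :=
  rightUnitor (w 0)

theorem split (w : κ → Word ι) (L' : List κ) : ∀ L : List κ,
    IsCanonical X (.tensors w (L ++ L')) (.tensor (.tensors w L) (.tensors w L'))
      (HigherOperad.split (fun i => (w i).obj X) L' L)
  | [] => leftUnitor_inv (.tensors w L')
  | i :: L => ((split w L' L).whiskerLeft (w i)).comp
      (associator_inv (w i) (.tensors w L) (.tensors w L'))

theorem remap {κ' : Type} (f : κ → κ') (w : κ' → Word ι) : ∀ L : List κ,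
    IsCanonical X (.tensors (fun i => w (f i)) L) (.tensors w (L.map f))
      (HigherOperad.remap f (fun i => (w i).obj X) L)
  | [] => id .one
  | i :: L => (remap f w L).whiskerLeft (w (f i))

theorem unmap {κ' : Type} (f : κ → κ') (w : κ' → Word ι) : ∀ L : List κ,
    IsCanonical X (.tensors w (L.map f)) (.tensors (fun i => w (f i)) L)
      (HigherOperad.unmap f (fun i => (w i).obj X) L)
  | [] => id .one
  | i :: L => (unmap f w L).whiskerLeft (w (f i))

theorem zip (w w' : κ → Word ι) : ∀ L : List κ,
    IsCanonical X (.tensor (.tensors w L) (.tensors w' L))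
      (.tensors (fun i => .tensor (w i) (w' i)) L)
      (HigherOperad.zip (fun i => (w i).obj X) (fun i => (w' i).obj X) L)
  | [] => leftUnitor .one
  | i :: L => (tensorμ (w i) (.tensors w L) (w' i) (.tensors w' L)).comp
      ((zip w w' L).whiskerLeft (.tensor (w i) (w' i)))

theorem rem (w : κ → Word ι) {i : κ} {L M : List κ} (r : Rem i L M) :
    IsCanonical X (.tensor (w i) (.tensors w M)) (.tensors w L) (r.hom fun i => (w i).obj X) := by
  induction r with
  | head L => exact id (.tensor (w i) (.tensors w L))
  | @tail j L M r ih => exact (swap (w i) (w j) (.tensors w M)).comp (ih.whiskerLeft (w j))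

theorem reordering (w : κ → Word ι) {L L' : List κ} (p : Reordering L L') :
    IsCanonical X (.tensors w L) (.tensors w L') (p.hom fun i => (w i).obj X) := by
  induction p with
  | nil => exact id .one
  | @cons i L L' M r p ih => exact (ih.whiskerLeft (w i)).comp (rem w r)

theorem reorder (w : κ → Word ι) {L L' : List κ} (h : L.Perm L') :
    IsCanonical X (.tensors w L) (.tensors w L')
      (HigherOperad.reorder (fun i => (w i).obj X) h) :=
  reordering w _

theorem blocks {k : ℕ} (w : κ → Word ι) (b : Fin k → ℕ) (φ : ∀ i, Fin (b i) → κ) :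
    ∀ L : List (Fin k),
      IsCanonical X (.tensors w (L.flatMap fun i => (List.finRange (b i)).map (φ i)))
        (.tensors (fun i => .tensors (fun j => w (φ i j)) (List.finRange (b i))) L)
        (HigherOperad.blocks (fun i => (w i).obj X) b φ L)
  | [] => id .one
  | i :: L => (split w _ _).comp ((unmap (φ i) w _).tensor (blocks w b φ L))

theorem permute {k : ℕ} (ρ : Equiv.Perm (Fin k)) (w : Fin k → Word ι) :
    IsCanonical X (.tensors (fun i => w (ρ i)) (List.finRange k)) (.tensors w (List.finRange k))
      (HigherOperad.permute ρ fun i => (w i).obj X) :=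
  (remap ρ w _).comp (reorder w _)

theorem regroup {m k : ℕ} {σ : Fin m → Fin k} {b : Fin k → ℕ} {φ : ∀ i, Fin (b i) → Fin m}
    (w : Fin m → Word ι) (h : IsFibers σ b φ) :
    IsCanonical X (.tensors w (List.finRange m))
      (.tensors (fun i => .tensors (fun j => w (φ i j)) (List.finRange (b i))) (List.finRange k))
      (HigherOperad.regroup (fun i => (w i).obj X) h) :=
  (reorder w _).comp (blocks w b φ _)

theorem distribute {m k : ℕ} {σ : Fin m → Fin k} {b : Fin k → ℕ} {φ : ∀ i, Fin (b i) → Fin m}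
    (p : Word ι) (y : Fin k → Word ι) (w : Fin m → Word ι) (h : IsFibers σ b φ) :
    IsCanonical X
      (.tensor (.tensor p (.tensors y (List.finRange k))) (.tensors w (List.finRange m)))
      (.tensor p (.tensors (fun i => .tensor (y i)
        (.tensors (fun j => w (φ i j)) (List.finRange (b i)))) (List.finRange k)))
      (HigherOperad.distribute (p.obj X) (fun i => (y i).obj X) (fun i => (w i).obj X) h) :=
  (associator p (.tensors y _) (.tensors w _)).comp
    ((((regroup w h).whiskerLeft (.tensors y _)).comp (zip y _ _)).whiskerLeft p)

end IsCanonical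

end Canonical

/-! ### Coherence of permutations and of the distribution over fibers -/

section Coherence

variable {V : Type u} [Category.{v} V] [MonoidalCategory V] [SymmetricCategory V]

theorem Reordering.perm {ι : Type} {L L' : List ι} (p : Reordering L L') : L.Perm L' := by
  induction p with
  | nil => exact .nil
  | cons r _ ih => exact (ih.cons _).trans r.perm.symm

namespace IsCanonical

variable {ι : Type} {X : ι → V}

/-- Canonical morphisms may be compared along an equality of target words. With `h` proved by
`Category.comp_id`, this covers words which are equal, but not definitionally, and whose values are
definitionally equal. -/
theorem cast {w w₁ w₂ : Word ι} {f : w.obj X ⟶ w₁.obj X} {g : w.obj X ⟶ w₂.obj X}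
    (hf : IsCanonical X w w₁ f) (e : w₁ = w₂) (h : f ≫ eqToHom (congrArg (Word.obj X) e) = g) :
    IsCanonical X w w₂ g := by
  subst e h
  exact hf.comp (id w₁)

/-- The coherence theorem, with the condition on the variables imposed on the source. -/
theorem unique_of_nodup_source {w w' : Word ι} {f g : w.obj X ⟶ w'.obj X}
    (hf : IsCanonical X w w' f) (hg : IsCanonical X w w' g) (h : w.leaves.Nodup) : f = g :=
  hf.unique hg (hf.choose.perm.nodup_iff.1 h)

end IsCanonical

theorem permute_mul {m : ℕ} (π ρ : Equiv.Perm (Fin m)) (X : Fin m → V) :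
    permute (π * ρ) X = permute ρ (fun i => X (π i)) ≫ permute π X := by
  refine IsCanonical.unique (X := X) (IsCanonical.permute (π * ρ) Word.var)
    ((IsCanonical.permute ρ fun i => Word.var (π i)).comp (IsCanonical.permute π Word.var)) ?_
  simp [Word.leaves, List.nodup_finRange]

theorem permute_one {m : ℕ} (X : Fin m → V) : permute 1 X = 𝟙 _ := by
  refine IsCanonical.unique (X := X) (IsCanonical.permute 1 Word.var)
    (IsCanonical.id (Word.tensors Word.var (List.finRange m))) ?_
  simp [Word.leaves, List.nodup_finRange]

/-- Coherence for the associativity law: the factors of an iterated tensor product may be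
distributed over the fibers of a composite map in one step or in two. -/
theorem distribute_distribute {m l k : ℕ} {σ : Fin m → Fin l} {ω : Fin l → Fin k}
    {b : Fin k → ℕ} {κ : ∀ i, Fin (b i) → Fin l} (hω : IsFibers ω b κ)
    {f : Fin l → ℕ} {φ : ∀ s, Fin (f s) → Fin m} (hσ : IsFibers σ f φ)
    {d : Fin k → ℕ} {ι : ∀ i, Fin (d i) → Fin m} (hσω : IsFibers (ω ∘ σ) d ι)
    {τ : ∀ i, Fin (d i) → Fin (b i)} {ψ : ∀ i j, Fin (f (κ i j)) → Fin (d i)}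
    (hψ : ∀ i j x, ι i (ψ i j x) = φ (κ i j) x)
    (hτ : ∀ i, IsFibers (τ i) (fun j => f (κ i j)) (ψ i))
    (P : V) (Y : Fin k → V) (Z : Fin l → V) (x : V) :
    distribute (P ⊗ bigTens Y) Z (fun _ => x) hσ ≫
        distribute P Y (fun s => Z s ⊗ bigTens fun _ : Fin (f s) => x) hω =
      distribute P Y Z hω ▷ bigTens (fun _ : Fin m => x) ≫
        distribute P (fun i => Y i ⊗ bigTens fun j => Z (κ i j)) (fun _ => x) hσω ≫
          P ◁ bigTensHom fun i => distribute (Y i) (fun j => Z (κ i j)) (fun _ => x) (hτ i) := by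
  let A : Unit ⊕ Fin k ⊕ Fin l ⊕ Fin m → V :=
    Sum.elim (fun _ => P) (Sum.elim Y (Sum.elim Z fun _ => x))
  let p : Word (Unit ⊕ Fin k ⊕ Fin l ⊕ Fin m) := .var (.inl ())
  let y : Fin k → Word (Unit ⊕ Fin k ⊕ Fin l ⊕ Fin m) := fun i => .var (.inr (.inl i))
  let z : Fin l → Word (Unit ⊕ Fin k ⊕ Fin l ⊕ Fin m) := fun i => .var (.inr (.inr (.inl i)))
  let t : Fin m → Word (Unit ⊕ Fin k ⊕ Fin l ⊕ Fin m) := fun i => .var (.inr (.inr (.inr i)))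
  have hL := (IsCanonical.distribute (X := A)
      (.tensor p (.tensors y (List.finRange k))) z t hσ).comp
    (IsCanonical.distribute p y
      (fun s => .tensor (z s) (.tensors (fun j => t (φ s j)) (List.finRange (f s)))) hω)
  have hR := ((IsCanonical.distribute (X := A) p y z hω).whiskerRight
      (.tensors t (List.finRange m))).comp
    ((IsCanonical.distribute p
      (fun i => .tensor (y i) (.tensors (fun j => z (κ i j)) (List.finRange (b i)))) t hσω).comp
        ((IsCanonical.tensHom (fun i => IsCanonical.distribute (y i) (fun j => z (κ i j))
          (fun j => t (ι i j)) (hτ i)) (List.finRange k)).whiskerLeft p))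
  refine (hR.cast ?_ (Category.comp_id _)).unique_of_nodup_source hL ?_ |>.symm
  · simp only [hψ]
  · simp +contextual [Word.leaves, p, y, z, t, List.nodup_append, List.nodup_finRange,
      ← List.map_eq_flatMap, List.nodup_map_iff_inj_on]

/-- Coherence for the right unit law. -/
theorem distribute_unit_right {m : ℕ}
    (h : IsFibers (fun s : Fin m => s) (fun _ => 1) (fun s _ => s)) (P : V) (X : Fin m → V) :
    distribute P (fun _ => 𝟙_ V) X h ≫ P ◁ bigTensHom (fun i => (λ_ _).hom ≫ single fun _ => X i) =
      (P ◁ tensUnit (List.finRange m) ≫ (ρ_ _).hom) ▷ bigTens X := by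
  let A : Unit ⊕ Fin m → V := Sum.elim (fun _ => P) X
  let p : Word (Unit ⊕ Fin m) := .var (.inl ())
  let t : Fin m → Word (Unit ⊕ Fin m) := fun i => .var (.inr i)
  have hL := (IsCanonical.distribute (X := A) p (fun _ => .one) t h).comp
    ((IsCanonical.tensHom (fun i => (IsCanonical.leftUnitor _).comp
      (IsCanonical.single fun _ => t i)) (List.finRange m)).whiskerLeft p)
  have hR := (((IsCanonical.tensUnit (X := A) (List.finRange m)).whiskerLeft p).comp
    (IsCanonical.rightUnitor p)).whiskerRight (.tensors t (List.finRange m))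
  refine hL.unique_of_nodup_source hR ?_
  have e : (List.finRange m).flatMap (fun _ => ([] : List (Unit ⊕ Fin m))) = [] := by
    simp [List.flatMap_eq_nil_iff]
  simp [Word.leaves, p, t, List.nodup_finRange, ← List.map_eq_flatMap, List.nodup_map_iff_inj_on, e]

/-- Coherence for the left unit law. -/
theorem distribute_unit_left {m : ℕ}
    (h : IsFibers (fun _ : Fin m => (0 : Fin 1)) (fun _ => m) (fun _ x => x)) (Y : V)
    (X : Fin m → V) :
    distribute (𝟙_ V) (fun _ => Y) X h ≫ (λ_ _).hom ≫ single (fun _ => Y ⊗ bigTens X) =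
      ((λ_ _).hom ≫ single fun _ => Y) ▷ bigTens X := by
  let A : Unit ⊕ Fin m → V := Sum.elim (fun _ => Y) X
  let y : Word (Unit ⊕ Fin m) := .var (.inl ())
  let t : Fin m → Word (Unit ⊕ Fin m) := fun i => .var (.inr i)
  have hL := (IsCanonical.distribute (X := A) .one (fun _ => y) t h).comp
    ((IsCanonical.leftUnitor _).comp
      (IsCanonical.single fun _ => .tensor y (.tensors t (List.finRange m))))
  have hR := ((IsCanonical.leftUnitor (X := A) (.tensors (fun _ => y) (List.finRange 1))).comp
    (IsCanonical.single fun _ => y)).whiskerRight (.tensors t (List.finRange m))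
  refine hL.unique_of_nodup_source hR ?_
  simp [Word.leaves, y, t, List.nodup_finRange, ← List.map_eq_flatMap, List.nodup_map_iff_inj_on]

/-- Coherence for the equivariance under permutations of the fibers as blocks. -/
theorem distribute_permute_outer {m k : ℕ} {σ σ' : Fin m → Fin k} (π : Equiv.Perm (Fin m))
    (ρ : Equiv.Perm (Fin k)) {b : Fin k → ℕ} {κ : ∀ i, Fin (b i) → Fin m} (h : IsFibers σ b κ)
    {κ' : ∀ i, Fin (b (ρ i)) → Fin m} (h' : IsFibers σ' (fun i => b (ρ i)) κ')
    (hπ : ∀ i x, π (κ' i x) = κ (ρ i) x) (P : V) (Y : Fin k → V) (x : V) :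
    (P ⊗ bigTens fun i => Y (ρ i)) ◁ permute π (fun _ => x) ≫
        (P ◁ permute ρ Y) ▷ bigTens (fun _ => x) ≫ distribute P Y (fun _ => x) h =
      distribute P (fun i => Y (ρ i)) (fun _ => x) h' ≫
        P ◁ permute ρ fun i => Y i ⊗ bigTens fun _ : Fin (b i) => x := by
  let A : Unit ⊕ Fin k ⊕ Fin m → V := Sum.elim (fun _ => P) (Sum.elim Y fun _ => x)
  let p : Word (Unit ⊕ Fin k ⊕ Fin m) := .var (.inl ())
  let y : Fin k → Word (Unit ⊕ Fin k ⊕ Fin m) := fun i => .var (.inr (.inl i))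
  let t : Fin m → Word (Unit ⊕ Fin k ⊕ Fin m) := fun i => .var (.inr (.inr i))
  have hL := ((IsCanonical.permute (X := A) π t).whiskerLeft
      (.tensor p (.tensors (fun i => y (ρ i)) (List.finRange k)))).comp
    ((((IsCanonical.permute ρ y).whiskerLeft p).whiskerRight (.tensors t (List.finRange m))).comp
      (IsCanonical.distribute p y t h))
  have hR := (IsCanonical.distribute (X := A) p (fun i => y (ρ i)) (fun i => t (π i)) h').cast
    (w₂ := .tensor p (.tensors (fun i => .tensor (y (ρ i)) (.tensors (fun j => t (κ (ρ i) j))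
      (List.finRange (b (ρ i))))) (List.finRange k))) (by simp only [hπ]) (Category.comp_id _)
  refine hL.unique_of_nodup_source (hR.comp ((IsCanonical.permute ρ fun i => .tensor (y i)
    (.tensors (fun j => t (κ i j)) (List.finRange (b i)))).whiskerLeft p)) ?_
  simp +contextual [Word.leaves, p, y, t, List.nodup_append, List.nodup_finRange,
    ← List.map_eq_flatMap, List.nodup_map_iff_inj_on]

/-- Coherence for the equivariance under permutations inside the fibers. -/
theorem distribute_permute_inner {m k : ℕ} {σ : Fin m → Fin k} (π : Equiv.Perm (Fin m))
    {b : Fin k → ℕ} {κ : ∀ i, Fin (b i) → Fin m} (h : IsFibers σ b κ)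
    (ρ : ∀ i, Equiv.Perm (Fin (b i))) (hπ : ∀ i x, π (κ i x) = κ i (ρ i x)) (P : V)
    (Y : Fin k → V) (x : V) :
    (P ⊗ bigTens Y) ◁ permute π (fun _ => x) ≫ distribute P Y (fun _ => x) h =
      distribute P Y (fun _ => x) h ≫
        P ◁ bigTensHom fun i => Y i ◁ permute (ρ i) fun _ => x := by
  let A : Unit ⊕ Fin k ⊕ Fin m → V := Sum.elim (fun _ => P) (Sum.elim Y fun _ => x)
  let p : Word (Unit ⊕ Fin k ⊕ Fin m) := .var (.inl ())
  let y : Fin k → Word (Unit ⊕ Fin k ⊕ Fin m) := fun i => .var (.inr (.inl i))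
  let t : Fin m → Word (Unit ⊕ Fin k ⊕ Fin m) := fun i => .var (.inr (.inr i))
  have hL := ((IsCanonical.permute (X := A) π t).whiskerLeft
      (.tensor p (.tensors y (List.finRange k)))).comp (IsCanonical.distribute p y t h)
  have hR := (IsCanonical.distribute (X := A) p y (fun i => t (π i)) h).cast
    (w₂ := .tensor p (.tensors (fun i => .tensor (y i) (.tensors (fun j => t (κ i (ρ i j)))
      (List.finRange (b i)))) (List.finRange k))) (by simp only [hπ]) (Category.comp_id _)
  refine hL.unique_of_nodup_source (hR.comp ((IsCanonical.tensHom (fun i =>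
    (IsCanonical.permute (ρ i) fun j => t (κ i j)).whiskerLeft (y i)) _).whiskerLeft p)) ?_
  simp +contextual [Word.leaves, p, y, t, List.nodup_append, List.nodup_finRange,
    ← List.map_eq_flatMap, List.nodup_map_iff_inj_on]

end Coherence

/-! ### Endomorphism operads -/

section End

variable {V : Type u} [Category.{v} V] [MonoidalCategory V]

theorem whiskerLeft_bigTensHom_comp {k : ℕ} (P : V) {X Y Z : Fin k → V} (f : ∀ i, X i ⟶ Y i)
    (g : ∀ i, Y i ⟶ Z i) : P ◁ bigTensHom f ≫ P ◁ bigTensHom g =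
      P ◁ bigTensHom fun i => f i ≫ g i := by
  rw [bigTensHom_comp, MonoidalCategory.whiskerLeft_comp]

theorem hom_unit_aux {I A E X x : V} {e : I ⟶ A} {a : A ⟶ E} {ε : E ⊗ X ⟶ x} {α : A ⊗ X ⟶ x}
    {c : I ⊗ X ⟶ x} {e' : I ⟶ E} (hα : a ▷ X ≫ ε = α) (h : e ▷ X ≫ α = c)
    (h' : e' ▷ X ≫ ε = c) : (e ≫ a) ▷ X ≫ ε = e' ▷ X ≫ ε := by
  rw [comp_whiskerRight, Category.assoc, hα, h, h']

theorem hom_act_aux {A E X X' x : V} {t : A ⟶ A} {a : A ⟶ E} {t' : E ⟶ E} {ε : E ⊗ X ⟶ x}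
    {ε' : E ⊗ X' ⟶ x} {α : A ⊗ X ⟶ x} {α' : A ⊗ X' ⟶ x} {p : X' ⟶ X} (hα : a ▷ X ≫ ε = α)
    (hα' : a ▷ X' ≫ ε' = α')
    (h : (t ⊗ₘ p) ≫ α = α') (h' : E ◁ p ≫ t' ▷ X ≫ ε = ε') :
    A ◁ p ≫ (t ≫ a) ▷ X ≫ ε = A ◁ p ≫ (a ≫ t') ▷ X ≫ ε := by
  rw [tensorHom_def', Category.assoc] at h
  rw [comp_whiskerRight, comp_whiskerRight, Category.assoc, Category.assoc, hα, h,
    whisker_exchange_assoc, h', hα']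

theorem hom_mul_aux {S S' A E X x W W' : V} {μ : S ⟶ A} {a : A ⟶ E} {ε : E ⊗ X ⟶ x}
    {α : A ⊗ X ⟶ x} {g : S ⟶ S'} {ν : S' ⟶ E} {D : S ⊗ X ⟶ W} {D' : S' ⊗ X ⟶ W'} {w : W ⟶ W'}
    {c : W' ⟶ x} {c' : W ⟶ x} (hα : a ▷ X ≫ ε = α) (hμ : μ ▷ X ≫ α = D ≫ c')
    (hν : ν ▷ X ≫ ε = D' ≫ c) (hw : g ▷ X ≫ D' = D ≫ w) (hc : w ≫ c = c') :
    (μ ≫ a) ▷ X ≫ ε = (g ≫ ν) ▷ X ≫ ε := by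
  rw [comp_whiskerRight, comp_whiskerRight, Category.assoc, Category.assoc, hα, hμ, hν,
    reassoc_of% hw, hc]

theorem single_natural {X Y : Fin 1 → V} (f : ∀ i, X i ⟶ Y i) :
    bigTensHom f ≫ single Y = single X ≫ f 0 :=
  (congrArg (· ≫ _) (tensorHom_id _ _)).trans (rightUnitor_naturality _)

variable [SymmetricCategory V]

theorem distribute_natural_outer {m k : ℕ} {σ : Fin m → Fin k} {b : Fin k → ℕ}
    {κ : ∀ i, Fin (b i) → Fin m} {P P' : V} (g : P ⟶ P') (Y : Fin k → V) (X : Fin m → V)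
    (h : IsFibers σ b κ) :
    (g ▷ bigTens Y) ▷ bigTens X ≫ distribute P' Y X h = distribute P Y X h ≫ g ▷ _ := by
  have e := distribute_natural g (fun i => 𝟙 (Y i)) X h
  simpa only [bigTensHom_id, id_whiskerRight, tensorHom_id] using e

theorem distribute_natural_inner {m k : ℕ} {σ : Fin m → Fin k} {b : Fin k → ℕ}
    {κ : ∀ i, Fin (b i) → Fin m} (P : V) {Y Y' : Fin k → V} (f : ∀ i, Y i ⟶ Y' i) (X : Fin m → V)
    (h : IsFibers σ b κ) :
    (P ◁ bigTensHom f) ▷ bigTens X ≫ distribute P Y' X h =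
      distribute P Y X h ≫ P ◁ bigTensHom fun i => f i ▷ bigTens fun j => X (κ i j) := by
  have e := distribute_natural (𝟙 P) f X h
  simpa only [id_tensorHom] using e

variable [MonoidalClosed V]

theorem curry_braiding_eval {P W x : V} (f : P ⊗ W ⟶ x) :
    MonoidalClosed.curry ((β_ W P).hom ≫ f) ▷ W ≫ (β_ _ _).hom ≫ (ihom.ev W).app x = f := by
  have h := MonoidalClosed.uncurry_curry ((β_ W P).hom ≫ f)
  rw [MonoidalClosed.uncurry_eq] at h
  refine (BraidedCategory.braiding_naturality_left_assoc _ _ _).trans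
    ((congrArg (_ ≫ ·) h).trans ?_)
  simp

theorem ihom_hom_ext {P W x : V} {f g : P ⟶ (ihom W).obj x}
    (h : f ▷ W ≫ (β_ _ _).hom ≫ (ihom.ev W).app x = g ▷ W ≫ (β_ _ _).hom ≫ (ihom.ev W).app x) :
    f = g := by
  apply MonoidalClosed.uncurry_injective
  rw [MonoidalClosed.uncurry_eq, MonoidalClosed.uncurry_eq, ← cancel_epi (β_ P W).hom]
  exact (BraidedCategory.braiding_naturality_left_assoc _ _ _).symm.trans
    (h.trans (BraidedCategory.braiding_naturality_left_assoc _ _ _))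

variable (x : V)

/-- The object of morphisms `x^{⊗m} ⟶ x`. -/
def endObj (m : ℕ) : V := (ihom (bigTens fun _ : Fin m => x)).obj x

/-- The evaluation morphism of `endObj`. -/
def endEval (m : ℕ) : endObj x m ⊗ bigTens (fun _ : Fin m => x) ⟶ x :=
  (β_ _ _).hom ≫ (ihom.ev (bigTens fun _ : Fin m => x)).app x

variable {x}

/-- The morphism to `endObj` with a given effect. -/
def endCurry {m : ℕ} {P : V} (f : P ⊗ bigTens (fun _ : Fin m => x) ⟶ x) : P ⟶ endObj x m :=
  MonoidalClosed.curry ((β_ _ _).hom ≫ f)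

@[simp]
theorem endCurry_eval {m : ℕ} {P : V} (f : P ⊗ bigTens (fun _ : Fin m => x) ⟶ x) :
    endCurry f ▷ _ ≫ endEval x m = f :=
  curry_braiding_eval f

theorem end_hom_ext {m : ℕ} {P : V} {f g : P ⟶ endObj x m}
    (h : f ▷ _ ≫ endEval x m = g ▷ _ ≫ endEval x m) : f = g :=
  ihom_hom_ext h

variable (x)

/-- Substitution of endomorphisms. -/
noncomputable def endMul {m k : ℕ} {σ : Fin m → Fin k} {b : Fin k → ℕ}
    {κ : ∀ i, Fin (b i) → Fin m} (h : IsFibers σ b κ) :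
    endObj x k ⊗ bigTens (fun i => endObj x (b i)) ⟶ endObj x m :=
  endCurry (distribute (endObj x k) (fun i => endObj x (b i)) (fun _ => x) h ≫
    endObj x k ◁ bigTensHom (fun i => endEval x (b i)) ≫ endEval x k)

theorem endMul_eval {m k : ℕ} {σ : Fin m → Fin k} {b : Fin k → ℕ}
    {κ : ∀ i, Fin (b i) → Fin m} (h : IsFibers σ b κ) :
    endMul x h ▷ _ ≫ endEval x m =
      distribute (endObj x k) (fun i => endObj x (b i)) (fun _ => x) h ≫
        endObj x k ◁ bigTensHom (fun i => endEval x (b i)) ≫ endEval x k :=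
  endCurry_eval _

/-- Permutation of the arguments of endomorphisms. -/
noncomputable def endAct {m : ℕ} (π : Equiv.Perm (Fin m)) : endObj x m ⟶ endObj x m :=
  endCurry (endObj x m ◁ inv (permute π fun _ => x) ≫ endEval x m)

theorem endAct_eval {m : ℕ} (π : Equiv.Perm (Fin m)) :
    (endObj x m) ◁ permute π (fun _ => x) ≫ endAct x π ▷ _ ≫ endEval x m = endEval x m := by
  rw [endAct, endCurry_eval, ← MonoidalCategory.whiskerLeft_comp_assoc, IsIso.hom_inv_id,
    MonoidalCategory.whiskerLeft_id, Category.id_comp]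

/-- Morphisms to `endObj x m` may be compared after a permutation of the arguments. Since `endAct`
is characterised by `endAct_eval`, this is how equations between actions of permutations are
checked. -/
theorem end_hom_ext_permute {m : ℕ} {P : V} (π : Equiv.Perm (Fin m)) {f g : P ⟶ endObj x m}
    (h : P ◁ permute π (fun _ => x) ≫ f ▷ _ ≫ endEval x m =
      P ◁ permute π (fun _ => x) ≫ g ▷ _ ≫ endEval x m) : f = g :=
  end_hom_ext ((cancel_epi _).1 h)

theorem comp_endAct_eval {m : ℕ} (π : Equiv.Perm (Fin m)) {P : V} (f : P ⟶ endObj x m) :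
    P ◁ permute π (fun _ => x) ≫ (f ≫ endAct x π) ▷ _ ≫ endEval x m = f ▷ _ ≫ endEval x m := by
  rw [comp_whiskerRight, Category.assoc, whisker_exchange_assoc, endAct_eval]

/-- The endomorphism operad of `x`. -/
noncomputable def endOperad : SymOperad V where
  obj := endObj x
  act := endAct x
  act_one m := end_hom_ext_permute x 1 <| by
    rw [endAct_eval, permute_one]
    simp
  act_mul π ρ := end_hom_ext_permute x (π * ρ) <| by
    rw [endAct_eval, permute_mul π ρ, MonoidalCategory.whiskerLeft_comp, Category.assoc,
      comp_endAct_eval, endAct_eval]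
  unit := endCurry ((λ_ _).hom ≫ single _)
  mul _ _ _ _ h := endMul x h
  mul_assoc {m l k} σ ω _ _ b κ hω f φ hσ d ι hσω τ _ _ ψ hψ hτ := end_hom_ext <| by
    have key := distribute_distribute hω hσ hσω hψ hτ (endObj x k) (fun i => endObj x (b i))
      (fun s => endObj x (f s)) x
    have e : ∀ i, endMul x (hτ i) ▷ bigTens (fun _ : Fin (d i) => x) ≫ endEval x (d i) =
        distribute (endObj x (b i)) (fun j => endObj x (f (κ i j))) (fun _ => x) (hτ i) ≫
          endObj x (b i) ◁ bigTensHom (fun j => endEval x (f (κ i j))) ≫ endEval x (b i) :=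
      fun i => endMul_eval x (hτ i)
    have n := distribute_natural_right (endObj x k) (fun i => endObj x (b i))
      (fun s => endEval x (f s)) hω
    simp only [comp_whiskerRight, Category.assoc]
    rw [endMul_eval, endMul_eval, reassoc_of% distribute_natural_outer,
      ← whisker_exchange_assoc, endMul_eval, reassoc_of% n, reassoc_of% key,
      reassoc_of% distribute_natural_inner]
    simp only [← Category.assoc (_ ◁ bigTensHom _) (_ ◁ bigTensHom _),
      whiskerLeft_bigTensHom_comp, e]
  mul_id m h := end_hom_ext <| by
    have key := distribute_unit_right h (endObj x m) fun _ => x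
    rw [comp_whiskerRight_assoc, endMul_eval, reassoc_of% distribute_natural_inner,
      ← Category.assoc (_ ◁ bigTensHom _) (_ ◁ bigTensHom _), whiskerLeft_bigTensHom_comp]
    simp only [endCurry_eval]
    rw [reassoc_of% key]
  mul_unit m h := end_hom_ext <| by
    have key := distribute_unit_left h (endObj x m) fun _ => x
    rw [comp_whiskerRight_assoc, endMul_eval, reassoc_of% distribute_natural_outer,
      ← whisker_exchange_assoc, endCurry_eval, ← key]
    have n := single_natural fun _ : Fin 1 => endEval x m
    rw [leftUnitor_naturality_assoc, n]
    simp only [Category.assoc]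
  equivariance_outer {m k} σ σ' _ _ π ρ _ b κ h κ' h' hπ := end_hom_ext_permute x π <| by
    rw [comp_endAct_eval, endMul_eval]
    have key := distribute_permute_outer π ρ h h' hπ (endObj x k) (fun i => endObj x (b i)) x
    have n := permute_natural ρ fun i => endEval x (b i)
    rw [tensorHom_def', comp_whiskerRight, comp_whiskerRight, Category.assoc, Category.assoc,
      endMul_eval, reassoc_of% distribute_natural_outer, reassoc_of% key, ← whisker_exchange_assoc,
      ← MonoidalCategory.whiskerLeft_comp_assoc, ← n, MonoidalCategory.whiskerLeft_comp_assoc,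
      endAct_eval]
  equivariance_inner {m k} σ _ b κ h π ρ hπ := end_hom_ext_permute x π <| by
    rw [comp_endAct_eval, endMul_eval]
    have key := distribute_permute_inner π h ρ hπ (endObj x k) (fun i => endObj x (b i)) x
    rw [comp_whiskerRight, Category.assoc, endMul_eval, reassoc_of% distribute_natural_inner,
      reassoc_of% key, ← Category.assoc (_ ◁ bigTensHom _) (_ ◁ bigTensHom _),
      whiskerLeft_bigTensHom_comp, ← Category.assoc (_ ◁ bigTensHom _) (_ ◁ bigTensHom _),
      whiskerLeft_bigTensHom_comp]
    have e : ∀ i, endObj x (b i) ◁ permute (ρ i) (fun _ => x) ≫ endAct x (ρ i) ▷ _ ≫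
        endEval x (b i) = endEval x (b i) := fun i => endAct_eval x (ρ i)
    simp only [Category.assoc]
    simp only [e]

/-- The tautological algebra of the endomorphism operad of `x`. -/
noncomputable def endAlg : (endOperad x).Alg where
  carrier := x
  act := endEval x
  act_unit := endCurry_eval _
  act_mul _ _ _ _ h := endMul_eval x h
  equivariance π :=
    (congrArg (· ≫ _) (tensorHom_def' _ _)).trans ((Category.assoc _ _ _).trans (endAct_eval x π))

end End

/-! ### Algebras as morphisms to the endomorphism operad -/

section Algebras

variable {n : ℕ} {V : Type u} [Category.{v} V] [MonoidalCategory V] [SymmetricCategory V]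

theorem SymOperad.Alg.eq_of_act {B : SymOperad V} {y z : B.Alg} (h : y.carrier = z.carrier)
    (h' : ∀ m, HEq (y.act m) (z.act m)) : y = z := by
  obtain ⟨c, a, _, _, _⟩ := y
  obtain ⟨c', a', _, _, _⟩ := z
  obtain rfl : c = c' := h
  obtain rfl : a = a' := funext fun m => eq_of_heq (h' m)
  rfl

theorem NOperad.Alg.eq_of_act {A : NOperad n V} {y z : A.Alg} (h : y.carrier = z.carrier)
    (h' : ∀ T, HEq (y.act T) (z.act T)) : y = z := by
  obtain ⟨c, a, _, _⟩ := y
  obtain ⟨c', a', _, _⟩ := z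
  obtain rfl : c = c' := h
  obtain rfl : a = a' := funext fun m => eq_of_heq (h' m)
  rfl

/-- Restriction of algebras along a morphism of symmetric operads. -/
noncomputable def SymOperad.Alg.pull {B C : SymOperad V} (f : B ⟶ C) (y : C.Alg) : B.Alg where
  carrier := y.carrier
  act m := SymOperad.Hom.app f m ▷ _ ≫ y.act m
  act_unit := unit_aux (SymOperad.Hom.unit f) y.act_unit
  act_mul σ b κ mσ h := mul_aux (SymOperad.Hom.mul f σ b κ mσ h) (y.act_mul σ b κ mσ h)
    (distribute_natural (SymOperad.Hom.app f _) (fun i => SymOperad.Hom.app f (b i)) _ h)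
    (act_aux (bigTensHom_comp _ _))
  equivariance π := by
    have h := y.equivariance π
    have h' := SymOperad.Hom.act f π
    rw [tensorHom_def'] at h ⊢
    rw [Category.assoc, ← comp_whiskerRight_assoc, h', comp_whiskerRight_assoc,
      whisker_exchange_assoc, ← Category.assoc (_ ◁ _), h]

variable [MonoidalClosed V]

theorem endCurry_tensor_eval {x : V} {k : ℕ} {b : Fin k → ℕ} {P : V} {Q : Fin k → V}
    (α : P ⊗ bigTens (fun _ : Fin k => x) ⟶ x)
    (β : ∀ i, Q i ⊗ bigTens (fun _ : Fin (b i) => x) ⟶ x) :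
    (endCurry α ⊗ₘ bigTensHom fun i => endCurry (β i) ▷ bigTens fun _ : Fin (b i) => x) ≫
      endObj x k ◁ bigTensHom (fun i => endEval x (b i)) ≫ endEval x k =
        P ◁ bigTensHom β ≫ α := by
  rw [MonoidalCategory.tensorHom_def, Category.assoc, ← Category.assoc (_ ◁ _),
    whiskerLeft_bigTensHom_comp, ← whisker_exchange_assoc]
  simp only [endCurry_eval]

/-- The structure of an algebra as a morphism to the endomorphism operad. -/
noncomputable def SymOperad.Alg.toHom {B : SymOperad V} (y : B.Alg) :
    B ⟶ endOperad y.carrier :=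
  show SymOperad.Hom _ _ from
  { app := fun m => endCurry (y.act m)
    act := fun π => end_hom_ext_permute _ π
      (hom_act_aux (endCurry_eval _) (endCurry_eval _) (y.equivariance π) (endAct_eval _ π))
    unit := end_hom_ext (hom_unit_aux (endCurry_eval _) y.act_unit (endCurry_eval _))
    mul := fun {_ k} σ b κ mσ h => end_hom_ext (hom_mul_aux (endCurry_eval _) (y.act_mul σ b κ mσ h)
      (endMul_eval _ h)
      (distribute_natural (endCurry (y.act k)) (fun i => endCurry (y.act (b i))) _ h)
      (endCurry_tensor_eval _ _)) }

/-- The structure of an algebra of an `n`-operad as a morphism to the endomorphism `n`-operad. -/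
noncomputable def NOperad.Alg.toHom {A : NOperad n V} (y : A.Alg) :
    A ⟶ (Des n V).obj (endOperad y.carrier) :=
  show NOperad.Hom _ _ from
  { app := fun T => endCurry (y.act T)
    unit := end_hom_ext (hom_unit_aux (endCurry_eval _) y.act_unit (endCurry_eval _))
    mul := fun {_ S} σ F ι h => end_hom_ext (hom_mul_aux (endCurry_eval _) (y.act_mul σ F ι h)
      ((endAlg y.carrier).comp_act (Tree.onTips σ) _ _ h.onTips)
      (distribute_natural (endCurry (y.act S)) (fun s => endCurry (y.act (F s))) _ h.onTips)
      (endCurry_tensor_eval _ _)) }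

theorem SymOperad.Alg.pull_toHom {B : SymOperad V} (y : B.Alg) :
    SymOperad.Alg.pull y.toHom (endAlg y.carrier) = y :=
  SymOperad.Alg.eq_of_act rfl fun m => heq_of_eq (endCurry_eval (y.act m))

theorem NOperad.Alg.restrict_toHom {A : NOperad n V} (y : A.Alg) :
    (restrict y.toHom).obj (endAlg y.carrier) = y :=
  NOperad.Alg.eq_of_act rfl fun T => heq_of_eq (endCurry_eval (y.act T))

/-- Under the correspondence of algebras with morphisms to endomorphism operads, restriction along
`f` is precomposition with `f`. -/
theorem toHom_restrict {A : NOperad n V} {B : SymOperad V} (f : A ⟶ (Des n V).obj B) (y : B.Alg) :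
    ((restrict f).obj y).toHom = f ≫ (Des n V).map y.toHom :=
  NOperad.Hom.ext <| funext fun T => end_hom_ext <| by
    refine (endCurry_eval _).trans ?_
    refine Eq.symm ((congrArg (· ≫ _) (comp_whiskerRight _ _ _)).trans
      ((Category.assoc _ _ _).trans ?_))
    exact congrArg (_ ≫ ·) (endCurry_eval (y.act T.tips))

end Algebras

/-! ### The left adjoint of desymmetrisation -/

section JointlyEpi

variable {V : Type u} [Category.{v} V]

/-- A family of morphisms with a common target which jointly detects equality of morphisms. -/
def JointlyEpi {I : Type w} {P : I → V} {Q : V} (e : ∀ a, P a ⟶ Q) : Prop :=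
  ∀ ⦃Z : V⦄ ⦃g g' : Q ⟶ Z⦄, (∀ a, e a ≫ g = e a ≫ g') → g = g'

variable [MonoidalCategory V] [MonoidalClosed V]

theorem JointlyEpi.whiskerLeft {I : Type w} {P : I → V} {Q : V} {e : ∀ a, P a ⟶ Q}
    (h : JointlyEpi e) (W : V) : JointlyEpi fun a => W ◁ e a := by
  intro Z g g' hg
  apply MonoidalClosed.curry_injective
  refine h fun a => ?_
  rw [← MonoidalClosed.curry_natural_left, ← MonoidalClosed.curry_natural_left, hg]

variable [SymmetricCategory V]

theorem JointlyEpi.whiskerRight {I : Type w} {P : I → V} {Q : V} {e : ∀ a, P a ⟶ Q}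
    (h : JointlyEpi e) (W : V) : JointlyEpi fun a => e a ▷ W := by
  intro Z g g' hg
  rw [← cancel_epi (β_ W Q).hom]
  refine h.whiskerLeft W fun a => ?_
  rw [BraidedCategory.braiding_naturality_right_assoc,
    BraidedCategory.braiding_naturality_right_assoc, hg]

theorem JointlyEpi.tensor {I J : Type*} {P : I → V} {Q : V} {e : ∀ a, P a ⟶ Q}
    (h : JointlyEpi e) {P' : J → V} {Q' : V} {e' : ∀ a, P' a ⟶ Q'} (h' : JointlyEpi e') :
    JointlyEpi fun a : I × J => e a.1 ⊗ₘ e' a.2 := by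
  intro Z g g' hg
  refine h'.whiskerLeft Q fun b => h.whiskerRight _ fun a => ?_
  have h : (e a ⊗ₘ e' b) ≫ g = (e a ⊗ₘ e' b) ≫ g' := hg (a, b)
  rwa [MonoidalCategory.tensorHom_def, Category.assoc, Category.assoc] at h

end JointlyEpi

/-- An equation between operations, which becomes an equation between terms after precomposition
with the values of terms, holds in the free structure if it holds in all the given models. -/
theorem Signature.free_eq_of_forall_eq {V : Type u} [Category.{v} V] [HasColimits V]
    {Θ : Signature V} {I : Type w} (M : I → Θ.Model) {c : Θ.Sort'} {J : Type*} {W : J → V}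
    {Q : Θ.Model → V} (t s : J → Θ.Term c) (φ : ∀ j, W j ⟶ (t j).dom) (hφ : ∀ j, IsIso (φ j))
    (ψ : ∀ j, W j ⟶ (s j).dom) (q : ∀ N j, W j ⟶ Q N) (hq : JointlyEpi (q (free M)))
    (l r : ∀ N : Θ.Model, Q N ⟶ N.obj c) (hl : ∀ N j, q N j ≫ l N = φ j ≫ N.ev (t j))
    (hr : ∀ N j, q N j ≫ r N = ψ j ≫ N.ev (s j)) (h : ∀ i, l (M i) = r (M i)) :
    l (free M) = r (free M) :=
  hq fun j => by
    rw [hl, hr, ← free_equation M (t := t j) (s := s j) (inv (φ j) ≫ ψ j), Category.assoc,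
      IsIso.hom_inv_id_assoc]
    intro i
    rw [Category.assoc, ← hr, ← h, hl, IsIso.inv_hom_id_assoc]

section Interchange

variable {V : Type u} [Category.{v} V] [MonoidalCategory V]

theorem mul_id_aux {A B W : V} (a : A ⟶ B) (u : W ⟶ 𝟙_ V) :
    a ▷ W ≫ B ◁ u ≫ (ρ_ B).hom = (A ◁ u ≫ (ρ_ A).hom) ≫ a := by
  rw [← whisker_exchange_assoc, rightUnitor_naturality, Category.assoc]

theorem mul_unit_aux {A B A' B' : V} {a : A ⟶ B} {s : B ⟶ B'} {s' : A ⟶ A'} {c : A' ⟶ B'}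
    (h : a ≫ s = s' ≫ c) : 𝟙_ V ◁ a ≫ (λ_ B).hom ≫ s = ((λ_ A).hom ≫ s') ≫ c := by
  rw [leftUnitor_naturality_assoc, h, Category.assoc]

theorem outer_aux {A B B' C C' D D' E : V} {a : A ⟶ B} {r : B ⟶ B'} {c : C ⟶ C'} {p' : C' ⟶ D'}
    {p : C ⟶ D} {d : D ⟶ D'} {m : B' ⊗ D' ⟶ E} (h : c ≫ p' = p ≫ d) :
    (a ⊗ₘ c) ≫ (r ⊗ₘ p') ≫ m = A ◁ p ≫ ((a ≫ r) ⊗ₘ d) ≫ m := by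
  rw [tensorHom_comp_tensorHom_assoc, h, ← id_tensorHom, tensorHom_comp_tensorHom_assoc,
    Category.id_comp]

theorem mul_aux₁ {A A' B C D E : V} (a : A ⟶ A') (b : B ⟶ C) (m : A' ⟶ D) (m' : D ⊗ C ⟶ E) :
    (a ⊗ₘ b) ≫ m ▷ C ≫ m' = ((a ≫ m) ⊗ₘ b) ≫ m' := by
  rw [← tensorHom_id, tensorHom_comp_tensorHom_assoc, Category.comp_id]

theorem mul_aux₂ {A A' E : V} {k : ℕ} {B C D : Fin k → V} (a : A ⟶ A') (b : ∀ i, B i ⟶ C i)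
    (m : ∀ i, C i ⟶ D i) (m' : A' ⊗ bigTens D ⟶ E) :
    (a ⊗ₘ bigTensHom b) ≫ A' ◁ bigTensHom m ≫ m' = (a ⊗ₘ bigTensHom fun i => b i ≫ m i) ≫ m' := by
  rw [← id_tensorHom, tensorHom_comp_tensorHom_assoc, Category.comp_id, bigTensHom_comp]

end Interchange

section Distribute

variable {V : Type u} [Category.{v} V] [MonoidalCategory V] [SymmetricCategory V]

theorem distribute_natural_all {m k : ℕ} {σ : Fin m → Fin k} {b : Fin k → ℕ}
    {κ : ∀ i, Fin (b i) → Fin m} {P P' : V} (p : P ⟶ P') {Y Y' : Fin k → V} (y : ∀ i, Y i ⟶ Y' i)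
    {X X' : Fin m → V} (x : ∀ i, X i ⟶ X' i) (h : IsFibers σ b κ) :
    ((p ⊗ₘ bigTensHom y) ⊗ₘ bigTensHom x) ≫ distribute P' Y' X' h =
      distribute P Y X h ≫ (p ⊗ₘ bigTensHom fun i => y i ⊗ₘ bigTensHom fun j => x (κ i j)) := by
  rw [tensorHom_def', Category.assoc, distribute_natural, reassoc_of% distribute_natural_right]
  congr 1
  rw [← id_tensorHom, tensorHom_comp_tensorHom, Category.id_comp, ← bigTensHom_comp]
  simp only [tensorHom_def']

end Distribute

section Symmetrisation

variable {n : ℕ} {V : Type u} [Category.{v} V] [MonoidalCategory V] [SymmetricCategory V]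
  [MonoidalClosed V]

/-- The operations of a symmetric operad, apart from the unit. -/
inductive SymOp : Type
  | act (m : ℕ) (π : Equiv.Perm (Fin m))
  | mul (m k : ℕ) (σ : Fin m → Fin k) (b : Fin k → ℕ) (κ : ∀ i, Fin (b i) → Fin m)
    (mσ : Monotone σ) (h : IsFibers σ b κ)

/-- The arguments of an operation. -/
def SymOp.Pos : SymOp → Type
  | act _ _ => Unit
  | mul _ k _ _ _ _ _ => Fin (k + 1)

/-- The arities of the arguments of an operation. -/
def SymOp.inp : ∀ o : SymOp, o.Pos → ℕ
  | act m _ => fun _ => m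
  | mul _ k _ b _ _ _ => Fin.cons k b

/-- The arity of the value of an operation. -/
def SymOp.out : SymOp → ℕ
  | act m _ => m
  | mul m _ _ _ _ _ _ => m

/-- The source of an operation, as a functor of its arguments. -/
def SymOp.src (V : Type u) [Category.{v} V] [MonoidalCategory V] : ∀ o : SymOp, (o.Pos → V) ⥤ V
  | act _ _ => Pi.eval (fun _ : Unit => V) ()
  | mul _ k _ _ _ _ _ => consTensor (bigTensFunctor k)

theorem SymOp.multicocontinuous : ∀ o : SymOp, Multicocontinuous (SymOp.src V o)
  | act _ _ => multicocontinuous_eval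
  | mul _ k _ _ _ _ _ => (multicocontinuous_bigTens k).consTensor

/-- The signature of symmetric operads under the `n`-operad `A`: the objects `A_T` are generators of
arity `|T|`, and the unit is a further generator of arity `1`. -/
def symSig (A : NOperad n V) : Signature V where
  Sort' := ℕ
  Op := SymOp
  Pos := SymOp.Pos
  inp := SymOp.inp
  out := SymOp.out
  src := SymOp.src V
  multicocontinuous := SymOp.multicocontinuous
  Gen := Option (Tree n)
  genSort
    | none => 1
    | some T => T.tips
  gen
    | none => 𝟙_ V
    | some T => A.obj T

namespace symSig

variable {A : NOperad n V}

/-- The unit as a term. -/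
def unitTerm : (symSig A).Term (1 : ℕ) := .gen (Θ := symSig A) none

/-- The generator `A_T` as a term. -/
def treeTerm (T : Tree n) : (symSig A).Term T.tips := .gen (Θ := symSig A) (some T)

/-- The term formed by the action of a permutation. -/
def actTerm {m : ℕ} (π : Equiv.Perm (Fin m)) (t : (symSig A).Term m) : (symSig A).Term m :=
  .node (Θ := symSig A) (SymOp.act m π) fun _ => t

/-- The term formed by multiplication. -/
def mulTerm {m k : ℕ} {σ : Fin m → Fin k} {b : Fin k → ℕ} {κ : ∀ i, Fin (b i) → Fin m}
    (mσ : Monotone σ) (h : IsFibers σ b κ) (t : (symSig A).Term k)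
    (ts : ∀ i, (symSig A).Term (b i)) : (symSig A).Term m :=
  .node (Θ := symSig A) (SymOp.mul m k σ b κ mσ h)
    (Fin.cons (α := fun p => (symSig A).Term (Fin.cons (α := fun _ => ℕ) k b p)) t ts)

variable (N : (symSig A).Model)

/-- The object of `m`-ary operations of a model. -/
def ar (m : ℕ) : V := N.obj m

/-- The unit of a model. -/
def unit : 𝟙_ V ⟶ ar N 1 := N.gen none

/-- The image of a generator in a model. -/
def tree (T : Tree n) : A.obj T ⟶ ar N T.tips := N.gen (some T)

/-- The action of permutations in a model. -/
def act {m : ℕ} (π : Equiv.Perm (Fin m)) : ar N m ⟶ ar N m := N.op (SymOp.act m π)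

/-- The multiplication of a model. -/
def mul {m k : ℕ} {σ : Fin m → Fin k} {b : Fin k → ℕ} {κ : ∀ i, Fin (b i) → Fin m}
    (mσ : Monotone σ) (h : IsFibers σ b κ) : ar N k ⊗ bigTens (fun i => ar N (b i)) ⟶ ar N m :=
  N.op (SymOp.mul m k σ b κ mσ h)

/-- The object from which a term is evaluated. -/
def dom {m : ℕ} (t : (symSig A).Term m) : V := Signature.Term.dom t

/-- Evaluation of a term in a model. -/
def ev {m : ℕ} (t : (symSig A).Term m) : dom t ⟶ ar N m := N.ev t

/-- The model given by a symmetric operad `B` and a morphism `A ⟶ Des_n(B)`. -/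
noncomputable def model (x : Σ B : SymOperad V, A ⟶ (Des n V).obj B) : (symSig A).Model where
  obj := x.1.obj
  op
    | .act _ π => x.1.act π
    | .mul _ _ σ b κ mσ h => x.1.mul σ b κ mσ h
  gen
    | none => x.1.unit
    | some T => NOperad.Hom.app x.2 T

variable [HasColimits V] (A)

/-- The free model. -/
noncomputable abbrev freeModel : (symSig A).Model := Signature.free (model (A := A))

variable {A}

/-- An equation between terms which holds for all symmetric operads under `A` holds in the free
model. -/
theorem freeModel_equation {m : ℕ} {t s : (symSig A).Term m} (φ : dom t ⟶ dom s)
    (h : ∀ x, φ ≫ ev (model x) s = ev (model x) t) :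
    φ ≫ ev (freeModel A) s = ev (freeModel A) t :=
  Signature.free_equation _ φ h

theorem jointlyEpi_ev (m : ℕ) :
    JointlyEpi fun t : (symSig A).Term m => ev (freeModel A) t :=
  fun _ _ _ h => Signature.free_hom_ext _ h

theorem jointlyEpi_bigTens {k : ℕ} (b : Fin k → ℕ) :
    JointlyEpi fun ts : ∀ i, (symSig A).Term (b i) => bigTensHom fun i => ev (freeModel A) (ts i) :=
  fun _ g g' h => Signature.src_free_hom_ext (Θ := symSig A) (model (A := A))
    (S := bigTensFunctor k) (multicocontinuous_bigTens k) b (g := g) (g' := g') h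

/-- The special case of `Signature.free_eq_of_forall_eq` for which the left hand side becomes the
value of a term. -/
theorem free_eq_of_model_eq {m : ℕ} {J : Type*} {Q : (symSig A).Model → V}
    (t s : J → (symSig A).Term m) (φ : ∀ j, dom (t j) ⟶ dom (s j)) (q : ∀ N j, dom (t j) ⟶ Q N)
    (hq : JointlyEpi (q (freeModel A))) (l r : ∀ N, Q N ⟶ ar N m)
    (hl : ∀ N j, q N j ≫ l N = ev N (t j)) (hr : ∀ N j, q N j ≫ r N = φ j ≫ ev N (s j))
    (h : ∀ x, l (model x) = r (model x)) : l (freeModel A) = r (freeModel A) :=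
  Signature.free_eq_of_forall_eq (model (A := A)) t s (fun j => 𝟙 (dom (t j)))
    (fun j => inferInstanceAs (IsIso (𝟙 (dom (t j))))) φ q hq l r
    (fun N j => (hl N j).trans (Category.id_comp _).symm) hr h

/-- The values of terms jointly cover a tensor product whose factors are permuted; the terms are
indexed by the original factors. -/
theorem jointlyEpi_bigTens_comp {k : ℕ} (b : Fin k → ℕ) (ρ : Equiv.Perm (Fin k)) :
    JointlyEpi fun ts : ∀ i, (symSig A).Term (b i) =>
      bigTensHom fun i => ev (freeModel A) (ts (ρ i)) := by
  intro Z g g' hg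
  refine jointlyEpi_bigTens (fun i => b (ρ i)) fun ts => ?_
  have h := hg (Equiv.piCongrLeft (fun i => (symSig A).Term (b i)) ρ ts)
  have e : ∀ i, Equiv.piCongrLeft (fun i => (symSig A).Term (b i)) ρ ts (ρ i) = ts i :=
    fun i => Equiv.piCongrLeft_apply_apply _ _ _ _
  exact (funext e : (fun i => _) = ts) ▸ h

end symSig

open symSig in
/-- The symmetrisation of an `n`-operad. -/
noncomputable def symObj [HasColimits V] (A : NOperad n V) : SymOperad V where
  obj := ar (freeModel A)
  act := act (freeModel A)
  act_one m := free_eq_of_model_eq (fun t => actTerm 1 t) (fun t => t) (fun t => 𝟙 (dom t))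
    (fun N t => ev N t)
    (jointlyEpi_ev m) (fun N => act N 1) (fun _ => 𝟙 _) (fun _ _ => rfl)
    (fun _ _ => (Category.comp_id _).trans (Category.id_comp _).symm)
    fun x => x.1.act_one m
  act_mul {m} π ρ := free_eq_of_model_eq (fun t => actTerm (π * ρ) t)
    (fun t => actTerm π (actTerm ρ t)) (fun t => 𝟙 (dom t))
    (fun N t => ev N t)
    (jointlyEpi_ev m) (fun N => act N (π * ρ)) (fun N => act N ρ ≫ act N π) (fun _ _ => rfl)
    (fun _ _ => (Category.assoc _ _ _).symm.trans (Category.id_comp _).symm)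
    fun x => x.1.act_mul π ρ
  unit := unit (freeModel A)
  mul _ _ _ mσ h := mul (freeModel A) mσ h
  mul_assoc {_ _ k} σ ω mσ mω b κ hω f φ hσ d ι hσω τ hκ mτ ψ hψ hτ :=
    free_eq_of_model_eq
      (J := ((symSig A).Term k × ∀ i, (symSig A).Term (b i)) × ∀ s, (symSig A).Term (f s))
      (fun t => mulTerm mσ hσ (mulTerm mω hω t.1.1 t.1.2) t.2)
      (fun t => mulTerm (mω.comp mσ) hσω t.1.1 fun i => mulTerm (mτ i) (hτ i) (t.1.2 i)
        fun j => t.2 (κ i j))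
      (fun t => distribute (dom t.1.1) (fun i => dom (t.1.2 i)) (fun s => dom (t.2 s)) hω)
      (fun N t => (ev N t.1.1 ⊗ₘ bigTensHom fun i => ev N (t.1.2 i)) ⊗ₘ
        bigTensHom fun s => ev N (t.2 s))
      (((jointlyEpi_ev k).tensor (jointlyEpi_bigTens b)).tensor (jointlyEpi_bigTens f))
      (fun N => mul N mω hω ▷ bigTens (fun s => ar N (f s)) ≫ mul N mσ hσ)
      (fun N => distribute (ar N k) (fun i => ar N (b i)) (fun s => ar N (f s)) hω ≫
        ar N k ◁ bigTensHom (fun i => mul N (mτ i) (hτ i)) ≫ mul N (mω.comp mσ) hσω)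
      (fun _ _ => mul_aux₁ _ _ _ _)
      (fun _ _ => (Category.assoc _ _ _).symm.trans
        ((congrArg (· ≫ _) (distribute_natural_all _ _ _ hω)).trans
          ((Category.assoc _ _ _).trans (congrArg (_ ≫ ·) (mul_aux₂ _ _ _ _)))))
      fun x => x.1.mul_assoc σ ω mσ mω b κ hω f φ hσ d ι hσω τ hκ mτ ψ hψ hτ
  mul_id m h := free_eq_of_model_eq
    (fun t => mulTerm monotone_id h t fun _ => unitTerm) (fun t => t)
    (fun t => dom t ◁ tensUnit _ ≫ (ρ_ _).hom)
    (fun N t => ev N t ▷ bigTens fun _ => 𝟙_ V)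
    ((jointlyEpi_ev m).whiskerRight _)
    (fun N => ar N m ◁ bigTensHom (fun _ => unit N) ≫ mul N monotone_id h)
    (fun N => ar N m ◁ tensUnit _ ≫ (ρ_ _).hom)
    (fun _ _ => (Category.assoc _ _ _).symm.trans
      (congrArg (· ≫ _) (MonoidalCategory.tensorHom_def _ _).symm))
    (fun _ _ => mul_id_aux _ _)
    fun x => x.1.mul_id m h
  mul_unit m h := free_eq_of_model_eq
    (fun ts : ∀ _ : Fin 1, (symSig A).Term m => mulTerm monotone_const h unitTerm ts)
    (fun ts => ts 0)
    (fun ts => (λ_ _).hom ≫ single fun i => dom (ts i))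
    (fun N ts => 𝟙_ V ◁ bigTensHom fun i => ev N (ts i))
    ((jointlyEpi_bigTens _).whiskerLeft _)
    (fun N => unit N ▷ bigTens (fun _ : Fin 1 => ar N m) ≫ mul N monotone_const h)
    (fun _ => (λ_ _).hom ≫ single _)
    (fun _ _ => (Category.assoc _ _ _).symm.trans
      (congrArg (· ≫ _) (tensorHom_def' _ _).symm))
    (fun _ _ => mul_unit_aux (single_natural _))
    fun x => x.1.mul_unit m h
  equivariance_outer {_ k} σ σ' mσ mσ' π ρ hρ b κ h κ' h' hκ := (free_eq_of_model_eq
    (J := (symSig A).Term k × ∀ i, (symSig A).Term (b i))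
    -- The blocks `t.2` are indexed as before the permutation, so `permute ρ` relates the domains.
    (fun t => actTerm π (mulTerm mσ' h' t.1 fun i => t.2 (ρ i)))
    (fun t => mulTerm mσ h (actTerm ρ t.1) t.2)
    (fun t => dom t.1 ◁ permute ρ fun i => dom (t.2 i))
    (fun N t => ev N t.1 ⊗ₘ bigTensHom fun i => ev N (t.2 (ρ i)))
    ((jointlyEpi_ev k).tensor (jointlyEpi_bigTens_comp b ρ))
    (fun N => mul N mσ' h' ≫ act N π)
    (fun N => (act N ρ ⊗ₘ permute ρ fun i => ar N (b i)) ≫ mul N mσ h)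
    (fun _ _ => (Category.assoc _ _ _).symm)
    (fun N t => outer_aux (permute_natural ρ fun i => ev N (t.2 i)))
    fun x => (x.1.equivariance_outer σ σ' mσ mσ' π ρ hρ b κ h κ' h' hκ).symm).symm
  equivariance_inner {_ k} σ mσ b κ h π ρ hρ := free_eq_of_model_eq
    (J := (symSig A).Term k × ∀ i, (symSig A).Term (b i))
    (fun t => mulTerm mσ h t.1 fun i => actTerm (ρ i) (t.2 i))
    (fun t => actTerm π (mulTerm mσ h t.1 t.2))
    (fun _ => 𝟙 _)
    (fun N t => ev N t.1 ⊗ₘ bigTensHom fun i => ev N (t.2 i))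
    ((jointlyEpi_ev k).tensor (jointlyEpi_bigTens b))
    (fun N => ar N k ◁ bigTensHom (fun i => act N (ρ i)) ≫ mul N mσ h)
    (fun N => mul N mσ h ≫ act N π)
    (fun _ _ => mul_aux₂ _ _ _ _)
    (fun _ _ => (Category.assoc _ _ _).symm.trans (Category.id_comp _).symm)
    fun x => x.1.equivariance_inner σ mσ b κ h π ρ hρ

variable [HasColimits V]

open symSig

/-- The canonical morphism from an `n`-operad to the desymmetrisation of its symmetrisation. -/
noncomputable def symUnit (A : NOperad n V) : A ⟶ (Des n V).obj (symObj A) :=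
  show NOperad.Hom _ _ from
  { app := fun T => tree (freeModel A) T
    unit := freeModel_equation (A := A) (t := unitTerm) (s := treeTerm (Tree.linear n)) A.unit
      fun x => NOperad.Hom.unit x.2
    mul := fun {T S} σ F _ h => by
      refine (freeModel_equation (A := A) (s := treeTerm T)
        (t := actTerm (Tuple.sort (Tree.onTips σ))
          (mulTerm (Tuple.monotone_sort _) h.onTips.sort (treeTerm S) fun s => treeTerm (F s)))
        (A.mul σ F _ h) fun x => ?_).trans (Category.assoc _ _ _)
      exact (NOperad.Hom.mul x.2 σ F _ h).trans (Category.assoc _ _ _).symm }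

variable {A : NOperad n V} {B : SymOperad V}

/-- A morphism `g` out of the symmetrisation is a morphism of models to the model which it induces
on its target. -/
theorem isHom_model (g : symObj A ⟶ B) :
    (freeModel A).IsHom (model ⟨B, symUnit A ≫ (Des n V).map g⟩) (SymOperad.Hom.app g) where
  op
    | .act _ π => SymOperad.Hom.act g π
    | .mul _ _ σ b κ mσ h => SymOperad.Hom.mul g σ b κ mσ h
  gen
    | none => SymOperad.Hom.unit g
    | some _ => rfl

theorem exists_symObj_hom (f : A ⟶ (Des n V).obj B) :
    ∃ g : symObj A ⟶ B, symUnit A ≫ (Des n V).map g = f := by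
  obtain ⟨g, hg⟩ := Signature.exists_free_isHom (model (A := A)) ⟨B, f⟩
  let g' : SymOperad.Hom (symObj A) B :=
    { app := g
      act := fun π => hg.op (.act _ π)
      unit := hg.gen none
      mul := fun σ b κ mσ h => hg.op (.mul _ _ σ b κ mσ h) }
  exact ⟨g', NOperad.Hom.ext (funext fun T => hg.gen (some T))⟩

theorem symObj_hom_ext {g g' : symObj A ⟶ B}
    (h : symUnit A ≫ (Des n V).map g = symUnit A ≫ (Des n V).map g') : g = g' :=
  SymOperad.Hom.ext (Signature.free_isHom_unique _ (isHom_model g) (h ▸ isHom_model g'))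

/-- The free symmetric operads `symObj A`, for all `n`-operads `A`, give a left adjoint of
desymmetrisation. -/
instance : (Des n V).IsRightAdjoint := by
  have : ∀ A : NOperad n V, HasInitial (StructuredArrow A (Des n V)) := fun A =>
    (IsInitial.ofUniqueHom (X := StructuredArrow.mk (symUnit A))
      (fun Y => StructuredArrow.homMk (exists_symObj_hom Y.hom).choose
        (exists_symObj_hom Y.hom).choose_spec)
      fun Y m => StructuredArrow.ext _ _ (symObj_hom_ext
        ((StructuredArrow.w m).trans (exists_symObj_hom Y.hom).choose_spec.symm))).hasInitial
  exact isRightAdjointOfStructuredArrowInitials _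

end Symmetrisation

/-! ### Morphisms of algebras of a symmetrisation -/

section Intertwines

theorem effect_mul_aux {V : Type u} [Category.{v} V] [MonoidalCategory V] {P P' Y Y' X W W' C x : V}
    {q : P ⊗ Y ⟶ P' ⊗ Y'} {μ : P' ⊗ Y' ⟶ C} {α : C ⊗ X ⟶ x} {D' : (P' ⊗ Y') ⊗ X ⟶ W'} {c : W' ⟶ x}
    {D : (P ⊗ Y) ⊗ X ⟶ W} {w : W ⟶ W'} {c' : W ⟶ x} (h : μ ▷ X ≫ α = D' ≫ c)
    (hD : q ▷ X ≫ D' = D ≫ w) (hw : w ≫ c = c') : (q ≫ μ) ▷ X ≫ α = D ≫ c' := by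
  rw [comp_whiskerRight, Category.assoc, h, reassoc_of% hD, hw]

variable {V : Type u} [Category.{v} V] [MonoidalCategory V] [SymmetricCategory V]

variable {B : SymOperad V}

/-- The action on an algebra of a family of operations `f`. -/
def SymOperad.Alg.effect (y : B.Alg) {m : ℕ} {P : V} (f : P ⟶ B.obj m) :
    P ⊗ bigTens (fun _ : Fin m => y.carrier) ⟶ y.carrier :=
  f ▷ _ ≫ y.act m

theorem SymOperad.Alg.effect_comp (y : B.Alg) {m : ℕ} {P Q : V} (p : Q ⟶ P) (f : P ⟶ B.obj m) :
    y.effect (p ≫ f) = p ▷ _ ≫ y.effect f := by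
  rw [effect, effect, comp_whiskerRight, Category.assoc]

theorem SymOperad.Alg.effect_act (y : B.Alg) {m : ℕ} {P : V} (f : P ⟶ B.obj m)
    (π : Equiv.Perm (Fin m)) :
    P ◁ permute π (fun _ => y.carrier) ≫ y.effect (f ≫ B.act π) = y.effect f := by
  have h := y.equivariance π
  rw [tensorHom_def', Category.assoc] at h
  rw [effect, effect, comp_whiskerRight, Category.assoc, whisker_exchange_assoc, h]

/-- The effect of a composite operation is the composite of the effects. -/
theorem SymOperad.Alg.effect_mul (y : B.Alg) {m k : ℕ} {σ : Fin m → Fin k} {b : Fin k → ℕ}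
    {κ : ∀ i, Fin (b i) → Fin m} (mσ : Monotone σ) (h : IsFibers σ b κ) {P : V} (f : P ⟶ B.obj k)
    {Q : Fin k → V} (g : ∀ i, Q i ⟶ B.obj (b i)) :
    y.effect ((f ⊗ₘ bigTensHom g) ≫ B.mul σ b κ mσ h) =
      distribute P Q (fun _ => y.carrier) h ≫
        P ◁ bigTensHom (fun i => y.effect (g i)) ≫ y.effect f := by
  refine effect_mul_aux (y.act_mul σ b κ mσ h) (distribute_natural f g _ h) ?_
  refine (mul_aux₂ f _ _ _).trans ?_
  rw [tensorHom_def', Category.assoc]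
  rfl

/-- The morphism `g` of underlying objects commutes with the operations in the image of `f`. -/
def Intertwines {y z : B.Alg} (g : y.carrier ⟶ z.carrier) {m : ℕ} {P : V} (f : P ⟶ B.obj m) :
    Prop :=
  y.effect f ≫ g = P ◁ bigTensHom (fun _ => g) ≫ z.effect f

variable {y z : B.Alg} {g : y.carrier ⟶ z.carrier}

theorem intertwines_id_iff {m : ℕ} : Intertwines g (𝟙 (B.obj m)) ↔
    y.act m ≫ g = B.obj m ◁ bigTensHom (fun _ => g) ≫ z.act m := by
  rw [Intertwines, SymOperad.Alg.effect, SymOperad.Alg.effect, id_whiskerRight, id_whiskerRight,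
    Category.id_comp, Category.id_comp]

theorem Intertwines.precomp {m : ℕ} {P Q : V} {f : P ⟶ B.obj m} (hf : Intertwines g f)
    (p : Q ⟶ P) : Intertwines g (p ≫ f) := by
  rw [Intertwines] at hf ⊢
  rw [y.effect_comp, z.effect_comp, Category.assoc, hf, whisker_exchange_assoc]

theorem intertwines_unit : Intertwines g B.unit := by
  rw [Intertwines, SymOperad.Alg.effect, SymOperad.Alg.effect]
  refine (congrArg (· ≫ _) y.act_unit).trans (Eq.trans ?_ (congrArg (_ ≫ ·) z.act_unit.symm))
  exact (mul_unit_aux (single_natural fun _ : Fin 1 => g)).symm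

theorem Intertwines.act {m : ℕ} {P : V} {f : P ⟶ B.obj m} (hf : Intertwines g f)
    (π : Equiv.Perm (Fin m)) : Intertwines g (f ≫ B.act π) := by
  rw [Intertwines, ← cancel_epi (P ◁ permute π fun _ => y.carrier), ← Category.assoc,
    y.effect_act, hf, ← MonoidalCategory.whiskerLeft_comp_assoc, ← permute_natural,
    MonoidalCategory.whiskerLeft_comp_assoc, z.effect_act]

theorem Intertwines.mul {m k : ℕ} {σ : Fin m → Fin k} {b : Fin k → ℕ}
    {κ : ∀ i, Fin (b i) → Fin m} (mσ : Monotone σ) (h : IsFibers σ b κ) {P : V} {f : P ⟶ B.obj k}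
    (hf : Intertwines g f) {Q : Fin k → V} {f' : ∀ i, Q i ⟶ B.obj (b i)}
    (hf' : ∀ i, Intertwines g (f' i)) :
    Intertwines g ((f ⊗ₘ bigTensHom f') ≫ B.mul σ b κ mσ h) := by
  have n := distribute_natural_right P Q (fun _ => g) h
  have e : ∀ i, y.effect (f' i) ≫ g = Q i ◁ bigTensHom (fun _ => g) ≫ z.effect (f' i) := hf'
  rw [Intertwines, y.effect_mul, z.effect_mul, Category.assoc, Category.assoc, hf,
    ← Category.assoc (_ ◁ bigTensHom _) (_ ◁ bigTensHom _), whiskerLeft_bigTensHom_comp,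
    reassoc_of% n, ← Category.assoc (_ ◁ bigTensHom _) (_ ◁ bigTensHom _),
    whiskerLeft_bigTensHom_comp]
  simp only [e]

variable {n : ℕ} [MonoidalClosed V] {A : NOperad n V}

open symSig

/-- A morphism which commutes with the actions of `A` commutes with all composites of operations
which come from `A`. -/
theorem intertwines_ev (f : A ⟶ (Des n V).obj B)
    (hg : ∀ T, Intertwines g (NOperad.Hom.app f T)) {m : ℕ} (t : (symSig A).Term m) :
    Intertwines g (ev (model ⟨B, f⟩) t) := by
  suffices h : ∀ (c : (symSig A).Sort') (t : (symSig A).Term c),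
      Intertwines (m := c) g (Signature.Model.ev (model ⟨B, f⟩) t) from h m t
  intro c t
  induction t with
  | gen a =>
    cases a with
    | none => exact intertwines_unit
    | some T => exact hg T
  | node o ts ih =>
    cases o with
    | act m π => exact (ih ()).act π
    | mul m k σ b κ mσ h =>
      exact Intertwines.mul mσ h (ih (0 : Fin (k + 1))) fun i => ih (Fin.succ i)

variable [HasColimits V]

/-- If `B` is a retract of the symmetrisation of `A`, then a morphism between algebras of `B`
which commutes with the actions of `A` commutes with the actions of `B`. -/
theorem act_comp_of_restrict (f : A ⟶ (Des n V).obj B) (ψ : symObj A ⟶ B) (χ : B ⟶ symObj A)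
    (hψ : symUnit A ≫ (Des n V).map ψ = f) (hχ : χ ≫ ψ = 𝟙 B)
    (hg : ∀ T, Intertwines g (NOperad.Hom.app f T)) (m : ℕ) :
    y.act m ≫ g = B.obj m ◁ bigTensHom (fun _ => g) ≫ z.act m := by
  subst hψ
  have h : Intertwines g (SymOperad.Hom.app ψ m) := by
    -- The values of terms cover the free model, so it suffices to consider composites of operations
    -- which come from `A`.
    refine (jointlyEpi_ev m).whiskerRight _ fun t => ?_
    have ht := intertwines_ev _ hg t
    have e : ev (model ⟨B, symUnit A ≫ (Des n V).map ψ⟩) t =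
      ev (freeModel A) t ≫ SymOperad.Hom.app ψ m := ((isHom_model ψ).ev_comp t).symm
    rw [e, Intertwines] at ht
    refine (Category.assoc _ _ _).symm.trans ((congrArg (· ≫ g) (y.effect_comp _ _).symm).trans
      (ht.trans ((congrArg (_ ≫ ·) (z.effect_comp _ _)).trans ?_)))
    exact whisker_exchange_assoc _ _ _
  rw [← intertwines_id_iff]
  have e : SymOperad.Hom.app χ m ≫ SymOperad.Hom.app ψ m = 𝟙 _ :=
    congrArg (fun a => SymOperad.Hom.app a m) hχ
  exact e ▸ h.precomp _

end Intertwines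

/-! ### Free algebras -/

section Iso

variable {V : Type u} [Category.{v} V] [MonoidalCategory V]

theorem split_isIso {ι : Type} (X : ι → V) (L' : List ι) : ∀ L : List ι, IsIso (split X L' L)
  | [] => inferInstanceAs (IsIso (λ_ _).inv)
  | i :: L =>
    have := split_isIso X L' L
    inferInstanceAs (IsIso (X i ◁ split X L' L ≫ (α_ _ _ _).inv))

theorem blocks_isIso {k : ℕ} {ι : Type} (X : ι → V) (b : Fin k → ℕ) (κ : ∀ i, Fin (b i) → ι) :
    ∀ L : List (Fin k), IsIso (blocks X b κ L)
  | [] => inferInstanceAs (IsIso (𝟙 (𝟙_ V)))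
  | i :: L =>
    have := blocks_isIso X b κ L
    have := split_isIso X (L.flatMap fun i => (List.finRange (b i)).map (κ i))
      ((List.finRange (b i)).map (κ i))
    have := unmap_isIso (κ i) X (List.finRange (b i))
    inferInstanceAs (IsIso (split X _ _ ≫ (unmap (κ i) X _ ⊗ₘ blocks X b κ L)))

theorem single_isIso (X : Fin 1 → V) : IsIso ((λ_ _).hom ≫ single X) :=
  have : IsIso (single X) := inferInstanceAs (IsIso (ρ_ (X 0)).hom)
  IsIso.comp_isIso

variable [SymmetricCategory V]

theorem zip_isIso {ι : Type} (X Y : ι → V) : ∀ L : List ι, IsIso (zip X Y L)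
  | [] => inferInstanceAs (IsIso (λ_ (𝟙_ V)).hom)
  | i :: L =>
    have := zip_isIso X Y L
    have : IsIso (tensorμ (X i) (tens X L) (Y i) (tens Y L)) :=
      ⟨tensorδ _ _ _ _, tensorμ_tensorδ _ _ _ _, tensorδ_tensorμ _ _ _ _⟩
    inferInstanceAs
      (IsIso (tensorμ (X i) (tens X L) (Y i) (tens Y L) ≫ (X i ⊗ Y i) ◁ zip X Y L))

theorem reorder_isIso {ι : Type} (X : ι → V) {L L' : List ι} (h : L.Perm L') (hL : L.Nodup) :
    IsIso (reorder X h) :=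
  ⟨reorder X h.symm, by rw [reorder_trans X _ _ hL, reorder_self _ _ hL], by
    rw [reorder_trans X _ _ (h.nodup_iff.1 hL), reorder_self _ _ (h.nodup_iff.1 hL)]⟩

instance distribute_isIso {m k : ℕ} {σ : Fin m → Fin k} {b : Fin k → ℕ}
    {κ : ∀ i, Fin (b i) → Fin m} (P : V) (Y : Fin k → V) (X : Fin m → V) (h : IsFibers σ b κ) :
    IsIso (distribute P Y X h) := by
  have h₁ : IsIso (regroup X h) :=
    @IsIso.comp_isIso _ _ _ _ _ _ _ (reorder_isIso X h.perm (List.nodup_finRange m))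
      (blocks_isIso X b κ _)
  have h₂ := zip_isIso Y (fun i => bigTens fun j => X (κ i j)) (List.finRange k)
  exact inferInstanceAs
    (IsIso ((α_ _ _ _).hom ≫ P ◁ (bigTens Y ◁ regroup X h ≫ zip Y _ (List.finRange k))))

end Iso

section FreeAlgebra

variable {n : ℕ} {V : Type u} [Category.{v} V] [MonoidalCategory V] [SymmetricCategory V]
  [MonoidalClosed V]

/-- The signature of algebras of the `n`-operad `A` under the object `x`. -/
def algSig (A : NOperad n V) (x : V) : Signature V where
  Sort' := Unit
  Op := Tree n
  Pos T := Fin T.tips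
  inp _ _ := ()
  out _ := ()
  src T := constTensor (A.obj T) (bigTensFunctor T.tips)
  multicocontinuous T := (multicocontinuous_bigTens T.tips).constTensor (A.obj T)
  Gen := Unit
  genSort _ := ()
  gen _ := x

namespace algSig

variable {A : NOperad n V} {x : V}

/-- The term formed by the operation of the tree `T`. -/
def node (T : Tree n) (ts : Fin T.tips → (algSig A x).Term ()) : (algSig A x).Term () :=
  .node (Θ := algSig A x) T ts

/-- The underlying object of a model. -/
def carrier (N : (algSig A x).Model) : V := N.obj ()

/-- The action of `A_T` on a model. -/
def act (N : (algSig A x).Model) (T : Tree n) :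
    A.obj T ⊗ bigTens (fun _ : Fin T.tips => carrier N) ⟶ carrier N := N.op T

/-- The object from which a term is evaluated. -/
def dom (t : (algSig A x).Term ()) : V := Signature.Term.dom t

/-- Evaluation of a term in a model. -/
def ev (N : (algSig A x).Model) (t : (algSig A x).Term ()) : dom t ⟶ carrier N := N.ev t

/-- The model given by an algebra `y` and a morphism from `x` to its underlying object. -/
def model (y : Σ y : A.Alg, x ⟶ y.carrier) : (algSig A x).Model where
  obj _ := y.1.carrier
  op T := y.1.act T
  gen _ := y.2

variable [HasColimits V]

variable (A x) in
/-- The free model. -/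
noncomputable abbrev freeModel : (algSig A x).Model := Signature.free (model (A := A) (x := x))

theorem jointlyEpi_bigTens (k : ℕ) :
    JointlyEpi fun ts : Fin k → (algSig A x).Term () =>
      bigTensHom fun i => ev (freeModel A x) (ts i) :=
  fun _ g g' h => Signature.src_free_hom_ext (Θ := algSig A x) (model (A := A) (x := x))
    (S := bigTensFunctor k) (multicocontinuous_bigTens k) (fun _ => ()) (g := g) (g' := g') h

end algSig

theorem mul_natural_aux {C : Type u} [Category.{v} C] {X X' W W' Z Y : C} {e : X ⟶ X'}
    {D' : X' ⟶ W'} {D : X ⟶ W} {w : W ⟶ W'} {a : W' ⟶ Z} {c : W ⟶ Z} {f : Z ⟶ Y}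
    (h : e ≫ D' = D ≫ w) (h' : w ≫ a = c) : e ≫ D' ≫ a ≫ f = D ≫ c ≫ f := by
  rw [reassoc_of% h, reassoc_of% h']

open algSig in
/-- The free algebra of an `n`-operad on an object. -/
noncomputable def freeAlg [HasColimits V] (A : NOperad n V) (x : V) : A.Alg where
  carrier := carrier (freeModel A x)
  act := act (freeModel A x)
  act_unit := (Signature.free_eq_of_forall_eq (model (A := A) (x := x))
    (J := Fin 1 → (algSig A x).Term ())
    (fun ts => ts 0) (fun ts => node (Tree.linear n) ts)
    (fun ts => (λ_ _).hom ≫ single fun i : Fin 1 => dom (ts i))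
    (fun ts => single_isIso fun i : Fin 1 => dom (ts i))
    (fun ts => A.unit ▷ bigTens fun i : Fin 1 => dom (ts i))
    (fun N ts => 𝟙_ V ◁ bigTensHom fun i : Fin 1 => ev N (ts i))
    ((jointlyEpi_bigTens 1).whiskerLeft _)
    (fun N => (λ_ _).hom ≫ single fun _ : Fin 1 => carrier N)
    (fun N => A.unit ▷ bigTens (fun _ : Fin 1 => carrier N) ≫ act N (Tree.linear n))
    (fun N ts => mul_unit_aux (single_natural fun i : Fin 1 => ev N (ts i)))
    (fun _ _ => whisker_exchange_assoc _ _ _)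
    fun y => y.1.act_unit.symm).symm
  act_mul {T S} σ F ι h := (Signature.free_eq_of_forall_eq (model (A := A) (x := x))
    (J := Fin T.tips → (algSig A x).Term ())
    (fun ts => node S fun s => node (F s) fun j => ts (Tree.onTips (ι s) j)) (fun ts => node T ts)
    (fun ts => distribute (A.obj S) (fun s => A.obj (F s)) (fun i => dom (ts i)) h.onTips)
    (fun _ => distribute_isIso _ _ _ _)
    (fun ts => A.mul σ F ι h ▷ bigTens fun i => dom (ts i))
    (fun N ts => (A.obj S ⊗ bigTens fun s => A.obj (F s)) ◁ bigTensHom fun i => ev N (ts i))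
    ((jointlyEpi_bigTens T.tips).whiskerLeft _)
    (fun N => distribute (A.obj S) (fun s => A.obj (F s)) (fun _ => carrier N) h.onTips ≫
        A.obj S ◁ bigTensHom (fun s => act N (F s)) ≫ act N S)
    (fun N => A.mul σ F ι h ▷ bigTens (fun _ => carrier N) ≫ act N T)
    (fun N ts => mul_natural_aux
      (distribute_natural_right _ (fun s => A.obj (F s)) (fun i => ev N (ts i)) h.onTips)
      (whiskerLeft_bigTensHom_comp (A.obj S)
        (fun s => A.obj (F s) ◁ bigTensHom fun j => ev N (ts (Tree.onTips (ι s) j)))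
        (fun s => act N (F s))))
    (fun _ _ => whisker_exchange_assoc _ _ _)
    fun y => (y.1.act_mul σ F ι h).symm).symm

variable [HasColimits V] {A : NOperad n V} {x : V}

variable (A x) in
/-- The insertion of generators in the free algebra. -/
noncomputable def freeAlgUnit : x ⟶ A.forget.obj (freeAlg A x) := (algSig.freeModel A x).gen ()

theorem isHom_algModel {y : A.Alg} {a : x ⟶ y.carrier} (g : freeAlg A x ⟶ y)
    (h : freeAlgUnit A x ≫ A.forget.map g = a) :
    (algSig.freeModel A x).IsHom (algSig.model ⟨y, a⟩) fun _ => NOperad.Alg.Hom.hom g where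
  op T := NOperad.Alg.Hom.act g T
  gen _ := h

theorem exists_freeAlg_hom {y : A.Alg} (a : x ⟶ A.forget.obj y) :
    ∃ g : freeAlg A x ⟶ y, freeAlgUnit A x ≫ A.forget.map g = a := by
  obtain ⟨g, hg⟩ := Signature.exists_free_isHom (algSig.model (A := A) (x := x)) ⟨y, a⟩
  let g' : NOperad.Alg.Hom (freeAlg A x) y := { hom := g (), act := hg.op }
  exact ⟨g', hg.gen ()⟩

theorem freeAlg_hom_ext {y : A.Alg} {g g' : freeAlg A x ⟶ y}
    (h : freeAlgUnit A x ≫ A.forget.map g = freeAlgUnit A x ≫ A.forget.map g') : g = g' :=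
  NOperad.Alg.Hom.ext (congrFun (Signature.free_isHom_unique _ (isHom_algModel g rfl)
    (isHom_algModel g' h.symm)) ())

instance forget_isRightAdjoint (A : NOperad n V) : A.forget.IsRightAdjoint := by
  have : ∀ x : V, HasInitial (StructuredArrow x A.forget) := fun x =>
    (IsInitial.ofUniqueHom (X := StructuredArrow.mk (freeAlgUnit A x))
      (fun Y => StructuredArrow.homMk (exists_freeAlg_hom Y.hom).choose
        (exists_freeAlg_hom Y.hom).choose_spec)
      fun Y m => StructuredArrow.ext _ _ (freeAlg_hom_ext
        ((StructuredArrow.w m).trans (exists_freeAlg_hom Y.hom).choose_spec.symm))).hasInitial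
  exact isRightAdjointOfStructuredArrowInitials _

end FreeAlgebra

/-! ### Monadicity -/

section Quotient

variable {n : ℕ} {V : Type u} [Category.{v} V] [MonoidalCategory V] [SymmetricCategory V]
  {A : NOperad n V}

theorem quotient_unit_aux {V : Type u} [Category.{v} V] [MonoidalCategory V]
    {I P X X' z w : V} {e : I ⟶ P} {a : P ⊗ X ⟶ z} {l : I ⊗ X ⟶ z} {s : X' ⟶ X} {q : z ⟶ w}
    {s' : w ⟶ z} {l' : I ⊗ X' ⟶ w} (h : e ▷ X ≫ a = l) (h' : I ◁ s ≫ l = l' ≫ s')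
    (hs : s' ≫ q = 𝟙 w) : e ▷ X' ≫ P ◁ s ≫ a ≫ q = l' := by
  rw [← whisker_exchange_assoc, reassoc_of% h, reassoc_of% h', hs, Category.comp_id]

theorem quotient_mul_aux {V : Type u} [Category.{v} V] [MonoidalCategory V]
    {S P X X' W W' Y Y' z w : V} {μ : S ⟶ P} {a : P ⊗ X ⟶ z} {s : X' ⟶ X} {q : z ⟶ w}
    {D : S ⊗ X ⟶ W} {D' : S ⊗ X' ⟶ W'} {d : W ⟶ Y} {c : Y ⟶ z} {s' : W' ⟶ W} {q' : Y ⟶ Y'}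
    {c' : Y' ⟶ w} {d' : W' ⟶ Y'} (h : μ ▷ X ≫ a = D ≫ d ≫ c) (hs : S ◁ s ≫ D = D' ≫ s')
    (hq : c ≫ q = q' ≫ c') (hd : s' ≫ d ≫ q' = d') :
    μ ▷ X' ≫ P ◁ s ≫ a ≫ q = D' ≫ d' ≫ c' := by
  rw [← whisker_exchange_assoc, reassoc_of% h, reassoc_of% hs, hq, reassoc_of% hd]

/-- The algebra structure on a split quotient `q` of an algebra, if the section of `q` respects the
actions up to `q`. -/
def NOperad.Alg.quotient (z : A.Alg) {w : V} (q : z.carrier ⟶ w) (s : w ⟶ z.carrier)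
    (hs : s ≫ q = 𝟙 w)
    (hq : ∀ T, z.act T ≫ q =
      A.obj T ◁ bigTensHom (fun _ => q) ≫ A.obj T ◁ bigTensHom (fun _ => s) ≫ z.act T ≫ q) :
    A.Alg where
  carrier := w
  act T := A.obj T ◁ bigTensHom (fun _ => s) ≫ z.act T ≫ q
  act_unit := quotient_unit_aux z.act_unit
    (mul_unit_aux (single_natural fun _ : Fin 1 => s)) hs
  act_mul {T S} σ F ι h := quotient_mul_aux (z.act_mul σ F ι h)
    (distribute_natural_right _ (fun s => A.obj (F s)) (fun _ => s) h.onTips) (hq S) <| by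
      rw [whiskerLeft_bigTensHom_comp]
      exact (whiskerLeft_bigTensHom_comp _ _ _).trans rfl

variable {y z : A.Alg} {f g : y ⟶ z} {w : V} {q : z.carrier ⟶ w}

/-- The condition of `NOperad.Alg.quotient` holds for a split coequalizer of morphisms of
algebras. -/
theorem act_quotient (h : IsSplitCoequalizer (NOperad.Alg.Hom.hom f) (NOperad.Alg.Hom.hom g) q)
    (T : Tree n) :
    z.act T ≫ q = A.obj T ◁ bigTensHom (fun _ => q) ≫
      A.obj T ◁ bigTensHom (fun _ => h.rightSection) ≫ z.act T ≫ q := by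
  have e : (fun _ : Fin T.tips => q ≫ h.rightSection) =
    fun _ => h.leftSection ≫ NOperad.Alg.Hom.hom f := funext fun _ => h.leftSection_top.symm
  have e' : h.leftSection ≫ NOperad.Alg.Hom.hom g = 𝟙 _ := h.leftSection_bottom
  have c : NOperad.Alg.Hom.hom f ≫ q = NOperad.Alg.Hom.hom g ≫ q := h.condition
  have hf := NOperad.Alg.Hom.act f T
  have hg := NOperad.Alg.Hom.act g T
  rw [← Category.assoc, whiskerLeft_bigTensHom_comp, e, ← whiskerLeft_bigTensHom_comp,
    Category.assoc, ← reassoc_of% hf, c, reassoc_of% hg, ← Category.assoc,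
    whiskerLeft_bigTensHom_comp, e', bigTensHom_id, MonoidalCategory.whiskerLeft_id,
    Category.id_comp]

/-- The quotient map of a split quotient of algebras. -/
def NOperad.Alg.quotientMap
    (h : IsSplitCoequalizer (NOperad.Alg.Hom.hom f) (NOperad.Alg.Hom.hom g) q) :
    z ⟶ z.quotient q h.rightSection h.rightSection_π (act_quotient h) :=
  show NOperad.Alg.Hom _ _ from ⟨q, act_quotient h⟩

theorem NOperad.Alg.quotientMap_condition
    (h : IsSplitCoequalizer (NOperad.Alg.Hom.hom f) (NOperad.Alg.Hom.hom g) q) :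
    f ≫ quotientMap h = g ≫ quotientMap h :=
  NOperad.Alg.Hom.ext h.condition

/-- The quotient of an algebra by a pair of morphisms which has a split coequalizer in `V` is a
coequalizer. -/
def NOperad.Alg.quotientIsColimit
    (h : IsSplitCoequalizer (NOperad.Alg.Hom.hom f) (NOperad.Alg.Hom.hom g) q) :
    IsColimit (Cofork.ofπ (quotientMap h) (quotientMap_condition h)) :=
  Cofork.IsColimit.mk' _ fun c => by
    have e : NOperad.Alg.Hom.hom f ≫ NOperad.Alg.Hom.hom c.π =
        NOperad.Alg.Hom.hom g ≫ NOperad.Alg.Hom.hom c.π :=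
      congrArg NOperad.Alg.Hom.hom c.condition
    have e' : q ≫ h.rightSection ≫ NOperad.Alg.Hom.hom c.π = NOperad.Alg.Hom.hom c.π := by
      have e₁ := h.leftSection_top
      have e₂ := h.leftSection_bottom
      rw [← reassoc_of% e₁, e, reassoc_of% e₂]
    refine ⟨⟨h.rightSection ≫ NOperad.Alg.Hom.hom c.π, fun T => ?_⟩, NOperad.Alg.Hom.ext e',
      fun {m} hm => NOperad.Alg.Hom.ext ?_⟩
    · have hc := NOperad.Alg.Hom.act c.π T
      refine (Category.assoc _ _ _).trans ((congrArg (_ ≫ ·) ((Category.assoc _ _ _).trans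
        (congrArg (_ ≫ ·) e'))).trans ?_)
      exact (congrArg (_ ≫ ·) hc).trans ((Category.assoc _ _ _).symm.trans
        (congrArg (· ≫ _) (whiskerLeft_bigTensHom_comp _ _ _)))
    · have hm' : q ≫ NOperad.Alg.Hom.hom m = NOperad.Alg.Hom.hom c.π :=
        congrArg NOperad.Alg.Hom.hom hm
      have e₃ := h.rightSection_π
      exact ((reassoc_of% e₃) _).symm.trans (congrArg (_ ≫ ·) hm')

instance (A : NOperad n V) : A.forget.ReflectsIsomorphisms where
  reflects {y z} f hf := by
    obtain ⟨i, h₁, h₂⟩ : ∃ i : z.carrier ⟶ y.carrier,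
      NOperad.Alg.Hom.hom f ≫ i = 𝟙 _ ∧ i ≫ NOperad.Alg.Hom.hom f = 𝟙 _ := hf.out
    refine ⟨⟨i, fun T => ?_⟩, NOperad.Alg.Hom.ext h₁, NOperad.Alg.Hom.ext h₂⟩
    have h := NOperad.Alg.Hom.act f T
    have e : A.obj T ◁ bigTensHom (fun _ : Fin T.tips => i) ≫
        A.obj T ◁ bigTensHom (fun _ : Fin T.tips => NOperad.Alg.Hom.hom f) = 𝟙 _ := by
      rw [whiskerLeft_bigTensHom_comp, h₂, bigTensHom_id, MonoidalCategory.whiskerLeft_id]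
    have h' : z.act T = A.obj T ◁ bigTensHom (fun _ : Fin T.tips => i) ≫ y.act T ≫
        NOperad.Alg.Hom.hom f := by
      rw [h, reassoc_of% e]
    rw [h', Category.assoc, Category.assoc, h₁, Category.comp_id]

/-- **Beck's criterion** for the forgetful functor from algebras of an `n`-operad. -/
@[reducible]
noncomputable def monadicRightAdjoint {F : V ⥤ A.Alg} (adj : F ⊣ A.forget) :
    MonadicRightAdjoint A.forget :=
  have : Monad.HasCoequalizerOfIsSplitPair A.forget :=
    ⟨fun f g hfg => by
      obtain ⟨w, q, ⟨h⟩⟩ := hfg.splittable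
      exact ⟨⟨_, NOperad.Alg.quotientIsColimit h⟩⟩⟩
  have : Monad.PreservesColimitOfIsSplitPair A.forget :=
    ⟨fun f g hfg => by
      obtain ⟨w, q, ⟨h⟩⟩ := hfg.splittable
      exact preservesColimit_of_preserves_colimit_cocone (NOperad.Alg.quotientIsColimit h)
        ((isColimitMapCoconeCoforkEquiv _ _).symm h.isCoequalizer)⟩
  Monad.monadicOfHasPreservesGSplitCoequalizersOfReflectsIsomorphisms adj

theorem comparison_isEquivalence {F : V ⥤ A.Alg} (adj : F ⊣ A.forget) :
    (Monad.comparison adj).IsEquivalence :=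
  (monadicRightAdjoint adj).eqv

end Quotient

section Transfer

variable {C D D' : Type*} [Category* C] [Category* D] [Category* D'] {F : C ⥤ D} {U : D ⥤ C}

theorem monadIsoComp_aux (adj : F ⊣ U) (e : D ≌ D') (Y : D) :
    adj.counit.app Y ≫ e.unit.app Y = F.map (U.map (e.unit.app Y)) ≫
      e.unit.app (F.obj (U.obj (e.inverse.obj (e.functor.obj Y)))) ≫
      e.inverse.map (e.functor.map (adj.counit.app (e.inverse.obj (e.functor.obj Y))) ≫
        e.counit.app (e.functor.obj Y)) := by
  have h := e.unit.naturality (adj.counit.app (e.inverse.obj (e.functor.obj Y)))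
  have h' := adj.counit.naturality (e.unit.app Y)
  have h'' := e.unit_inverse_comp (e.functor.obj Y)
  dsimp at h h' h''
  rw [Functor.map_comp, ← reassoc_of% h, h'', Category.comp_id, h']

/-- The monad of an adjunction does not change along an equivalence. -/
def monadIsoComp (adj : F ⊣ U) (e : D ≌ D') :
    adj.toMonad ≅ (adj.comp e.toAdjunction).toMonad :=
  MonadIso.mk (NatIso.ofComponents (fun X => U.mapIso (e.unitIso.app (F.obj X)))
    fun {X Y} f => by
      have h := congrArg U.map (e.unit.naturality (F.map f))
      rw [U.map_comp, U.map_comp] at h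
      exact h)
    (fun X => by
      refine (congrArg (_ ≫ ·) ?_).trans (Adjunction.comp_unit_app adj e.toAdjunction X).symm
      rfl)
    fun X => by
      have h := congrArg U.map (monadIsoComp_aux adj e (F.obj X))
      rw [U.map_comp, U.map_comp, U.map_comp] at h
      refine h.trans (Eq.trans ?_ (Category.assoc _ _ _).symm)
      refine congrArg (_ ≫ ·) (congrArg (_ ≫ ·) (congrArg U.map (congrArg e.inverse.map ?_)))
      exact (Adjunction.comp_counit_app adj e.toAdjunction _).symm

theorem comparison_comp_aux (adj : F ⊣ U) (e : D ≌ D') (Y : D') :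
    e.unitInv.app (F.obj (U.obj (e.inverse.obj Y))) ≫ adj.counit.app (e.inverse.obj Y) =
      e.inverse.map (e.functor.map (adj.counit.app (e.inverse.obj Y)) ≫ e.counit.app Y) := by
  have h := e.unitInv.naturality (adj.counit.app (e.inverse.obj Y))
  dsimp at h
  rw [← h, Functor.map_comp]
  refine congrArg (_ ≫ ·) ?_
  exact e.unitInv_app_inverse Y

/-- The comparison functor of the composite of an adjunction with an equivalence. -/
def comparisonCompIso (adj : F ⊣ U) (e : D ≌ D') :
    e.inverse ⋙ Monad.comparison adj ⋙
      (Monad.algebraEquivOfIsoMonads (monadIsoComp adj e)).functor ≅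
        Monad.comparison (adj.comp e.toAdjunction) :=
  NatIso.ofComponents (fun Y => Monad.Algebra.isoMk (Iso.refl _) (by
    have h := congrArg U.map (comparison_comp_aux adj e Y)
    rw [U.map_comp] at h
    refine (congrArg (· ≫ _) (CategoryTheory.Functor.map_id _ _)).trans ((Category.id_comp _).trans
      (Eq.trans ?_ (Category.comp_id _).symm))
    refine Eq.trans (congrArg U.map (congrArg e.inverse.map ?_)) h.symm
    exact Adjunction.comp_counit_app adj e.toAdjunction Y)) fun f => by
      ext
      exact (Category.comp_id _).trans (Category.id_comp _).symm

/-- Monadicity does not change along an equivalence. -/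
theorem comparison_comp_isEquivalence (adj : F ⊣ U) [(Monad.comparison adj).IsEquivalence]
    (e : D ≌ D') : (Monad.comparison (adj.comp e.toAdjunction)).IsEquivalence :=
  Functor.isEquivalence_of_iso (comparisonCompIso adj e)

end Transfer

/-! ### The symmetrisation problem -/

section Faithful

variable {C D E : Type*} [Category* C] [Category* D] [Category* E]

/-- Functors which agree on objects, and after composition with a faithful functor, are equal. -/
theorem functor_eq_of_comp_faithful {U : D ⥤ E} [U.Faithful] {F G : C ⥤ D}
    (h : ∀ X, F.obj X = G.obj X) (h' : F ⋙ U = G ⋙ U) : F = G :=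
  CategoryTheory.Functor.ext h fun X Y f => U.map_injective <| by
    have := Functor.congr_hom h' f
    simpa [eqToHom_map] using this

end Faithful

section IsUniversal

variable {n : ℕ} {V : Type u} [Category.{v} V] [MonoidalCategory V] [SymmetricCategory V]

instance (A : NOperad n V) : A.forget.Faithful where
  map_injective h := NOperad.Alg.Hom.ext h

instance (B : SymOperad V) : B.forget.Faithful where
  map_injective h := SymOperad.Alg.Hom.ext h

theorem restrict_pull {A : NOperad n V} {B C : SymOperad V} (f : A ⟶ (Des n V).obj B) (g : B ⟶ C)
    (y : C.Alg) :
    (restrict f).obj (SymOperad.Alg.pull g y) = (restrict (f ≫ (Des n V).map g)).obj y :=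
  NOperad.Alg.eq_of_act rfl fun T => heq_of_eq <|
    (y.effect_comp (NOperad.Hom.app f T) (SymOperad.Hom.app g T.tips)).symm

variable {A : NOperad n V} {B : SymOperad V}

/-- `η` exhibits `B` as the free symmetric operad on the `n`-operad `A`. -/
def IsUniversal (η : A ⟶ (Des n V).obj B) : Prop :=
  ∀ ⦃C : SymOperad V⦄ (f : A ⟶ (Des n V).obj C), ∃! g : B ⟶ C, η ≫ (Des n V).map g = f

theorem isUniversal_unit {Sym : NOperad n V ⥤ SymOperad V} (adj : Sym ⊣ Des n V)
    (A : NOperad n V) : IsUniversal (A := A) (B := Sym.obj A) (adj.unit.app A) := by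
  intro C f
  obtain ⟨g, hg, hg'⟩ := (adj.homEquiv A C).bijective.existsUnique f
  exact ⟨g, (adj.homEquiv_unit A C g).symm.trans hg, fun g' hg₂ =>
    hg' g' ((adj.homEquiv_unit A C g').trans hg₂)⟩

variable [MonoidalClosed V] {η : A ⟶ (Des n V).obj B} (hη : IsUniversal η)

/-- An algebra of an `n`-operad as an algebra of its symmetrisation: the actions of `A` are a
morphism to the endomorphism operad, which factors through the symmetrisation. -/
noncomputable def extendObj (y : A.Alg) : B.Alg :=
  SymOperad.Alg.pull (hη y.toHom).choose (endAlg y.carrier)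

theorem restrict_extendObj (y : A.Alg) : (restrict η).obj (extendObj hη y) = y := by
  refine (restrict_pull _ _ _).trans ?_
  rw [(hη y.toHom).choose_spec.1]
  exact y.restrict_toHom

theorem extendObj_restrict (y : B.Alg) : extendObj hη ((restrict η).obj y) = y := by
  have e : y.toHom = (hη ((restrict η).obj y).toHom).choose :=
    (hη ((restrict η).obj y).toHom).choose_spec.2 y.toHom (toHom_restrict η y).symm
  exact (congrArg (fun g => SymOperad.Alg.pull g (endAlg y.carrier)) e.symm).trans y.pull_toHom

theorem effect_extendObj (y : A.Alg) (T : Tree n) :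
    (extendObj hη y).effect (NOperad.Hom.app η T) = y.act T := by
  have h' : (endAlg y.carrier).effect (NOperad.Hom.app y.toHom T) = y.act T :=
    endCurry_eval (y.act T)
  refine Eq.trans ?_ h'
  refine ((endAlg y.carrier).effect_comp (NOperad.Hom.app η T)
    (SymOperad.Hom.app (hη y.toHom).choose T.tips)).symm.trans ?_
  exact congrArg (fun f => (endAlg y.carrier).effect (NOperad.Hom.app f T))
    (hη y.toHom).choose_spec.1

variable [HasColimits V]

/-- A symmetrisation is a retract of the one which is built from terms. -/
theorem IsUniversal.exists_retraction (hη : IsUniversal η) :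
    ∃ (ψ : symObj A ⟶ B) (χ : B ⟶ symObj A), symUnit A ≫ (Des n V).map ψ = η ∧ χ ≫ ψ = 𝟙 _ := by
  obtain ⟨ψ, hψ⟩ := exists_symObj_hom η
  obtain ⟨χ, hχ, -⟩ := hη (symUnit A)
  refine ⟨ψ, χ, hψ, (hη η).unique ?_ ?_⟩
  · rw [CategoryTheory.Functor.map_comp, ← Category.assoc, hχ, hψ]
  · rw [CategoryTheory.Functor.map_id, Category.comp_id]

/-- The functor from algebras of an `n`-operad to algebras of its symmetrisation, which does not
change the underlying objects and morphisms. -/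
noncomputable def extend : A.Alg ⥤ B.Alg where
  obj := extendObj hη
  map {y z} f :=
    show SymOperad.Alg.Hom _ _ from
    { hom := NOperad.Alg.Hom.hom f
      act := fun m => by
        obtain ⟨ψ, χ, hψ, hχ⟩ := hη.exists_retraction
        refine act_comp_of_restrict (y := extendObj hη y) (z := extendObj hη z)
          (g := NOperad.Alg.Hom.hom f) η ψ χ hψ hχ (fun T => ?_) m
        exact (congrArg (· ≫ _) (effect_extendObj hη y T)).trans
          ((NOperad.Alg.Hom.act f T).trans (congrArg (_ ≫ ·) (effect_extendObj hη z T).symm)) }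
  map_id _ := rfl
  map_comp _ _ := rfl

theorem extend_restrict : extend hη ⋙ restrict η = 𝟭 _ :=
  functor_eq_of_comp_faithful (U := A.forget) (restrict_extendObj hη) rfl

theorem restrict_extend : restrict η ⋙ extend hη = 𝟭 _ :=
  functor_eq_of_comp_faithful (U := B.forget) (extendObj_restrict hη) rfl

/-- The isomorphism between the categories of algebras of an `n`-operad and of its symmetrisation,
as an equivalence. -/
noncomputable def algEquivalence : A.Alg ≌ B.Alg :=
  .mk (extend hη) (restrict η) (eqToIso (extend_restrict hη).symm) (eqToIso (restrict_extend hη))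

theorem IsUniversal.isSymmetrisation (hη : IsUniversal η) : IsSymmetrisation A B where
  monadic := ⟨monadicRightAdjoint (Adjunction.ofIsRightAdjoint A.forget)⟩
  comesFrom F adj :=
    have := comparison_isEquivalence adj
    ⟨F ⋙ extend hη, adj.comp (algEquivalence hη).toAdjunction,
      comparison_comp_isEquivalence adj (algEquivalence hη),
      ⟨monadIsoComp adj (algEquivalence hη)⟩⟩

end IsUniversal

end HigherOperad

theorem mainTheorem1 {V : Type u} [Category.{v} V] [MonoidalCategory V] [SymmetricCategory V]
    [MonoidalClosed V] [HasColimits V] (n : ℕ) :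
    (HigherOperad.Des n V).IsRightAdjoint ∧
    ∀ (Sym : HigherOperad.NOperad n V ⥤ HigherOperad.SymOperad V)
      (adj : Sym ⊣ HigherOperad.Des n V) (A : HigherOperad.NOperad n V),
      HigherOperad.IsSymmetrisation A (Sym.obj A) ∧
      ∃ Φ : A.Alg ⥤ (Sym.obj A).Alg,
        Φ ⋙ HigherOperad.restrict (adj.unit.app A) = 𝟭 _ ∧
        HigherOperad.restrict (adj.unit.app A) ⋙ Φ = 𝟭 _ :=
  ⟨inferInstance, fun _ adj A =>
    have h := HigherOperad.isUniversal_unit adj A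
    ⟨h.isSymmetrisation, HigherOperad.extend h, HigherOperad.extend_restrict h,
      HigherOperad.restrict_extend h⟩⟩
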